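/- Work in the deterministic word RAM: uniform programs with unit-cost arithmetic, comparison, bitwise and indirect-addressing operations, on words whose length is a constant times the logarithm of the size parameter. \textbf{OMv.} In the online boolean matrix-vector multiplication problem one is given a boolean $n\times n$ matrix $M$, and then $n$ boolean vectors $v^1,\dots,v^n$ of length $n$ arrive one at a time; the boolean product $Mv^i$ has to be output before $v^{i+1}$ is revealed. The \emph{OMv conjecture} says that for no $\varepsilon>0$ is there an algorithm that solves this problem in total time $O(n^{3-\varepsilon})$ (preprocessing of $M$ included). \textbf{Dynamic maximum flow.} In \emph{incremental} max $st$ flow one starts with the graph without edges on $n$ given vertices, two of which are the distinct vertices $s$ and $t$, and each operation either inserts an edge (with its capacity) that is not yet present, or asks for the value of a maximum $s$-$t$ flow in the current graph. In \emph{decremental} max $st$ flow one starts with a complete graph (given with its capacities) and each operation either deletes an edge or asks for the value of a maximum $s$-$t$ flow. All graphs are simple and without loops. Unweighted means that all capacities are $1$; weighted means that the capacities are integers between $1$ and $n^k$, for a constant $k\ge 1$. An algorithm has \emph{amortized time} $O(f(n))$ per operation if every sequence of $k'$ operations, starting from a start graph with $n$ vertices and $m_0$ edges, is processed in total time $O((n+m_0+k')\,f(n))$,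 initialization included. Words have $O(\log(n+k'))$ bits here. \textbf{Theorem.} If the OMv conjecture is true, then for every $\varepsilon>0$ there is no algorithm that solves incremental max $st$ flow with amortized time $O(n^{1-\varepsilon})$ per operation, and none that solves decremental max $st$ flow with amortized time $O(n^{1-\varepsilon})$ per operation, neither on unweighted directed graphs on $n$ vertices, nor, for any constant $k\ge1$, on weighted undirected graphs on $n$ vertices with integer capacities in $\{1,\dots,n^k\}$. -/

import Mathlib

/-! ### The word RAM

Programs are structured (`while`) programs over a random access memory whose cells hold natural
numbers.  There is one memory; fixed cells play the role of registers.  Every operation costs one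
time unit.  An execution with word bound `W` is one in which every value that is ever computed or
used as an address is smaller than `W`; with `W` polynomial in the size parameter this is the usual
word RAM with words of logarithmic length. -/

/-- The arithmetic, comparison and bitwise operations of the machine. -/
inductive RamOp
  | add | sub | mul | div | mod | eq | lt | and | or | xor | shl | shr

/-- The value of an operation (subtraction is truncated, comparisons return `0` or `1`). -/
def RamOp.eval : RamOp → ℕ → ℕ → ℕ
  | .add, a, b => a + b
  | .sub, a, b => a - b
  | .mul, a, b => a * b
  | .div, a, b => a / b
  | .mod, a, b => a % b
  | .eq, a, b => if a = b then 1 else 0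
  | .lt, a, b => if a < b then 1 else 0
  | .and, a, b => a &&& b
  | .or, a, b => a ||| b
  | .xor, a, b => a ^^^ b
  | .shl, a, b => a <<< b
  | .shr, a, b => a >>> b

/-- Memory contents. -/
abbrev RamMem := ℕ → ℕ

/-- Expressions: constants, the content of the cell with a computed address, operations. -/
inductive RamExpr
  | const (k : ℕ)
  | load (addr : RamExpr)
  | op (o : RamOp) (a b : RamExpr)

/-- The value of an expression in a memory. -/
def RamExpr.eval (m : RamMem) : RamExpr → ℕ
  | .const k => k
  | .load a => m (a.eval m)
  | .op o a b => o.eval (a.eval m) (b.eval m)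

/-- The time to evaluate an expression: the number of its constants, loads and operations. -/
def RamExpr.cost : RamExpr → ℕ
  | .const _ => 1
  | .load a => a.cost + 1
  | .op _ a b => a.cost + b.cost + 1

/-- Every value that occurs in the evaluation, addresses included, is smaller than `W`. -/
def RamExpr.Fits (W : ℕ) (m : RamMem) : RamExpr → Prop
  | .const k => k < W
  | .load a => a.Fits W m ∧ m (a.eval m) < W
  | .op o a b => a.Fits W m ∧ b.Fits W m ∧ o.eval (a.eval m) (b.eval m) < W

/-- Programs. -/
inductive RamProg
  | skip
  | store (addr val : RamExpr)
  | seq (p q : RamProg)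
  | cond (b : RamExpr) (p q : RamProg)
  | loop (b : RamExpr) (p : RamProg)

/-- `RamExec W p m m' t`: with word bound `W`, the program `p` started in memory `m` halts in memory
`m'` after exactly `t` time units, without overflow.  A condition is true if it is nonzero. -/
inductive RamExec (W : ℕ) : RamProg → RamMem → RamMem → ℕ → Prop
  | skip (m : RamMem) : RamExec W .skip m m 1
  | store (a e : RamExpr) (m : RamMem) (ha : a.Fits W m) (he : e.Fits W m) :
      RamExec W (.store a e) m (Function.update m (a.eval m) (e.eval m)) (a.cost + e.cost + 1)
  | seq {p q : RamProg} {m m₁ m₂ : RamMem} {t₁ t₂ : ℕ}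
      (hp : RamExec W p m m₁ t₁) (hq : RamExec W q m₁ m₂ t₂) :
      RamExec W (.seq p q) m m₂ (t₁ + t₂)
  | cond_true {b : RamExpr} {p q : RamProg} {m m₁ : RamMem} {t : ℕ}
      (hf : b.Fits W m) (hb : b.eval m ≠ 0) (hp : RamExec W p m m₁ t) :
      RamExec W (.cond b p q) m m₁ (b.cost + 1 + t)
  | cond_false {b : RamExpr} {p q : RamProg} {m m₁ : RamMem} {t : ℕ}
      (hf : b.Fits W m) (hb : b.eval m = 0) (hq : RamExec W q m m₁ t) :
      RamExec W (.cond b p q) m m₁ (b.cost + 1 + t)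
  | loop_true {b : RamExpr} {p : RamProg} {m m₁ m₂ : RamMem} {t₁ t₂ : ℕ}
      (hf : b.Fits W m) (hb : b.eval m ≠ 0) (hp : RamExec W p m m₁ t₁)
      (hl : RamExec W (.loop b p) m₁ m₂ t₂) :
      RamExec W (.loop b p) m m₂ (b.cost + 1 + t₁ + t₂)
  | loop_false {b : RamExpr} {p : RamProg} {m : RamMem}
      (hf : b.Fits W m) (hb : b.eval m = 0) :
      RamExec W (.loop b p) m m (b.cost + 1)

/-- Write an array into the cells `base, …, base + len - 1`. -/
def RamMem.writeArray (m : RamMem) (base len : ℕ) (x : Fin len → ℕ) : RamMem :=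
  fun a => if h : base ≤ a ∧ a - base < len then x ⟨a - base, h.2⟩ else m a

/-- Write a square matrix, row by row, into the cells `base, …, base + n * n - 1`. -/
def RamMem.writeMatrix (m : RamMem) (base n : ℕ) (x : Fin n → Fin n → ℕ) : RamMem :=
  m.writeArray base (n * n) (fun p => x p.divNat p.modNat)

/-! ### Online boolean matrix-vector multiplication -/

/-- An algorithm for online matrix-vector multiplication: one program that is run when the matrix
is given and one that is run on the arrival of each vector. -/
structure OMvAlgorithm where
  preprocess : RamProg
  round : RamProg

/-- The memory at the beginning: `n` in cell `0`, then the matrix, all other cells `0`. -/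
def OMvAlgorithm.initMem (n : ℕ) (M : Fin n → Fin n → Bool) : RamMem :=
  RamMem.writeMatrix (Function.update (fun _ => 0) 0 n) 1 n (fun i j => (M i j).toNat)

/-- The arrival of a vector: it is written into the `n` cells behind the matrix. -/
def OMvAlgorithm.receive (n : ℕ) (v : Fin n → Bool) (m : RamMem) : RamMem :=
  m.writeArray (1 + n * n) n (fun j => (v j).toNat)

/-- The answer to a vector is expected in the `n` cells behind the vector, and it has to be the
boolean product `M v`. -/
def OMvAlgorithm.AnswerCorrect {n : ℕ} (M : Fin n → Fin n → Bool) (v : Fin n → Bool)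
    (m : RamMem) : Prop :=
  ∀ i : Fin n, ((∃ j, M i j = true ∧ v j = true) → m (1 + n * n + n + i) = 1) ∧
    ((¬ ∃ j, M i j = true ∧ v j = true) → m (1 + n * n + n + i) = 0)

/-- Started in memory `m`, the algorithm answers the vectors of the list one after the other (it
sees a vector only after it has answered the ones before), correctly and in total time `T`. -/
def OMvAlgorithm.Answers (A : OMvAlgorithm) (W : ℕ) {n : ℕ} (M : Fin n → Fin n → Bool) :
    RamMem → List (Fin n → Bool) → ℕ → Prop
  | _, [], T => T = 0
  | m, v :: vs, T => ∃ (m' : RamMem) (t T' : ℕ),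
      RamExec W A.round (OMvAlgorithm.receive n v m) m' t ∧
      OMvAlgorithm.AnswerCorrect M v m' ∧ A.Answers W M m' vs T' ∧ T = t + T'

/-- The algorithm solves every instance with an `n × n` matrix and `n` vectors in total time
`O(n ^ e)`, preprocessing included, on words of `O(log n)` bits. -/
def OMvAlgorithm.SolvesInTime (A : OMvAlgorithm) (e : ℝ) : Prop :=
  ∃ (c : ℕ) (C : ℝ), ∀ n : ℕ, 1 ≤ n → ∀ (M : Fin n → Fin n → Bool) (v : Fin n → Fin n → Bool),
    ∃ (m : RamMem) (t T : ℕ),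
      RamExec ((n + 2) ^ c) A.preprocess (OMvAlgorithm.initMem n M) m t ∧
      A.Answers ((n + 2) ^ c) M m (List.ofFn v) T ∧
      ((t + T : ℕ) : ℝ) ≤ C * (n : ℝ) ^ e

/-- The OMv conjecture: no algorithm solves online boolean matrix-vector multiplication in time
`O(n ^ (3 - ε))`, for any `ε > 0`. -/
def OMvConjecture : Prop :=
  ∀ ε : ℝ, 0 < ε → ¬ ∃ A : OMvAlgorithm, A.SolvesInTime (3 - ε)

/-! ### Maximum flow -/

/-- A simple capacitated graph on the vertices `Fin n`, given by its capacities; `cap u v = 0` means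
that there is no edge from `u` to `v`.  In an undirected graph the capacities are symmetric. -/
abbrev Network (n : ℕ) := Fin n → Fin n → ℕ

/-- `f u v` is the net flow from `u` to `v`.  For an undirected edge of capacity `c` the
capacity constraint says `|f u v| ≤ c`. -/
structure IsFlow {n : ℕ} (cap : Network n) (s t : Fin n) (f : Fin n → Fin n → ℝ) : Prop where
  skew : ∀ u v, f u v = - f v u
  capacity : ∀ u v, f u v ≤ cap u v
  conservation : ∀ u, u ≠ s → u ≠ t → ∑ v, f u v = 0

/-- `x` is the maximum value of a flow from `s` to `t`. -/
def IsMaxFlowValue {n : ℕ} (cap : Network n) (s t : Fin n) (x : ℝ) : Prop :=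
  IsGreatest {y : ℝ | ∃ f, IsFlow cap s t f ∧ y = ∑ v, f s v} x

/-! ### Incremental and decremental maximum flow -/

/-- The graph classes: directed graphs with unit capacities, and undirected graphs whose
capacities are integers between `1` and `n ^ k`, where `n` is the number of vertices. -/
inductive GraphClass
  | unweightedDirected
  | weightedUndirected (k : ℕ)

/-- The largest capacity allowed on `n` vertices. -/
def GraphClass.maxCap : GraphClass → ℕ → ℕ
  | .unweightedDirected, _ => 1
  | .weightedUndirected k, n => n ^ k

/-- Set the capacity of the edge from `u` to `v` (between `u` and `v` if undirected). -/
def GraphClass.setEdge {n : ℕ} : GraphClass → Network n → Fin n → Fin n → ℕ → Network n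
  | .unweightedDirected, cap, u, v, c => fun x y => if x = u ∧ y = v then c else cap x y
  | .weightedUndirected _, cap, u, v, c =>
      fun x y => if (x = u ∧ y = v) ∨ (x = v ∧ y = u) then c else cap x y

/-- The complete graphs of the class, with arbitrary allowed capacities. -/
def GraphClass.IsComplete {n : ℕ} (g : GraphClass) (cap : Network n) : Prop :=
  (∀ u, cap u u = 0) ∧ (∀ u v, u ≠ v → 1 ≤ cap u v ∧ cap u v ≤ g.maxCap n) ∧
    match g with
    | .unweightedDirected => True
    | .weightedUndirected _ => ∀ u v, cap u v = cap v u

/-- The two partially dynamic settings: edge insertions only, or edge deletions only. -/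
inductive DynMode
  | incremental
  | decremental

/-- The start graph: no edges if incremental, complete if decremental. -/
def DynMode.IsStart {n : ℕ} : DynMode → GraphClass → Network n → Prop
  | .incremental, _, cap => ∀ u v, cap u v = 0
  | .decremental, g, cap => g.IsComplete cap

/-- The operations: set the capacity of an edge to `c` (an insertion if `c ≠ 0`, a deletion if
`c = 0`), or ask for the value of a maximum flow. -/
inductive FlowRequest (n : ℕ)
  | update (u v : Fin n) (c : ℕ)
  | query

/-- The graph after an operation. -/
def GraphClass.apply {n : ℕ} (g : GraphClass) (cap : Network n) : FlowRequest n → Network n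
  | .update u v c => g.setEdge cap u v c
  | .query => cap

/-- Queries are always allowed.  Incremental: an edge that is absent (and is not a loop) may be
inserted.  Decremental: an edge that is present may be deleted. -/
def DynMode.Allowed {n : ℕ} (g : GraphClass) (cap : Network n) : DynMode → FlowRequest n → Prop
  | _, .query => True
  | .incremental, .update u v c => u ≠ v ∧ cap u v = 0 ∧ 1 ≤ c ∧ c ≤ g.maxCap n
  | .decremental, .update u v c => cap u v ≠ 0 ∧ c = 0

/-- Every operation of the sequence is allowed at the time when it is issued. -/
def DynMode.Legal {n : ℕ} (mode : DynMode) (g : GraphClass) :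
    Network n → List (FlowRequest n) → Prop
  | _, [] => True
  | cap, r :: rs => mode.Allowed g cap r ∧ mode.Legal g (g.apply cap r) rs

/-- A dynamic maximum flow algorithm: the programs that are run at the start, at each insertion or
deletion, and at each query. -/
structure DynFlowAlgorithm where
  init : RamProg
  update : RamProg
  query : RamProg

/-- The memory at the beginning: `n`, `s`, `t` in the cells `0`, `1`, `2`, then the matrix of the
capacities of the start graph, all other cells `0`. -/
def DynFlowAlgorithm.initMem {n : ℕ} (cap : Network n) (s t : Fin n) : RamMem :=
  RamMem.writeMatrix
    (Function.update (Function.update (Function.update (fun _ => 0) 0 n) 1 (s : ℕ)) 2 (t : ℕ))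
    3 n cap

/-- The arguments of an update are written into the cells `0`, `1`, `2`. -/
def DynFlowAlgorithm.receive {n : ℕ} (m : RamMem) : FlowRequest n → RamMem
  | .update u v c =>
      Function.update (Function.update (Function.update m 0 (u : ℕ)) 1 (v : ℕ)) 2 c
  | .query => m

/-- The program that is run for an operation. -/
def DynFlowAlgorithm.prog (A : DynFlowAlgorithm) {n : ℕ} : FlowRequest n → RamProg
  | .update _ _ _ => A.update
  | .query => A.query

/-- Started in memory `m` with current graph `cap`, the algorithm handles the operations of the list
one after the other in total time `T`, and after each query cell `0` holds the maximum value of a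
flow from `s` to `t` in the current graph. -/
def DynFlowAlgorithm.Handles (A : DynFlowAlgorithm) (g : GraphClass) (W : ℕ) {n : ℕ}
    (s t : Fin n) : Network n → RamMem → List (FlowRequest n) → ℕ → Prop
  | _, _, [], T => T = 0
  | cap, m, r :: rs, T => ∃ (m' : RamMem) (τ T' : ℕ),
      RamExec W (A.prog r) (DynFlowAlgorithm.receive m r) m' τ ∧
      (r = .query → IsMaxFlowValue cap s t (m' 0 : ℝ)) ∧
      A.Handles g W s t (g.apply cap r) m' rs T' ∧ T = τ + T'

/-- The number of edges (ordered pairs, so an undirected edge counts twice). -/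
def Network.numEdges {n : ℕ} (cap : Network n) : ℕ :=
  (Finset.univ.filter (fun p : Fin n × Fin n => cap p.1 p.2 ≠ 0)).card

/-- The algorithm solves incremental (or decremental) maximum `s`-`t` flow on the graph class with
amortized time `O(n ^ e)` per operation: every legal sequence of `k` operations, from a start graph
with `n` vertices and `m₀` edges, is answered correctly in total time
`O((n + m₀ + k) * n ^ e)`, on words of `O(log (n + k))` bits.  (The vertices and edges of the start
graph count as operations; without them the requirement on the algorithm would only be harder.) -/
def DynFlowAlgorithm.SolvesInAmortizedTime (A : DynFlowAlgorithm) (mode : DynMode)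
    (g : GraphClass) (e : ℝ) : Prop :=
  ∃ (c : ℕ) (C : ℝ), ∀ (n : ℕ) (s t : Fin n), s ≠ t →
    ∀ cap : Network n, mode.IsStart g cap →
    ∀ rs : List (FlowRequest n), mode.Legal g cap rs →
    ∃ (m : RamMem) (τ T : ℕ),
      RamExec ((n + rs.length + 2) ^ c) A.init (DynFlowAlgorithm.initMem cap s t) m τ ∧
      A.Handles g ((n + rs.length + 2) ^ c) s t cap m rs T ∧
      ((τ + T : ℕ) : ℝ) ≤ C * ((n + cap.numEdges + rs.length : ℕ) : ℝ) * (n : ℝ) ^ e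

/-! ### Word bounds and weights -/

/-! Put `y = n^(1/3)` and let `B` be its integral part. The matrix is cut into `X * X` blocks of
side `B`, where `X = n / B + 1`, and the `n` rounds are cut into windows of `B` rounds. Every pair
of a block and a window gets a dynamic flow instance of its own, with `8 * B` vertices and O(B²)
requests. An algorithm with amortized time O(n^(1-ε)) handles one instance in time O(B² · B^(1-ε)),
hence all `X³` = O(y⁶) instances in time O(y^(9-ε)) = O(n^(3-ε/3)). All other work is O(y⁸), which
is no more than this as soon as ε ≤ 1.

In each round an instance decides whether its block has a nonzero entry in a given set of rows and a
given set of columns: the rows that have no witness so far and the support of the current vector.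
For round `k` there is a gadget, whose entry vertex is joined to the rows and whose exit vertex is
reached from the columns. Stage 1 provides the edge from the exit to the sink, stage 2 the edge from
the source to the entry, and stage 3 the edges from the source to the exit and from the entry to the
sink. At stage 3 the entry and the exit each carry a saturated path of length two, so a finished
gadget cannot disturb later rounds. Going from stage 1 to stage 2 raises the maximum flow exactly if
there is a path source, entry, row, column, exit, sink (`GadgetNet.value_lt_iff`): such a path
augments the stationary flow `rest` (`augmented_isFlow`), and without one `rest` saturates a cut
(`value_le_of_active`). In the incremental setting the stages ascend. In the decremental setting all
gadgets start complete at stage 3 and the stages descend, so that the same two networks are compared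
in the opposite order (`query_answers`).

For undirected graphs every middle edge from `p` to `q` is accompanied by unit edges from a copy of
the source to `q` and from `p` to a copy of the sink. The flow `rest` sends one unit along source,
copy, `q`, `p`, copy, sink. This saturates the edge in the direction from `q` to `p`, and what
remains behaves like a directed edge from `p` to `q`.

A positive answer only says that some row gets its first witness in this block. The block is then
scanned and all its rows with a witness are marked. Each scan marks a new row, so a round has at
most `n` scans, and all scans together cost O(n · n · B²) = O(y⁸) (`wp_blockRound`).

The rest is a simulation on the word RAM. The programs of the flow algorithm are relocated into
disjoint regions of memory (`reloc_prog`). Since single operations have only an amortized bound, the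
program logic `Layout.WP` carries credits, which hold the remaining running time of the simulated
instances (`Ready`). The sets of rows are defined from the true product, so the request sequence of
an instance is a function of the matrix and the vectors. The time bound can thus be applied to the
whole sequence (`exists_block_run`), although the simulation discovers it round by round. -/

theorem RamExpr.Fits.eval_lt {W : ℕ} {m : RamMem} : ∀ {e : RamExpr}, e.Fits W m → e.eval m < W
  | .const _, h => h
  | .load _, h => h.2
  | .op _ _ _, h => h.2.2

theorem RamExpr.Fits.mono {W W' : ℕ} (hW : W ≤ W') {m : RamMem} :
    ∀ {e : RamExpr}, e.Fits W m → e.Fits W' m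
  | .const _, h => lt_of_lt_of_le h hW
  | .load _, h => ⟨RamExpr.Fits.mono hW h.1, lt_of_lt_of_le h.2 hW⟩
  | .op _ _ _, h => ⟨RamExpr.Fits.mono hW h.1, RamExpr.Fits.mono hW h.2.1,
      lt_of_lt_of_le h.2.2 hW⟩

theorem RamExec.mono {W W' : ℕ} (hW : W ≤ W') {p : RamProg} {m m' : RamMem} {t : ℕ}
    (h : RamExec W p m m' t) : RamExec W' p m m' t := by
  induction h with
  | skip m => exact .skip m
  | store a e m ha he => exact .store a e m (ha.mono hW) (he.mono hW)
  | seq _ _ ihp ihq => exact .seq ihp ihq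
  | cond_true hf hb _ ih => exact .cond_true (hf.mono hW) hb ih
  | cond_false hf hb _ ih => exact .cond_false (hf.mono hW) hb ih
  | loop_true hf hb _ _ ih₁ ih₂ => exact .loop_true (hf.mono hW) hb ih₁ ih₂
  | loop_false hf hb => exact .loop_false (hf.mono hW) hb

/-- A bound for the cost of an expression, and for the exponent by which its value grows. -/
def RamExpr.weight : RamExpr → ℕ
  | .const k => k + 1
  | .load a => a.weight + 1
  | .op _ a b => a.weight + b.weight + 1

/-- The operations that do not let a value grow faster than multiplication does. -/
def RamOp.Tame : RamOp → Prop
  | .add | .sub | .mul | .div | .mod | .eq | .lt => True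
  | _ => False

/-- All operations of the expression are tame. -/
def RamExpr.Tame : RamExpr → Prop
  | .const _ => True
  | .load a => a.Tame
  | .op o a b => o.Tame ∧ a.Tame ∧ b.Tame

theorem RamExpr.cost_le_weight : ∀ e : RamExpr, e.cost ≤ e.weight
  | .const _ => by simp [cost, weight]
  | .load a => by simpa [cost, weight] using a.cost_le_weight
  | .op _ a b => by
    have := a.cost_le_weight
    have := b.cost_le_weight
    simp only [cost, weight]; omega

theorem RamOp.Tame.eval_lt {o : RamOp} (ho : o.Tame) {V p q a b : ℕ} (hV : 2 ≤ V)
    (ha : a < V ^ p) (hb : b < V ^ q) : o.eval a b < V ^ (p + q + 1) := by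
  have hp : 0 < V ^ p := by positivity
  have hq : 0 < V ^ q := by positivity
  have hpq : V ^ (p + q + 1) = V ^ p * V ^ q * V := by ring
  have h1 : V ^ p ≤ V ^ p * V ^ q := Nat.le_mul_of_pos_right _ hq
  have h2 : V ^ q ≤ V ^ p * V ^ q := Nat.le_mul_of_pos_left _ hp
  have h3 : V ^ p * V ^ q * 2 ≤ V ^ p * V ^ q * V := Nat.mul_le_mul_left _ hV
  rw [hpq]
  cases o <;> simp only [Tame] at ho <;> simp only [eval]
  · omega
  · omega
  · have : a * b < V ^ p * V ^ q := Nat.mul_lt_mul'' ha hb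
    omega
  · have := Nat.div_le_self a b
    omega
  · have := Nat.mod_le a b
    omega
  · split <;> omega
  · split <;> omega

/-- A constant `k` is below `2 ^ (k + 1)`, a load returns to the range below `V`, and a tame
operation at most multiplies the two bounds and one more `V`. The weight depends on the program text
alone, so a fixed power of `V` serves as word bound for every input. A left shift would break this,
since its result is exponential in the second operand. -/
theorem RamExpr.Tame.fits {V : ℕ} (hV : 2 ≤ V) {m : RamMem} (hm : ∀ a, m a < V) :
    ∀ {e : RamExpr}, e.Tame → e.eval m < V ^ e.weight ∧ ∀ W, V ^ e.weight ≤ W → e.Fits W m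
  | .const k, _ => by
    have : k < V ^ (k + 1) := lt_of_lt_of_le (Nat.lt_two_pow_self (n := k))
      ((Nat.pow_le_pow_left hV k).trans (Nat.pow_le_pow_right (by omega) (by omega)))
    exact ⟨this, fun W hW => lt_of_lt_of_le this hW⟩
  | .load a, h => by
    have ih := RamExpr.Tame.fits hV hm (e := a) h
    have h1 : V ^ a.weight ≤ V ^ (a.weight + 1) := Nat.pow_le_pow_right (by omega) (by omega)
    have h2 : V ^ 1 ≤ V ^ (a.weight + 1) := Nat.pow_le_pow_right (by omega) (by omega)
    have h3 := hm (a.eval m)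
    rw [pow_one] at h2
    exact ⟨lt_of_lt_of_le h3 h2, fun W hW => ⟨ih.2 W (h1.trans hW),
      lt_of_lt_of_le h3 (h2.trans hW)⟩⟩
  | .op o a b, h => by
    have iha := RamExpr.Tame.fits hV hm (e := a) h.2.1
    have ihb := RamExpr.Tame.fits hV hm (e := b) h.2.2
    have h0 := h.1.eval_lt hV iha.1 ihb.1
    have h1 : V ^ a.weight ≤ V ^ (a.weight + b.weight + 1) :=
      Nat.pow_le_pow_right (by omega) (by omega)
    have h2 : V ^ b.weight ≤ V ^ (a.weight + b.weight + 1) :=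
      Nat.pow_le_pow_right (by omega) (by omega)
    exact ⟨h0, fun W hW => ⟨iha.2 W (h1.trans hW), ihb.2 W (h2.trans hW), lt_of_lt_of_le h0 hW⟩⟩

/-- The largest weight of an expression in a program. -/
def RamProg.weight : RamProg → ℕ
  | .skip => 1
  | .store a e => max a.weight e.weight
  | .seq p q => max p.weight q.weight
  | .cond b p q => max b.weight (max p.weight q.weight)
  | .loop b p => max b.weight p.weight

/-! ### Source expressions -/

/-- The number `1` if the arguments are equal, and `0` otherwise. -/
def eqNat (a b : ℕ) : ℕ := if a = b then 1 else 0

/-- The number `1` if the first argument is smaller, and `0` otherwise. -/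
def ltNat (a b : ℕ) : ℕ := if a < b then 1 else 0

theorem ltNat_ne_zero {a b : ℕ} : ltNat a b ≠ 0 ↔ a < b := by simp [ltNat]

theorem eqNat_le_one (a b : ℕ) : eqNat a b ≤ 1 := by unfold eqNat; split <;> omega

theorem ltNat_le_one (a b : ℕ) : ltNat a b ≤ 1 := by unfold ltNat; split <;> omega

theorem ltNat_of_lt {a b : ℕ} (h : a < b) : ltNat a b = 1 := if_pos h

theorem ltNat_of_not_lt {a b : ℕ} (h : ¬ a < b) : ltNat a b = 0 := if_neg h

/-- The operations of source expressions. -/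
inductive SrcOp
  | add | sub | mul | div | mod | eq | lt

/-- The machine operation of a source operation. -/
def SrcOp.toRam : SrcOp → RamOp
  | .add => .add
  | .sub => .sub
  | .mul => .mul
  | .div => .div
  | .mod => .mod
  | .eq => .eq
  | .lt => .lt

theorem SrcOp.tame_toRam (o : SrcOp) : o.toRam.Tame := by cases o <;> trivial

/-- Expressions over the size, the matrix, the current vector, the current answer and
registers.  Indices of arrays are taken modulo the length of the array. -/
inductive SrcExpr
  | const (k : ℕ)
  | size
  | reg (r : Fin 32)
  | mat (e : SrcExpr)
  | vec (e : SrcExpr)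
  | ans (e : SrcExpr)
  | bin (o : SrcOp) (a b : SrcExpr)

namespace SrcExpr

instance : Add SrcExpr := ⟨bin .add⟩
instance : Sub SrcExpr := ⟨bin .sub⟩
instance : Mul SrcExpr := ⟨bin .mul⟩
instance : Div SrcExpr := ⟨bin .div⟩
instance : Mod SrcExpr := ⟨bin .mod⟩
instance (k : ℕ) : OfNat SrcExpr k := ⟨const k⟩

/-- The test for equality. -/
def eqb (a b : SrcExpr) : SrcExpr := bin .eq a b

/-- The test for `<`. -/
def ltb (a b : SrcExpr) : SrcExpr := bin .lt a b

end SrcExpr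

/-- The memory layout: the size `n`, the matrix, the vector, the answer, 32 registers and `cnt`
regions of size `S`.  All memory contents are smaller than `V`, the word bound is `V ^ K`. -/
structure Layout where
  n : ℕ
  mat : ℕ → ℕ
  S : ℕ
  cnt : ℕ
  V : ℕ
  K : ℕ

/-- The variable part of the memory. -/
structure St where
  reg : Fin 32 → ℕ
  vec : ℕ → ℕ
  ans : ℕ → ℕ
  inst : ℕ → RamMem

/-- Set a register. -/
def St.setReg (st : St) (r : Fin 32) (v : ℕ) : St := { st with reg := Function.update st.reg r v }

/-- Set an entry of the answer. -/
def St.setAns (st : St) (i v : ℕ) : St := { st with ans := Function.update st.ans i v }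

/-- Set the contents of a region. -/
def St.setInst (st : St) (q : ℕ) (μ : RamMem) : St :=
  { st with inst := Function.update st.inst q μ }

namespace Layout

/-- The word bound. -/
def W (L : Layout) : ℕ := L.V ^ L.K

/-- The start of the regions. -/
def off (L : Layout) : ℕ := 1 + L.n * L.n + L.n + L.n + 32

/-- The start of a region. -/
def base (L : Layout) (q : ℕ) : ℕ := L.off + q * L.S

/-- The parameters are consistent. -/
structure Valid (L : Layout) : Prop where
  n_pos : 0 < L.n
  le_V : L.off + L.cnt * L.S + L.S < L.V
  le_K : 100 ≤ L.K

/-- The memory `m` represents the state `st`. -/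
structure Rep (L : Layout) (m : RamMem) (st : St) : Prop where
  size : m 0 = L.n
  mat : ∀ a < L.n * L.n, m (1 + a) = L.mat a
  vec : ∀ a < L.n, m (1 + L.n * L.n + a) = st.vec a
  ans : ∀ a < L.n, m (1 + L.n * L.n + L.n + a) = st.ans a
  reg : ∀ r : Fin 32, m (1 + L.n * L.n + L.n + L.n + r) = st.reg r
  inst : ∀ q < L.cnt, ∀ a < L.S, m (L.base q + a) = st.inst q a
  bdd : ∀ a, m a < L.V

end Layout

namespace SrcExpr

/-- The value of a source expression. -/
def eval (L : Layout) (st : St) : SrcExpr → ℕ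
  | const k => k
  | size => L.n
  | reg r => st.reg r
  | mat e => L.mat (e.eval L st % (L.n * L.n))
  | vec e => st.vec (e.eval L st % L.n)
  | ans e => st.ans (e.eval L st % L.n)
  | bin o a b => o.toRam.eval (a.eval L st) (b.eval L st)

section
variable (L : Layout) (st : St) (a b : SrcExpr)

@[simp] theorem eval_add : (a + b).eval L st = a.eval L st + b.eval L st := rfl
@[simp] theorem eval_sub : (a - b).eval L st = a.eval L st - b.eval L st := rfl
@[simp] theorem eval_mul : (a * b).eval L st = a.eval L st * b.eval L st := rfl
@[simp] theorem eval_div : (a / b).eval L st = a.eval L st / b.eval L st := rfl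
@[simp] theorem eval_mod : (a % b).eval L st = a.eval L st % b.eval L st := rfl
@[simp] theorem eval_eqb : (a.eqb b).eval L st = eqNat (a.eval L st) (b.eval L st) := rfl
@[simp] theorem eval_ltb : (a.ltb b).eval L st = ltNat (a.eval L st) (b.eval L st) := rfl
@[simp] theorem eval_ofNat (k : ℕ) [k.AtLeastTwo] : (ofNat(k) : SrcExpr).eval L st = k := rfl
@[simp] theorem eval_zero : (0 : SrcExpr).eval L st = 0 := rfl
@[simp] theorem eval_one : (1 : SrcExpr).eval L st = 1 := rfl
@[simp] theorem eval_const (k : ℕ) : (const k).eval L st = k := rfl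
@[simp] theorem eval_size : size.eval L st = L.n := rfl
@[simp] theorem eval_reg (r : Fin 32) : (reg r).eval L st = st.reg r := rfl
@[simp] theorem eval_mat : (mat a).eval L st = L.mat (a.eval L st % (L.n * L.n)) := rfl
@[simp] theorem eval_vec : (vec a).eval L st = st.vec (a.eval L st % L.n) := rfl
@[simp] theorem eval_ans : (ans a).eval L st = st.ans (a.eval L st % L.n) := rfl

end

/-- The content of cell `0`. -/
def ramSize : RamExpr := .load (.const 0)

/-- The square of the content of cell `0`. -/
def ramSq : RamExpr := .op .mul ramSize ramSize

/-- The address of a vector entry. -/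
def vecAddr (i : RamExpr) : RamExpr := .op .add (.op .add (.const 1) ramSq) i

/-- The address of an answer entry. -/
def ansAddr (i : RamExpr) : RamExpr :=
  .op .add (.op .add (.op .add (.const 1) ramSq) ramSize) i

/-- The address of a register. -/
def regAddr (r : Fin 32) : RamExpr :=
  .op .add (.op .add (.op .add (.op .add (.const 1) ramSq) ramSize) ramSize) (.const r)

/-- Compilation of source expressions. -/
def compile : SrcExpr → RamExpr
  | const k => .const k
  | size => ramSize
  | reg r => .load (regAddr r)
  | mat e => .load (.op .add (.const 1) (.op .mod e.compile ramSq))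
  | vec e => .load (vecAddr (.op .mod e.compile ramSize))
  | ans e => .load (ansAddr (.op .mod e.compile ramSize))
  | bin o a b => .op o.toRam a.compile b.compile

theorem tame_compile : ∀ e : SrcExpr, e.compile.Tame
  | const k => trivial
  | size => trivial
  | reg r => by simp [compile, regAddr, ramSq, ramSize, RamExpr.Tame, RamOp.Tame]
  | mat e => by simp [compile, ramSq, ramSize, RamExpr.Tame, RamOp.Tame, e.tame_compile]
  | vec e => by simp [compile, vecAddr, ramSq, ramSize, RamExpr.Tame, RamOp.Tame, e.tame_compile]
  | ans e => by simp [compile, ansAddr, ramSq, ramSize, RamExpr.Tame, RamOp.Tame, e.tame_compile]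
  | bin o a b => ⟨o.tame_toRam, a.tame_compile, b.tame_compile⟩

theorem eval_regAddr {L : Layout} {m : RamMem} (h : m 0 = L.n) (r : Fin 32) :
    (regAddr r).eval m = 1 + L.n * L.n + L.n + L.n + r := by
  simp [regAddr, ramSq, ramSize, RamExpr.eval, RamOp.eval, h]

theorem eval_compile {L : Layout} (hL : L.Valid) {m : RamMem} {st : St} (h : L.Rep m st) :
    ∀ e : SrcExpr, e.compile.eval m = e.eval L st
  | const k => rfl
  | size => h.size
  | reg r => by simp [compile, RamExpr.eval, eval_regAddr h.size, h.reg]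
  | mat e => by
    simp only [compile, ramSq, ramSize, RamExpr.eval, RamOp.eval, h.size,
      eval_compile hL h e, eval]
    exact h.mat _ (Nat.mod_lt _ (Nat.mul_pos hL.n_pos hL.n_pos))
  | vec e => by
    simp only [compile, vecAddr, ramSq, ramSize, RamExpr.eval, RamOp.eval, h.size,
      eval_compile hL h e, eval]
    exact h.vec _ (Nat.mod_lt _ hL.n_pos)
  | ans e => by
    simp only [compile, ansAddr, ramSq, ramSize, RamExpr.eval, RamOp.eval, h.size,
      eval_compile hL h e, eval]
    exact h.ans _ (Nat.mod_lt _ hL.n_pos)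
  | bin o a b => by
    simp only [compile, RamExpr.eval, eval_compile hL h a, eval_compile hL h b, eval]

end SrcExpr

/-! ### Writing to memory -/

namespace Layout

variable {L : Layout}

theorem Valid.two_le (hL : L.Valid) : 2 ≤ L.V := by
  have := hL.le_V
  unfold off at this
  omega

theorem base_add_lt (hL : L.Valid) {q a : ℕ} (hq : q < L.cnt) (ha : a < L.S) :
    L.base q + a < L.V := by
  have := hL.le_V
  have h2 : (q + 1) * L.S ≤ L.cnt * L.S := Nat.mul_le_mul_right _ hq
  have h3 : (q + 1) * L.S = q * L.S + L.S := by ring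
  unfold base
  omega

theorem base_lt (hL : L.Valid) {q : ℕ} (hq : q < L.cnt) : L.base q < L.V := by
  have := hL.le_V
  have h2 : q * L.S ≤ L.cnt * L.S := Nat.mul_le_mul_right _ hq.le
  unfold base
  omega

theorem base_add_ne {q q' a a' : ℕ} (hqq : q ≠ q') (ha : a < L.S) (ha' : a' < L.S) :
    L.base q + a ≠ L.base q' + a' := by
  unfold base
  rcases Nat.lt_or_gt_of_ne hqq with h | h
  · have h2 : (q + 1) * L.S ≤ q' * L.S := Nat.mul_le_mul_right _ h
    have h3 : (q + 1) * L.S = q * L.S + L.S := by ring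
    omega
  · have h2 : (q' + 1) * L.S ≤ q * L.S := Nat.mul_le_mul_right _ h
    have h3 : (q' + 1) * L.S = q' * L.S + L.S := by ring
    omega

theorem update_lt {m : RamMem} (hm : ∀ a, m a < L.V) (x : ℕ) {v : ℕ} (hv : v < L.V) (a : ℕ) :
    Function.update m x v a < L.V := by
  by_cases h : a = x
  · subst h; simpa using hv
  · simpa [h] using hm a

theorem Rep.setReg {m : RamMem} {st : St} (h : L.Rep m st) (r : Fin 32) {v : ℕ} (hv : v < L.V) :
    L.Rep (Function.update m (1 + L.n * L.n + L.n + L.n + r) v) (st.setReg r v) := by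
  have hr := r.2
  constructor
  · rw [Function.update_of_ne (by omega)]; exact h.size
  · intro a ha
    rw [Function.update_of_ne (by omega)]; exact h.mat a ha
  · intro a ha
    rw [Function.update_of_ne (by omega)]; exact h.vec a ha
  · intro a ha
    rw [Function.update_of_ne (by omega)]; exact h.ans a ha
  · intro r'
    by_cases hrr : r' = r
    · subst hrr; simp [St.setReg]
    · have : (r' : ℕ) ≠ r := fun e => hrr (Fin.ext e)
      rw [Function.update_of_ne (by omega)]
      simp [St.setReg, hrr, h.reg]
  · intro q hq a ha
    rw [Function.update_of_ne (by unfold base off; omega)]; exact h.inst q hq a ha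
  · exact update_lt h.bdd _ hv

theorem Rep.setAns {m : RamMem} {st : St} (h : L.Rep m st) {i v : ℕ} (hi : i < L.n)
    (hv : v < L.V) :
    L.Rep (Function.update m (1 + L.n * L.n + L.n + i) v) (st.setAns i v) := by
  constructor
  · rw [Function.update_of_ne (by omega)]; exact h.size
  · intro a ha
    rw [Function.update_of_ne (by omega)]; exact h.mat a ha
  · intro a ha
    rw [Function.update_of_ne (by omega)]; exact h.vec a ha
  · intro a ha
    by_cases hrr : a = i
    · subst hrr; simp [St.setAns]
    · rw [Function.update_of_ne (by omega)]
      simp [St.setAns, hrr, h.ans a ha]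
  · intro r
    rw [Function.update_of_ne (by omega)]; exact h.reg r
  · intro q hq a ha
    rw [Function.update_of_ne (by unfold base off; omega)]; exact h.inst q hq a ha
  · exact update_lt h.bdd _ hv

theorem Rep.setInst {m : RamMem} {st : St} (h : L.Rep m st) {q a v : ℕ} (hq : q < L.cnt)
    (ha : a < L.S) (hv : v < L.V) :
    L.Rep (Function.update m (L.base q + a) v)
      (st.setInst q (Function.update (st.inst q) a v)) := by
  have hb : L.base q = 1 + L.n * L.n + L.n + L.n + 32 + q * L.S := rfl
  constructor
  · rw [Function.update_of_ne (by omega)]; exact h.size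
  · intro a ha
    rw [Function.update_of_ne (by omega)]; exact h.mat a ha
  · intro a ha
    rw [Function.update_of_ne (by omega)]; exact h.vec a ha
  · intro a ha
    rw [Function.update_of_ne (by omega)]; exact h.ans a ha
  · intro r
    rw [Function.update_of_ne (by omega)]; exact h.reg r
  · intro q' hq' a' ha'
    by_cases hqq : q' = q
    · subst hqq
      by_cases haa : a' = a
      · subst haa; simp [St.setInst]
      · rw [Function.update_of_ne (by omega)]
        simp [St.setInst, haa, h.inst q' hq' a' ha']
    · rw [Function.update_of_ne (base_add_ne hqq ha' ha)]
      simp [St.setInst, hqq, h.inst q' hq' a' ha']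
  · exact update_lt h.bdd _ hv

end Layout

/-! ### Relocation of programs -/

/-- The base address of the current region is kept in register `0`. -/
def curBase : RamExpr := (SrcExpr.reg 0).compile

/-- Access the memory relative to the current base address. -/
def RamExpr.reloc : RamExpr → RamExpr
  | .const k => .const k
  | .load a => .load (.op .add curBase (a.reloc))
  | .op o a b => .op o (a.reloc) (b.reloc)

/-- Run a program on the memory that starts at the current base address. -/
def RamProg.reloc : RamProg → RamProg
  | .skip => .skip
  | .store a e => .store (.op .add curBase (a.reloc)) (e.reloc)
  | .seq p q => .seq (p.reloc) (q.reloc)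
  | .cond b p q => .cond (b.reloc) (p.reloc) (q.reloc)
  | .loop b p => .loop (b.reloc) (p.reloc)

namespace Layout

variable {L : Layout}

theorem Valid.le_W (hL : L.Valid) : L.V ≤ L.W := by
  have h1 : L.V ^ 1 ≤ L.V ^ L.K :=
    Nat.pow_le_pow_right (by have := hL.two_le; omega) (by have := hL.le_K; omega)
  simpa [W] using h1

theorem fits_compile (hL : L.Valid) {m : RamMem} {st : St} (h : L.Rep m st) {e : RamExpr}
    (ht : e.Tame) (he : e.weight ≤ L.K) : e.Fits L.W m :=
  (ht.fits hL.two_le h.bdd).2 _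
    (Nat.pow_le_pow_right (by have := hL.two_le; omega) he)

theorem curBase_spec (hL : L.Valid) {m : RamMem} {st : St} (h : L.Rep m st) :
    curBase.eval m = st.reg 0 ∧ curBase.Fits L.W m :=
  ⟨SrcExpr.eval_compile hL h _, fits_compile hL h (SrcExpr.tame_compile _)
    (le_trans (by decide) hL.le_K)⟩

/-- The simulated program may use every operation, shifts included; its bounds are not derived but
inherited from its own word bound `W ≤ L.S`. For the same reason all its addresses stay inside the
region. Each load gains an addition and the evaluation of `curBase`, which accounts for the factor
20. -/
theorem reloc_expr (hL : L.Valid) {q : ℕ} (hq : q < L.cnt) {W : ℕ} (hW : W ≤ L.S) {m : RamMem}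
    {st : St} (h : L.Rep m st) (hb : st.reg 0 = L.base q) :
    ∀ {e : RamExpr}, e.Fits W (st.inst q) →
      (e.reloc).eval m = e.eval (st.inst q) ∧ (e.reloc).Fits L.W m ∧
        (e.reloc).cost ≤ 20 * e.cost
  | .const k, hf => by
    refine ⟨rfl, ?_, by simp [RamExpr.reloc, RamExpr.cost]⟩
    have h1 : L.S ≤ L.V := by have := hL.le_V; omega
    exact lt_of_lt_of_le hf (hW.trans (h1.trans hL.le_W))
  | .load a, hf => by
    obtain ⟨h1, h2, h3⟩ := reloc_expr hL hq hW h hb (e := a) hf.1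
    obtain ⟨h4, h5⟩ := curBase_spec hL h
    have ha : a.eval (st.inst q) < L.S := lt_of_lt_of_le hf.1.eval_lt hW
    have h6 : curBase.cost ≤ 18 := by decide
    have hev : (RamExpr.reloc (.load a)).eval m = (RamExpr.load a).eval (st.inst q) := by
      simp only [RamExpr.reloc, RamExpr.eval, RamOp.eval, h1, h4, hb]
      exact h.inst q hq _ ha
    refine ⟨hev, ⟨⟨h5, h2, ?_⟩, ?_⟩, ?_⟩
    · rw [h1, h4, hb]
      exact lt_of_lt_of_le (base_add_lt hL hq ha) hL.le_W
    · exact lt_of_lt_of_le (h.bdd _) hL.le_W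
    · simp only [RamExpr.reloc, RamExpr.cost]; omega
  | .op o a b, hf => by
    obtain ⟨h1, h2, h3⟩ := reloc_expr hL hq hW h hb (e := a) hf.1
    obtain ⟨h4, h5, h6⟩ := reloc_expr hL hq hW h hb (e := b) hf.2.1
    refine ⟨by simp only [RamExpr.reloc, RamExpr.eval, h1, h4], ⟨h2, h5, ?_⟩, ?_⟩
    · rw [h1, h4]
      have h1 : L.S ≤ L.V := by have := hL.le_V; omega
      exact lt_of_lt_of_le hf.2.2 (hW.trans (h1.trans hL.le_W))
    · simp only [RamExpr.reloc, RamExpr.cost]; omega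

/-- The base address is kept in a register, outside all regions. The simulated program therefore
cannot change it, and the hypothesis on register 0 survives sequencing and loops. -/
theorem reloc_prog (hL : L.Valid) {q : ℕ} (hq : q < L.cnt) {W : ℕ} (hW : W ≤ L.S)
    {p : RamProg} {μ μ' : RamMem} {t : ℕ} (hp : RamExec W p μ μ' t) :
    ∀ {m : RamMem} {st : St}, L.Rep m st → st.reg 0 = L.base q → st.inst q = μ →
      ∃ m' t', RamExec L.W (p.reloc) m m' t' ∧ L.Rep m' (st.setInst q μ') ∧
        t' ≤ 30 * t := by
  induction hp with
  | skip μ =>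
    intro m st h _ hi
    refine ⟨m, 1, .skip m, ?_, by omega⟩
    have : st.setInst q μ = st := by
      subst hi; simp [St.setInst]
    rwa [this]
  | store a e μ ha he =>
    intro m st h hb hi
    subst hi
    obtain ⟨h1, h2, h3⟩ := reloc_expr hL hq hW h hb ha
    obtain ⟨h4, h5, h6⟩ := reloc_expr hL hq hW h hb he
    obtain ⟨h7, h8⟩ := curBase_spec hL h
    have hal : a.eval (st.inst q) < L.S := lt_of_lt_of_le ha.eval_lt hW
    have hel : e.eval (st.inst q) < L.S := lt_of_lt_of_le he.eval_lt hW
    have hadd : (RamExpr.op .add curBase (a.reloc)).eval m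
        = L.base q + a.eval (st.inst q) := by
      simp only [RamExpr.eval, RamOp.eval, h1, h7, hb]
    refine ⟨_, _, .store _ _ m ⟨h8, h2, ?_⟩ h5, ?_, ?_⟩
    · rw [h1, h7, hb]
      exact lt_of_lt_of_le (base_add_lt hL hq hal) hL.le_W
    · rw [hadd, h4]
      exact h.setInst hq hal (by have := hL.le_V; omega)
    · have h9 : curBase.cost ≤ 18 := by decide
      have h10 : 1 ≤ e.cost := by cases e <;> simp [RamExpr.cost]
      simp only [RamExpr.cost]; omega
  | seq _ _ ihp ihq =>
    intro m st h hb hi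
    obtain ⟨m₁, t₁, e₁, r₁, l₁⟩ := ihp h hb hi
    obtain ⟨m₂, t₂, e₂, r₂, l₂⟩ := ihq r₁ hb (by simp [St.setInst])
    refine ⟨m₂, _, .seq e₁ e₂, ?_, by omega⟩
    simpa [St.setInst] using r₂
  | cond_true hf hbv _ ih =>
    intro m st h hb hi
    subst hi
    obtain ⟨h1, h2, h3⟩ := reloc_expr hL hq hW h hb hf
    obtain ⟨m₁, t₁, e₁, r₁, l₁⟩ := ih h hb rfl
    exact ⟨m₁, _, .cond_true h2 (by rwa [h1]) e₁, r₁, by omega⟩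
  | cond_false hf hbv _ ih =>
    intro m st h hb hi
    subst hi
    obtain ⟨h1, h2, h3⟩ := reloc_expr hL hq hW h hb hf
    obtain ⟨m₁, t₁, e₁, r₁, l₁⟩ := ih h hb rfl
    exact ⟨m₁, _, .cond_false h2 (by rwa [h1]) e₁, r₁, by omega⟩
  | loop_true hf hbv _ _ ih₁ ih₂ =>
    intro m st h hb hi
    subst hi
    obtain ⟨h1, h2, h3⟩ := reloc_expr hL hq hW h hb hf
    obtain ⟨m₁, t₁, e₁, r₁, l₁⟩ := ih₁ h hb rfl
    obtain ⟨m₂, t₂, e₂, r₂, l₂⟩ := ih₂ r₁ hb (by simp [St.setInst])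
    refine ⟨m₂, _, .loop_true h2 (by rwa [h1]) e₁ e₂, ?_, by omega⟩
    simpa [St.setInst] using r₂
  | loop_false hf hbv =>
    intro m st h hb hi
    subst hi
    obtain ⟨h1, h2, h3⟩ := reloc_expr hL hq hW h hb hf
    refine ⟨m, _, .loop_false h2 (by rwa [h1]), ?_, by omega⟩
    simpa [St.setInst] using h

end Layout

/-! ### Source statements and a program logic with time and credits -/

infixr:60 " ;; " => RamProg.seq

namespace SrcExpr

/-- Assign to a register. -/
def assign (r : Fin 32) (e : SrcExpr) : RamProg := .store (regAddr r) e.compile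

/-- Assign to an entry of the answer. -/
def assignAns (i e : SrcExpr) : RamProg :=
  .store (ansAddr (.op .mod i.compile ramSize)) e.compile

/-- Assign to a cell of the current region. -/
def assignCell (a e : SrcExpr) : RamProg := .store (.op .add curBase a.compile) e.compile

/-- Assign the content of cell `0` of the current region to a register. -/
def fetch (r : Fin 32) : RamProg := .store (regAddr r) (.load curBase)

/-- Conditional execution. -/
def branch (b : SrcExpr) (p q : RamProg) : RamProg := .cond b.compile p q

/-- A loop in which the register `r` counts from `0` to the value of `bound`. -/
def forLoop (r : Fin 32) (bound : SrcExpr) (body : RamProg) : RamProg :=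
  assign r 0 ;; .loop ((reg r).ltb bound).compile (body ;; assign r (reg r + 1))

end SrcExpr

open SrcExpr

namespace Layout

variable {L : Layout}

/-- Started in the state `st` with `φ` credits, `p` halts in a state and with a number of credits
that satisfy `Q`, and the time is at most `3 * K * T` plus the credits spent. -/
def WP (L : Layout) (p : RamProg) (T : ℕ) (Q : St → ℕ → Prop) (st : St) (φ : ℕ) : Prop :=
  L.Valid → p.weight ≤ L.K → ∀ m, L.Rep m st → ∃ m' t st' φ', RamExec L.W p m m' t ∧
    L.Rep m' st' ∧ Q st' φ' ∧ t + φ' ≤ 3 * L.K * T + φ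

namespace WP

variable {p q : RamProg} {T T' T₁ T₂ φ : ℕ} {Q Q' : St → ℕ → Prop} {st : St}

/-- Credits may be thrown away: the new postcondition can be met with fewer of them. -/
theorem mono (h : L.WP p T Q st φ) (hT : T ≤ T')
    (hQ : ∀ st' φ', Q st' φ' → ∃ ψ ≤ φ', Q' st' ψ) : L.WP p T' Q' st φ := by
  intro hL hw m hm
  obtain ⟨m', t, st', φ', he, hr, hq, ht⟩ := h hL hw m hm
  obtain ⟨ψ, hψ, hq'⟩ := hQ _ _ hq
  have := Nat.mul_le_mul_left (3 * L.K) hT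
  exact ⟨m', t, st', ψ, he, hr, hq', by omega⟩

theorem mono_time (h : L.WP p T Q st φ) (hT : T ≤ T') : L.WP p T' Q st φ :=
  h.mono hT fun _ φ' hq => ⟨φ', le_rfl, hq⟩

theorem mono_post (h : L.WP p T Q st φ) (hQ : ∀ st' φ', Q st' φ' → Q' st' φ') :
    L.WP p T Q' st φ :=
  h.mono le_rfl fun _ φ' hq => ⟨φ', le_rfl, hQ _ _ hq⟩

/-- Running time and credits are exchangeable at the rate `3 * K` per time unit. This direction
lends credits at the start of a program against a larger time bound; `use_credits` pays for time out
of credits at hand. -/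
theorem of_credits (h : L.WP p T Q st (φ + 3 * L.K * T')) : L.WP p (T + T') Q st φ := by
  intro hL hw m hm
  obtain ⟨m', t, st', φ', he, hr, hq, ht⟩ := h hL hw m hm
  exact ⟨m', t, st', φ', he, hr, hq, by rw [Nat.mul_add]; omega⟩

theorem use_credits (h : L.WP p (T + T') Q st φ) : L.WP p T Q st (φ + 3 * L.K * T') := by
  intro hL hw m hm
  obtain ⟨m', t, st', φ', he, hr, hq, ht⟩ := h hL hw m hm
  exact ⟨m', t, st', φ', he, hr, hq, by rw [Nat.mul_add] at ht; omega⟩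

theorem skip (h : Q st φ) : L.WP .skip 1 Q st φ := by
  intro hL hw m hm
  exact ⟨m, 1, st, φ, .skip m, hm, h, by have := hL.le_K; omega⟩

theorem seq (h : L.WP p T₁ (fun st' φ' => L.WP q T₂ Q st' φ') st φ) :
    L.WP (p ;; q) (T₁ + T₂) Q st φ := by
  intro hL hw m hm
  simp only [RamProg.weight, max_le_iff] at hw
  obtain ⟨m₁, t₁, st₁, φ₁, he₁, hr₁, hq₁, ht₁⟩ := h hL hw.1 m hm
  obtain ⟨m₂, t₂, st₂, φ₂, he₂, hr₂, hq₂, ht₂⟩ := hq₁ hL hw.2 m₁ hr₁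
  exact ⟨m₂, t₁ + t₂, st₂, φ₂, .seq he₁ he₂, hr₂, hq₂, by rw [Nat.mul_add]; omega⟩

theorem branch {b : SrcExpr} (h₁ : b.eval L st ≠ 0 → L.WP p T Q st φ)
    (h₂ : b.eval L st = 0 → L.WP q T Q st φ) : L.WP (b.branch p q) (T + 1) Q st φ := by
  intro hL hw m hm
  simp only [RamProg.weight, SrcExpr.branch, max_le_iff] at hw
  have hf := fits_compile hL hm b.tame_compile hw.1
  have he := eval_compile hL hm b
  have hc := b.compile.cost_le_weight
  have hK := hL.le_K
  by_cases hb : b.eval L st = 0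
  · obtain ⟨m', t, st', φ', h1, h2, h3, h4⟩ := h₂ hb hL hw.2.2 m hm
    exact ⟨m', _, st', φ', .cond_false hf (he.trans hb) h1, h2, h3, by rw [Nat.mul_add]; omega⟩
  · obtain ⟨m', t, st', φ', h1, h2, h3, h4⟩ := h₁ hb hL hw.2.1 m hm
    exact ⟨m', _, st', φ', .cond_true hf (by rwa [he]) h1, h2, h3, by rw [Nat.mul_add]; omega⟩

theorem tame_regAddr (r : Fin 32) : (regAddr r).Tame := by
  simp [regAddr, ramSq, ramSize, RamExpr.Tame, RamOp.Tame]

theorem assign {r : Fin 32} {e : SrcExpr} (hv : e.eval L st < L.V)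
    (h : Q (st.setReg r (e.eval L st)) φ) : L.WP (assign r e) 1 Q st φ := by
  intro hL hw m hm
  simp only [RamProg.weight, SrcExpr.assign, max_le_iff] at hw
  have hr := hm.setReg r hv
  have hf := fits_compile hL hm e.tame_compile hw.2
  have hf' := fits_compile hL hm (tame_regAddr r) hw.1
  rw [← eval_compile hL hm e, ← eval_regAddr hm.size r] at hr
  refine ⟨_, _, _, φ, .store _ _ m hf' hf, hr, by rwa [eval_compile hL hm e], ?_⟩
  have := e.compile.cost_le_weight
  have := (regAddr r).cost_le_weight
  have := hL.le_K
  omega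

theorem assignAns {i e : SrcExpr} (hv : e.eval L st < L.V)
    (h : Q (st.setAns (i.eval L st % L.n) (e.eval L st)) φ) :
    L.WP (assignAns i e) 1 Q st φ := by
  intro hL hw m hm
  simp only [RamProg.weight, SrcExpr.assignAns, max_le_iff] at hw
  have hr := hm.setAns (Nat.mod_lt (i.eval L st) hL.n_pos) hv
  have hf := fits_compile hL hm e.tame_compile hw.2
  have hf' := fits_compile hL hm (e := ansAddr (.op .mod i.compile ramSize))
    (by simp [ansAddr, ramSq, ramSize, RamExpr.Tame, RamOp.Tame, i.tame_compile]) hw.1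
  have ha : (ansAddr (.op .mod i.compile ramSize)).eval m
      = 1 + L.n * L.n + L.n + i.eval L st % L.n := by
    simp [ansAddr, ramSq, ramSize, RamExpr.eval, RamOp.eval, hm.size, eval_compile hL hm i]
  rw [← ha] at hr
  have hr' := hr
  rw [← eval_compile hL hm e] at hr'
  refine ⟨_, _, _, φ, .store _ _ m hf' hf, hr', by rwa [eval_compile hL hm e], ?_⟩
  have := e.compile.cost_le_weight
  have := (ansAddr (.op .mod i.compile ramSize)).cost_le_weight
  have := hL.le_K
  omega

theorem assignCell {a e : SrcExpr} {q : ℕ} (hq : q < L.cnt) (hb : st.reg 0 = L.base q)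
    (ha : a.eval L st < L.S) (hv : e.eval L st < L.V)
    (h : Q (st.setInst q (Function.update (st.inst q) (a.eval L st) (e.eval L st))) φ) :
    L.WP (assignCell a e) 1 Q st φ := by
  intro hL hw m hm
  simp only [RamProg.weight, SrcExpr.assignCell, max_le_iff] at hw
  have hr := hm.setInst hq ha hv
  have hf := fits_compile hL hm e.tame_compile hw.2
  have hf' := fits_compile hL hm (e := .op .add curBase a.compile)
    ⟨trivial, tame_compile _, a.tame_compile⟩ hw.1
  have hadd : (RamExpr.op .add curBase a.compile).eval m = L.base q + a.eval L st := by
    simp only [RamExpr.eval, RamOp.eval, (curBase_spec hL hm).1, eval_compile hL hm a, hb]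
  rw [← hadd] at hr
  have hr' := hr
  rw [← eval_compile hL hm e] at hr'
  refine ⟨_, _, _, φ, .store _ _ m hf' hf, hr', by rwa [eval_compile hL hm e], ?_⟩
  have := e.compile.cost_le_weight
  have := (RamExpr.op .add curBase a.compile).cost_le_weight
  have := hL.le_K
  omega

theorem fetch {r : Fin 32} {q : ℕ} (hq : q < L.cnt) (hb : st.reg 0 = L.base q) (hS : 0 < L.S)
    (h : st.inst q 0 < L.V → Q (st.setReg r (st.inst q 0)) φ) : L.WP (fetch r) 1 Q st φ := by
  intro hL hw m hm
  simp only [RamProg.weight, SrcExpr.fetch, max_le_iff] at hw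
  have hcell : (RamExpr.load curBase).eval m = st.inst q 0 := by
    have := hm.inst q hq 0 hS
    simpa only [RamExpr.eval, (curBase_spec hL hm).1, hb, Nat.add_zero] using this
  have hlt : st.inst q 0 < L.V := by rw [← hcell]; exact hm.bdd _
  have hr := hm.setReg r hlt
  have hf := fits_compile hL hm (e := .load curBase) (tame_compile (.reg 0)) hw.2
  have hf' := fits_compile hL hm (tame_regAddr r) hw.1
  rw [← hcell, ← eval_regAddr hm.size r] at hr
  refine ⟨_, _, _, φ, .store _ _ m hf' hf, hr, by rw [hcell]; exact h hlt, ?_⟩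
  have := (RamExpr.load curBase).cost_le_weight
  have := (regAddr r).cost_le_weight
  have := hL.le_K
  omega

/-- A simulated operation has no useful worst-case bound, so its static time is `0` and its whole
cost is charged to the credits. -/
theorem call {W q τ : ℕ} {μ' : RamMem} (hq : q < L.cnt) (hb : st.reg 0 = L.base q)
    (hW : W ≤ L.S) (he : RamExec W p (st.inst q) μ' τ) (h : Q (st.setInst q μ') φ) :
    L.WP p.reloc 0 Q st (φ + 30 * τ) := by
  intro hL _ m hm
  obtain ⟨m', t', h1, h2, h3⟩ := reloc_prog hL hq hW he hm hb rfl
  exact ⟨m', t', _, φ, h1, h2, h, by omega⟩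

/-- Induction on the number of remaining iterations. The two extra units per iteration pay for the
test and the increment, the final one for the failing test. The body has to establish the invariant
for the state after the increment, so that the invariant may mention the counter. -/
theorem loop {r : Fin 32} {bound : SrcExpr} {body : RamProg} {I : ℕ → St → ℕ → Prop} {N : ℕ}
    (hN : N < L.V) (hbound : ∀ i ≤ N, ∀ st φ, I i st φ → bound.eval L st = N)
    (hreg : ∀ i ≤ N, ∀ st φ, I i st φ → st.reg r = i)
    (hbody : ∀ i < N, ∀ st φ, I i st φ →
      L.WP body T (fun st' φ' => st'.reg r = i ∧ I (i + 1) (st'.setReg r (i + 1)) φ') st φ) :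
    ∀ k i, i + k = N → ∀ st φ, I i st φ →
      L.WP (.loop ((reg r).ltb bound).compile (body ;; SrcExpr.assign r (reg r + 1)))
        (k * (T + 2) + 1) (I N) st φ := by
  intro k
  induction k with
  | zero =>
    intro i hi st φ hI hL hw m hm
    obtain rfl : i = N := by omega
    have hev : ((reg r).ltb bound).eval L st = 0 := by
      simp [hbound i le_rfl st φ hI, hreg i le_rfl st φ hI, ltNat]
    simp only [RamProg.weight, max_le_iff] at hw
    have hf := fits_compile hL hm (tame_compile ((reg r).ltb bound)) hw.1
    refine ⟨m, _, st, φ, .loop_false hf ((eval_compile hL hm _).trans hev), hm, hI, ?_⟩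
    have := (((reg r).ltb bound).compile).cost_le_weight
    have := hL.le_K
    omega
  | succ k ih =>
    intro i hi st φ hI hL hw m hm
    have hev : ((reg r).ltb bound).eval L st ≠ 0 := by
      simp [hbound i (by omega) st φ hI, hreg i (by omega) st φ hI, ltNat]
      omega
    have hw' := hw
    rw [RamProg.weight, max_le_iff] at hw'
    have hf := fits_compile hL hm (tame_compile ((reg r).ltb bound)) hw'.1
    have hb : L.WP (body ;; SrcExpr.assign r (reg r + 1)) (T + 1) (I (i + 1)) st φ := by
      refine seq ((hbody i (by omega) st φ hI).mono_post ?_)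
      rintro st' φ' ⟨h1, h2⟩
      refine assign ?_ ?_
      · simp [h1]; omega
      · simpa [h1] using h2
    obtain ⟨m₁, t₁, st₁, φ₁, he₁, hr₁, hq₁, ht₁⟩ := hb hL hw'.2 m hm
    obtain ⟨m₂, t₂, st₂, φ₂, he₂, hr₂, hq₂, ht₂⟩ :=
      ih (i + 1) (by omega) st₁ φ₁ hq₁ hL hw m₁ hr₁
    refine ⟨m₂, _, st₂, φ₂, .loop_true hf (by rwa [eval_compile hL hm]) he₁ he₂, hr₂, hq₂, ?_⟩
    have := (((reg r).ltb bound).compile).cost_le_weight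
    have := hL.le_K
    have e1 : 3 * L.K * ((k + 1) * (T + 2) + 1)
        = 3 * L.K * (T + 1) + 3 * L.K * (k * (T + 2) + 1) + 3 * L.K := by ring
    omega

theorem forLoop {r : Fin 32} {bound : SrcExpr} {body : RamProg} (I : ℕ → St → ℕ → Prop) (N : ℕ)
    (hN : N < L.V) (hbound : ∀ i ≤ N, ∀ st φ, I i st φ → bound.eval L st = N)
    (hreg : ∀ i ≤ N, ∀ st φ, I i st φ → st.reg r = i)
    (hbody : ∀ i < N, ∀ st φ, I i st φ →
      L.WP body T (fun st' φ' => st'.reg r = i ∧ I (i + 1) (st'.setReg r (i + 1)) φ') st φ)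
    (h0 : I 0 (st.setReg r 0) φ) (hQ : ∀ st φ, I N st φ → Q st φ) :
    L.WP (forLoop r bound body) (N * (T + 2) + 2) Q st φ := by
  have := loop hN hbound hreg hbody N 0 (by omega) _ φ h0
  refine mono_time (seq (assign ?_ (this.mono_post hQ))) (by omega)
  simp; omega

end WP

end Layout

/-! ### Cuts -/

/-- Summed over `X`, the net outflows reduce to that of the source by conservation. The part that
stays inside `X` equals its own negative by antisymmetry, which leaves the flow across the cut. -/
theorem IsFlow.value_eq_cut {n : ℕ} {cap : Network n} {s t : Fin n} {f : Fin n → Fin n → ℝ}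
    (hf : IsFlow cap s t f) {X : Finset (Fin n)} (hs : s ∈ X) (ht : t ∉ X) :
    ∑ v, f s v = ∑ u ∈ X, ∑ v ∈ Xᶜ, f u v := by
  have h1 : ∑ u ∈ X, ∑ v, f u v = ∑ v, f s v := by
    refine Finset.sum_eq_single_of_mem s hs fun u hu hus => hf.conservation u hus ?_
    rintro rfl; exact ht hu
  have h2 : ∑ u ∈ X, ∑ v ∈ X, f u v = 0 := by
    have h3 : ∑ u ∈ X, ∑ v ∈ X, f u v = - ∑ u ∈ X, ∑ v ∈ X, f u v := by
      conv_lhs => rw [Finset.sum_comm]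
      rw [← Finset.sum_neg_distrib]
      refine Finset.sum_congr rfl fun u _ => ?_
      rw [← Finset.sum_neg_distrib]
      exact Finset.sum_congr rfl fun v _ => hf.skew v u
    linarith
  have h4 : ∑ u ∈ X, ∑ v, f u v = ∑ u ∈ X, ∑ v ∈ X, f u v + ∑ u ∈ X, ∑ v ∈ Xᶜ, f u v := by
    rw [← Finset.sum_add_distrib]
    exact Finset.sum_congr rfl fun u _ => (Finset.sum_add_sum_compl X _).symm
  linarith

/-- If `f` saturates a cut of `cap'` then no flow of `cap'` has a larger value. -/
theorem IsFlow.value_le_of_saturated {n : ℕ} {cap cap' : Network n} {s t : Fin n}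
    {f f' : Fin n → Fin n → ℝ} (hf : IsFlow cap s t f) (hf' : IsFlow cap' s t f')
    (X : Fin n → Prop) (hs : X s) (ht : ¬ X t)
    (hX : ∀ u v, X u → ¬ X v → (cap' u v : ℝ) ≤ f u v) :
    ∑ v, f' s v ≤ ∑ v, f s v := by
  classical
  have hs' : s ∈ Finset.univ.filter X := by simpa using hs
  have ht' : t ∉ Finset.univ.filter X := by simpa using ht
  rw [hf.value_eq_cut hs' ht', hf'.value_eq_cut hs' ht']
  refine Finset.sum_le_sum fun u hu => Finset.sum_le_sum fun v hv => ?_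
  exact (hf'.capacity u v).trans (hX u v (by simpa using hu) (by simpa using hv))

/-! ### The gadget network -/

/-- The vertex of a given role with a given index.  The roles are: source, sink, entry and exit of
the gadget of a round, row, column, copy of the source, copy of the sink. -/
def vx {B : ℕ} (ρ : Fin 8) (i : Fin B) : Fin (B * 8) := finProdFinEquiv (i, ρ)

theorem vx_injective {B : ℕ} {ρ ρ' : Fin 8} {i i' : Fin B} :
    vx ρ i = vx ρ' i' ↔ ρ = ρ' ∧ i = i' := by
  simp [vx, and_comm]

theorem exists_vx {B : ℕ} (u : Fin (B * 8)) : ∃ ρ i, u = vx ρ i :=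
  ⟨(finProdFinEquiv.symm u).2, (finProdFinEquiv.symm u).1,
    (finProdFinEquiv.apply_symm_apply u).symm⟩

theorem sum_vx {B : ℕ} (f : Fin (B * 8) → ℝ) : ∑ v, f v = ∑ ρ, ∑ i, f (vx ρ i) := by
  rw [Finset.sum_comm, ← Fintype.sum_prod_type' (f := fun i ρ => f (vx ρ i))]
  exact (finProdFinEquiv.sum_comp f).symm

/-- The data of the network: the matrix of columns joined to rows, the two sets of each gadget,
the stages of the gadgets, and whether the network is undirected. -/
structure GadgetNet (B : ℕ) where
  M : Fin B → Fin B → ℕ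
  U : Fin B → Fin B → ℕ
  V : Fin B → Fin B → ℕ
  stage : Fin B → ℕ
  β : ℕ

namespace GadgetNet

variable {B : ℕ} [NeZero B]

/-- The entries are `0` or `1`. -/
structure Bounded (G : GadgetNet B) : Prop where
  M : ∀ i j, G.M i j ≤ 1
  U : ∀ i j, G.U i j ≤ 1
  V : ∀ i j, G.V i j ≤ 1
  β : G.β ≤ 1

/-- The oriented capacities, in terms of roles and indices. -/
def arcAt (G : GadgetNet B) (ρ : Fin 8) (i : Fin B) (σ : Fin 8) (j : Fin B) : ℕ :=
  match ρ, σ with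
  | 0, 2 => if i = 0 then (if 2 ≤ G.stage j then 1 else 0) else 0
  | 0, 3 => if i = 0 then (if 3 ≤ G.stage j then 1 else 0) else 0
  | 2, 1 => if j = 0 then (if 3 ≤ G.stage i then 1 else 0) else 0
  | 3, 1 => if j = 0 then (if 1 ≤ G.stage i then 1 else 0) else 0
  | 2, 4 => G.U i j
  | 4, 5 => G.M i j
  | 5, 3 => G.V j i
  -- The copies serve the undirected case. The edge with tail index `i` and head index `j` is tied
  -- to source copy `i` and sink copy `j`, so each middle edge has two unit edges of its own. With a
  -- single source one would need an edge of growing weight, but a capacity cannot be changed after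
  -- insertion.
  | 0, 6 => if i = 0 then G.β * (B * 8) else 0
  | 7, 1 => if j = 0 then G.β * (B * 8) else 0
  | 6, 4 => G.β * G.U i j
  | 6, 5 => G.β * G.M i j
  | 6, 3 => G.β * G.V j i
  | 2, 7 => G.β * G.U i j
  | 4, 7 => G.β * G.M i j
  | 5, 7 => G.β * G.V j i
  | _, _ => 0

/-- The oriented capacities. -/
def arc (G : GadgetNet B) (u v : Fin (B * 8)) : ℕ :=
  G.arcAt (finProdFinEquiv.symm u).2 (finProdFinEquiv.symm u).1
    (finProdFinEquiv.symm v).2 (finProdFinEquiv.symm v).1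

/-- The network. -/
def cap (G : GadgetNet B) : Network (B * 8) := fun u v => G.arc u v + G.β * G.arc v u

@[simp] theorem arc_vx (G : GadgetNet B) (ρ σ : Fin 8) (i j : Fin B) :
    G.arc (vx ρ i) (vx σ j) = G.arcAt ρ i σ j := by simp [arc, vx]

/-- The stationary flow on the oriented edges. -/
noncomputable def restAt (G : GadgetNet B) (ρ : Fin 8) (i : Fin B) (σ : Fin 8) (j : Fin B) : ℝ :=
  match ρ, σ with
  | 0, 2 => if i = 0 then (if 3 ≤ G.stage j then 1 else 0) else 0
  | 0, 3 => if i = 0 then (if 3 ≤ G.stage j then 1 else 0) else 0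
  | 2, 1 => if j = 0 then (if 3 ≤ G.stage i then 1 else 0) else 0
  | 3, 1 => if j = 0 then (if 3 ≤ G.stage i then 1 else 0) else 0
  -- The middle edges are saturated backwards, from head to tail. The unit comes from the source
  -- copy adjacent to the head and leaves through the sink copy adjacent to the tail.
  | 2, 4 => -(G.β * G.U i j)
  | 4, 5 => -(G.β * G.M i j)
  | 5, 3 => -(G.β * G.V j i)
  | 0, 6 => if i = 0 then G.β * (∑ a, (G.U j a : ℝ) + ∑ a, (G.M j a : ℝ) + ∑ a, (G.V a j : ℝ))
      else 0
  | 7, 1 => if j = 0 then G.β * (∑ a, (G.U a i : ℝ) + ∑ a, (G.M a i : ℝ) + ∑ a, (G.V i a : ℝ))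
      else 0
  | 6, 4 => G.β * G.U i j
  | 6, 5 => G.β * G.M i j
  | 6, 3 => G.β * G.V j i
  | 2, 7 => G.β * G.U i j
  | 4, 7 => G.β * G.M i j
  | 5, 7 => G.β * G.V j i
  | _, _ => 0

/-- The stationary flow. -/
noncomputable def rest (G : GadgetNet B) (u v : Fin (B * 8)) : ℝ :=
  G.restAt (finProdFinEquiv.symm u).2 (finProdFinEquiv.symm u).1
      (finProdFinEquiv.symm v).2 (finProdFinEquiv.symm v).1 -
    G.restAt (finProdFinEquiv.symm v).2 (finProdFinEquiv.symm v).1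
      (finProdFinEquiv.symm u).2 (finProdFinEquiv.symm u).1

@[simp] theorem rest_vx (G : GadgetNet B) (ρ σ : Fin 8) (i j : Fin B) :
    G.rest (vx ρ i) (vx σ j) = G.restAt ρ i σ j - G.restAt σ j ρ i := by simp [rest, vx]

/-- The flow is a sum of source-sink paths: through the entry alone and through the exit alone for
each gadget at stage 3, and, if undirected, one path backwards through each middle edge. -/
theorem rest_conservation (G : GadgetNet B) (u : Fin (B * 8)) (hs : u ≠ vx 0 0)
    (ht : u ≠ vx 1 0) : ∑ v, G.rest u v = 0 := by
  obtain ⟨ρ, i, rfl⟩ := exists_vx u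
  rw [Ne, vx_injective] at hs ht
  rw [sum_vx, Fin.sum_univ_eight]
  simp only [rest_vx]
  fin_cases ρ
  all_goals simp at hs ht
  all_goals simp [restAt, hs, ht, ← Finset.mul_sum]
  all_goals ring

omit [NeZero B] in
theorem sum_entries_le {f : Fin B → ℕ} (hf : ∀ i, f i ≤ 1) : ∑ a, (f a : ℝ) ≤ B := by
  calc ∑ a, (f a : ℝ) ≤ ∑ _a : Fin B, (1 : ℝ) :=
        Finset.sum_le_sum fun a _ => by exact_mod_cast hf a
    _ = B := by simp

/-- The lower bound is what permits an undirected edge to be used against its orientation. A copy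
handles at most `3 * B` units; the capacity `B * 8` is chosen because it equals the number of
vertices and is therefore an allowed weight. -/
theorem restAt_bounds {G : GadgetNet B} (hG : G.Bounded) (ρ σ : Fin 8) (i j : Fin B) :
    G.restAt ρ i σ j ≤ G.arcAt ρ i σ j ∧ -(G.β * G.arcAt ρ i σ j : ℝ) ≤ G.restAt ρ i σ j := by
  have hβ : (0 : ℝ) ≤ G.β := Nat.cast_nonneg _
  have h8 : ∀ x y z : ℝ, x ≤ B → y ≤ B → z ≤ B → x + y + z ≤ B * 8 := by
    intro x y z hx hy hz
    have : (0 : ℝ) ≤ B := Nat.cast_nonneg _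
    linarith
  have h01 : (G.β : ℝ) = 0 ∨ (G.β : ℝ) = 1 := by
    have := hG.β
    interval_cases h : G.β <;> simp
  have hU := fun i => sum_entries_le (hG.U i)
  have hM := fun i => sum_entries_le (hG.M i)
  have hV := fun i => sum_entries_le (hG.V i)
  have hU' := fun j => sum_entries_le fun i => hG.U i j
  have hM' := fun j => sum_entries_le fun i => hG.M i j
  have hV' := fun j => sum_entries_le fun i => hG.V i j
  have ha := h8 _ _ _ (hU j) (hM j) (hV' j)
  have hc := h8 _ _ _ (hU' i) (hM' i) (hV i)
  have ha0 : 0 ≤ ∑ a, (G.U j a : ℝ) + ∑ a, (G.M j a : ℝ) + ∑ a, (G.V a j : ℝ) := by positivity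
  have hc0 : 0 ≤ ∑ a, (G.U a i : ℝ) + ∑ a, (G.M a i : ℝ) + ∑ a, (G.V i a : ℝ) := by positivity
  have hB : (0 : ℝ) ≤ B := Nat.cast_nonneg _
  fin_cases ρ <;> fin_cases σ <;> (try simp [restAt, arcAt]) <;> rcases h01 with h | h <;>
    rw [h] <;> (try split_ifs) <;> (try simp) <;> (try constructor) <;>
    first | assumption | positivity | omega | linarith

theorem rest_isFlow {G : GadgetNet B} (hG : G.Bounded) :
    IsFlow G.cap (vx 0 0) (vx 1 0) G.rest where
  skew u v := by simp [rest]
  conservation := G.rest_conservation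
  capacity u v := by
    obtain ⟨ρ, i, rfl⟩ := exists_vx u
    obtain ⟨σ, j, rfl⟩ := exists_vx v
    have h1 := (restAt_bounds hG ρ σ i j).1
    have h2 := (restAt_bounds hG σ ρ j i).2
    simp only [cap, rest_vx, arc_vx]
    push_cast
    linarith

/-- The unit flow along a path through the gadget `k`, the row `a` and the column `b`. -/
noncomputable def pathAt (k a b : Fin B) (ρ : Fin 8) (i : Fin B) (σ : Fin 8) (j : Fin B) : ℝ :=
  match ρ, σ with
  | 0, 2 => if i = 0 then (if j = k then 1 else 0) else 0
  | 2, 4 => if i = k then (if j = a then 1 else 0) else 0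
  | 4, 5 => if i = a then (if j = b then 1 else 0) else 0
  | 5, 3 => if i = b then (if j = k then 1 else 0) else 0
  | 3, 1 => if i = k then (if j = 0 then 1 else 0) else 0
  | _, _ => 0

/-- The stationary flow together with a unit flow along a path. -/
noncomputable def augmented (G : GadgetNet B) (k a b : Fin B) (u v : Fin (B * 8)) : ℝ :=
  G.rest u v +
    (pathAt k a b (finProdFinEquiv.symm u).2 (finProdFinEquiv.symm u).1
      (finProdFinEquiv.symm v).2 (finProdFinEquiv.symm v).1 -
    pathAt k a b (finProdFinEquiv.symm v).2 (finProdFinEquiv.symm v).1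
      (finProdFinEquiv.symm u).2 (finProdFinEquiv.symm u).1)

theorem augmented_vx (G : GadgetNet B) (k a b : Fin B) (ρ σ : Fin 8) (i j : Fin B) :
    G.augmented k a b (vx ρ i) (vx σ j) =
      G.rest (vx ρ i) (vx σ j) + (pathAt k a b ρ i σ j - pathAt k a b σ j ρ i) := by
  simp only [augmented, vx, Equiv.symm_apply_apply]

theorem augmented_sum (G : GadgetNet B) (k a b : Fin B) (ρ : Fin 8) (i : Fin B) :
    ∑ v, G.augmented k a b (vx ρ i) v = ∑ v, G.rest (vx ρ i) v +
      (if ρ = 0 ∧ i = 0 then 1 else 0) - (if ρ = 1 ∧ i = 0 then 1 else 0) := by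
  rw [sum_vx, sum_vx]
  simp only [augmented_vx, Finset.sum_add_distrib, add_sub_assoc, add_right_inj]
  rw [Fin.sum_univ_eight]
  fin_cases ρ <;> simp [pathAt]

/-- At stage 2 the stationary flow does not use the two outer edges of the path, and on the three
middle edges it is `-β`. One more unit thus stays within the capacity. -/
theorem augmented_isFlow {G : GadgetNet B} (hG : G.Bounded) {k a b : Fin B}
    (hk : G.stage k = 2) (hU : G.U k a = 1) (hM : G.M a b = 1) (hV : G.V k b = 1) :
    IsFlow G.cap (vx 0 0) (vx 1 0) (G.augmented k a b) where
  skew u v := by simp only [augmented, rest]; ring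
  conservation u hs ht := by
    have h := G.rest_conservation u hs ht
    obtain ⟨ρ, i, rfl⟩ := exists_vx u
    rw [Ne, vx_injective] at hs ht
    rw [augmented_sum, h]
    simp [hs, ht]
  capacity u v := by
    obtain ⟨ρ, i, rfl⟩ := exists_vx u
    obtain ⟨σ, j, rfl⟩ := exists_vx v
    have hβ : (0 : ℝ) ≤ G.β := Nat.cast_nonneg _
    have key : ∀ (ρ σ : Fin 8) (i j : Fin B),
        G.restAt ρ i σ j + pathAt k a b ρ i σ j ≤ G.arcAt ρ i σ j ∧ 0 ≤ pathAt k a b ρ i σ j := by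
      intro ρ σ i j
      have h1 := (restAt_bounds hG ρ σ i j).1
      have h0 : 0 ≤ pathAt k a b ρ i σ j := by
        unfold pathAt; split <;> (try split_ifs) <;> norm_num
      refine ⟨?_, h0⟩
      by_cases hz : pathAt k a b ρ i σ j = 0
      · rw [hz, add_zero]; exact h1
      · unfold pathAt at hz ⊢
        split at hz <;> (try split_ifs at hz) <;> (try simp at hz) <;> subst_vars <;>
          simp [restAt, arcAt, hk, hU, hM, hV, hβ]
    have h1 := (key ρ σ i j).1
    have h2 := (restAt_bounds hG σ ρ j i).2
    have h3 := (key σ ρ j i).2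
    simp only [cap, augmented_vx, rest_vx, arc_vx]
    push_cast
    linarith

/-- The network before the gadget `k` is activated: the stationary flow is maximal. -/
theorem value_le_of_inactive {G : GadgetNet B} (hG : G.Bounded) {k : Fin B}
    (hk : G.stage k = 1) (hstage : ∀ j, j ≠ k → G.stage j = 0 ∨ G.stage j = 3)
    {f : Fin (B * 8) → Fin (B * 8) → ℝ} (hf : IsFlow G.cap (vx 0 0) (vx 1 0) f) :
    ∑ v, f (vx 0 0) v ≤ ∑ v, G.rest (vx 0 0) v := by
  have h23 : ∀ j, (2 ≤ G.stage j ↔ 3 ≤ G.stage j) := by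
    intro j
    by_cases hj : j = k
    · subst hj; omega
    · have := hstage j hj; omega
  refine (rest_isFlow hG).value_le_of_saturated hf
    -- The cut separates the source and its copies from everything else. With no gadget at stage 2,
    -- all edges that leave it are saturated by `rest`.
    (fun u => (finProdFinEquiv.symm u).2 = 0 ∨ (finProdFinEquiv.symm u).2 = 6)
    (by simp [vx]) (by simp [vx]) ?_
  intro u v hu hv
  obtain ⟨ρ, i, rfl⟩ := exists_vx u
  obtain ⟨σ, j, rfl⟩ := exists_vx v
  simp only [vx, Equiv.symm_apply_apply] at hu hv
  simp only [cap, rest_vx, arc_vx]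
  rcases hu with rfl | rfl <;> fin_cases σ <;> simp at hv <;> simp [restAt, arcAt, h23]

/-- The network while the gadget `k` is active: without a witness the stationary flow is
maximal. -/
theorem value_le_of_active {G : GadgetNet B} (hG : G.Bounded) {k : Fin B}
    (hk : G.stage k = 2) (hstage : ∀ j, j ≠ k → G.stage j = 0 ∨ G.stage j = 3)
    (hno : ∀ a b, G.U k a = 1 → G.M a b = 1 → G.V k b = 0)
    {f : Fin (B * 8) → Fin (B * 8) → ℝ} (hf : IsFlow G.cap (vx 0 0) (vx 1 0) f) :
    ∑ v, f (vx 0 0) v ≤ ∑ v, G.rest (vx 0 0) v := by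
  have h23 : ∀ j, j ≠ k → (2 ≤ G.stage j ↔ 3 ≤ G.stage j) := by
    intro j hj; have := hstage j hj; omega
  have h13 : ∀ j, j ≠ k → (1 ≤ G.stage j ↔ 3 ≤ G.stage j) := by
    intro j hj; have := hstage j hj; omega
  have hU : ∀ a, G.U k a ≠ 1 → G.U k a = 0 := fun a h => by have := hG.U k a; omega
  have hM : ∀ a b, G.M a b ≠ 1 → G.M a b = 0 := fun a b h => by have := hG.M a b; omega
  refine (rest_isFlow hG).value_le_of_saturated hf
    -- The source side follows the active entry to its rows and on to their columns. The other exits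
    -- are on the source side and the other entries on the sink side: at stage 3 their cut edges are
    -- saturated, at stage 0 these are absent. Middle edges crossing against their orientation are
    -- saturated by the backward flow.
    (fun u => match (finProdFinEquiv.symm u).2, (finProdFinEquiv.symm u).1 with
      | 0, _ => True
      | 6, _ => True
      | 2, i => i = k
      | 4, i => G.U k i = 1
      | 5, i => ∃ a, G.U k a = 1 ∧ G.M a i = 1
      | 3, i => i ≠ k
      | _, _ => False) (by simp [vx]) (by simp [vx]) ?_
  intro u v hu hv
  obtain ⟨ρ, i, rfl⟩ := exists_vx u
  obtain ⟨σ, j, rfl⟩ := exists_vx v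
  simp only [vx, Equiv.symm_apply_apply] at hu hv
  simp only [cap, rest_vx, arc_vx]
  fin_cases ρ <;> simp at hu <;> fin_cases σ <;> simp at hv <;>
    simp [restAt, arcAt, h23, h13, hU, hM, hk, hu, hv]
  obtain ⟨a, ha, ha'⟩ := hu
  simp [hno a i ha ha']

/-- The activation of a gadget increases the maximal value of a flow exactly if there is a
witness. -/
theorem value_lt_iff {G : GadgetNet B} (hG : G.Bounded) {k : Fin B} {σ₁ σ₂ : Fin B → ℕ}
    (h₁ : σ₁ k = 1) (h₂ : σ₂ k = 2) (hσ : ∀ j, j ≠ k → σ₁ j = σ₂ j)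
    (hstage : ∀ j, j ≠ k → σ₂ j = 0 ∨ σ₂ j = 3) {x₁ x₂ : ℝ}
    (hx₁ : IsMaxFlowValue ({ G with stage := σ₁ } : GadgetNet B).cap (vx 0 0) (vx 1 0) x₁)
    (hx₂ : IsMaxFlowValue ({ G with stage := σ₂ } : GadgetNet B).cap (vx 0 0) (vx 1 0) x₂) :
    x₁ < x₂ ↔ ∃ a b, G.U k a = 1 ∧ G.M a b = 1 ∧ G.V k b = 1 := by
  have hG₁ : ({ G with stage := σ₁ } : GadgetNet B).Bounded := ⟨hG.M, hG.U, hG.V, hG.β⟩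
  have hG₂ : ({ G with stage := σ₂ } : GadgetNet B).Bounded := ⟨hG.M, hG.U, hG.V, hG.β⟩
  have h3 : ∀ j, (3 ≤ σ₁ j ↔ 3 ≤ σ₂ j) := by
    intro j
    by_cases hj : j = k
    · subst hj; omega
    · rw [hσ j hj]
  -- The stationary flow sees a stage only through the test `3 ≤ stage`, so the two networks share
  -- it. It is the common baseline of the comparison.
  have hrest : ({ G with stage := σ₁ } : GadgetNet B).rest
      = ({ G with stage := σ₂ } : GadgetNet B).rest := by
    funext u v
    simp only [rest, restAt, h3]
  obtain ⟨f₁, hf₁, rfl⟩ := hx₁.1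
  have h5 := value_le_of_inactive hG₁ h₁ (fun j hj => by
    change σ₁ j = 0 ∨ σ₁ j = 3; rw [hσ j hj]; exact hstage j hj) hf₁
  have h4 := hx₁.2 ⟨_, rest_isFlow hG₁, rfl⟩
  rw [hrest] at h4 h5
  constructor
  · intro hlt
    by_contra hno
    push Not at hno
    obtain ⟨f₂, hf₂, rfl⟩ := hx₂.1
    have := value_le_of_active hG₂ h₂ hstage (fun a b ha hb => by
      have h1 := hno a b ha hb
      have h2 := hG.V k b
      change G.V k b = 0
      omega) hf₂
    linarith
  · rintro ⟨a, b, ha, hb, hc⟩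
    have h6 := hx₂.2 ⟨_, augmented_isFlow hG₂ h₂ ha hb hc, rfl⟩
    rw [augmented_sum] at h6
    simp only [true_and, if_true, Fin.reduceEq, false_and, if_false] at h6
    linarith

end GadgetNet

/-! ### Sequences of updates that lead from one network to another -/

/-- The edges that are changed when an edge is changed. -/
def GraphClass.SameEdge {n : ℕ} : GraphClass → Fin n × Fin n → Fin n × Fin n → Prop
  | .unweightedDirected, p, q => q = p
  | .weightedUndirected _, p, q => q = p ∨ q = p.swap

theorem GraphClass.sameEdge_refl {n : ℕ} (g : GraphClass) (p : Fin n × Fin n) :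
    g.SameEdge p p := by cases g <;> simp [SameEdge]

theorem GraphClass.SameEdge.symm {n : ℕ} {g : GraphClass} {p q : Fin n × Fin n}
    (h : g.SameEdge p q) : g.SameEdge q p := by
  cases g with
  | unweightedDirected => exact Eq.symm h
  | weightedUndirected k => rcases h with rfl | rfl <;> simp [SameEdge]

theorem GraphClass.SameEdge.trans {n : ℕ} {g : GraphClass} {p q r : Fin n × Fin n}
    (h : g.SameEdge p q) (h' : g.SameEdge q r) : g.SameEdge p r := by
  cases g with
  | unweightedDirected => exact Eq.trans h' h
  | weightedUndirected k => rcases h with rfl | rfl <;> rcases h' with rfl | rfl <;> simp [SameEdge]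

open Classical in
theorem GraphClass.setEdge_eq {n : ℕ} (g : GraphClass) (cap : Network n) (p q : Fin n × Fin n)
    (c : ℕ) : g.setEdge cap p.1 p.2 c q.1 q.2 = if g.SameEdge p q then c else cap q.1 q.2 := by
  cases g with
  | unweightedDirected => simp [setEdge, SameEdge, Prod.ext_iff]
  | weightedUndirected k => simp [setEdge, SameEdge, Prod.ext_iff]

/-- The request that gives an edge its new capacity, if that differs from the old one. -/
def syncItem {n : ℕ} (old new : Network n) (p : Fin n × Fin n) : List (FlowRequest n) :=
  if old p.1 p.2 = new p.1 p.2 then [] else [.update p.1 p.2 (new p.1 p.2)]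

/-- The requests that give the listed edges their new capacities. -/
def syncReqs {n : ℕ} (old new : Network n) (ps : List (Fin n × Fin n)) : List (FlowRequest n) :=
  ps.flatMap (syncItem old new)

theorem length_syncReqs_le {n : ℕ} (old new : Network n) (ps : List (Fin n × Fin n)) :
    (syncReqs old new ps).length ≤ ps.length := by
  induction ps with
  | nil => simp [syncReqs]
  | cons p ps ih =>
    have : (syncItem old new p).length ≤ 1 := by unfold syncItem; split <;> simp
    simp only [syncReqs, List.flatMap_cons, List.length_append, List.length_cons] at ih ⊢
    omega

/-- Induction on the list of pairs: every difference between the networks is covered by a listed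
pair, and no edge is listed twice, so an update neither disturbs nor repeats another one. Legality
is stated with an arbitrary continuation so that segments can be chained. -/
theorem syncReqs_spec {n : ℕ} {g : GraphClass} {mode : DynMode} {new : Network n}
    (hnew : ∀ p q : Fin n × Fin n, g.SameEdge p q → new q.1 q.2 = new p.1 p.2)
    (ps : List (Fin n × Fin n)) (hps : ps.Pairwise fun p q => ¬ g.SameEdge p q) :
    ∀ old : Network n,
    (∀ p q : Fin n × Fin n, g.SameEdge p q → old q.1 q.2 = old p.1 p.2) →
    (∀ q : Fin n × Fin n, old q.1 q.2 ≠ new q.1 q.2 → ∃ p ∈ ps, g.SameEdge p q) →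
    (∀ p : Fin n × Fin n, old p.1 p.2 ≠ new p.1 p.2 →
      mode.Allowed g old (.update p.1 p.2 (new p.1 p.2))) →
    (syncReqs old new ps).foldl g.apply old = new ∧
      ∀ rest, mode.Legal g new rest → mode.Legal g old (syncReqs old new ps ++ rest) := by
  classical
  induction ps with
  | nil =>
    intro old _ hcover _
    have : old = new := by
      funext u v
      by_contra h
      obtain ⟨p, hp, _⟩ := hcover (u, v) h
      simp at hp
    subst this
    exact ⟨rfl, fun rest h => h⟩
  | cons p ps ih =>
    intro old hold hcover hall
    rw [List.pairwise_cons] at hps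
    by_cases hp : old p.1 p.2 = new p.1 p.2
    · have hitem : syncReqs old new (p :: ps) = syncReqs old new ps := by
        simp [syncReqs, syncItem, hp]
      rw [hitem]
      refine ih hps.2 old hold (fun q hq => ?_) hall
      obtain ⟨p', hp', hs⟩ := hcover q hq
      rcases List.mem_cons.1 hp' with rfl | hp'
      · exact absurd ((hold _ _ hs).trans (hp.trans (hnew _ _ hs).symm)) hq
      · exact ⟨p', hp', hs⟩
    · set old' := g.setEdge old p.1 p.2 (new p.1 p.2) with hold'
      have he : ∀ q : Fin n × Fin n,
          old' q.1 q.2 = if g.SameEdge p q then new p.1 p.2 else old q.1 q.2 :=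
        fun q => g.setEdge_eq old p q _
      have hne : ∀ q : Fin n × Fin n, old' q.1 q.2 ≠ new q.1 q.2 →
          ¬ g.SameEdge p q ∧ old' q.1 q.2 = old q.1 q.2 := by
        intro q hq
        have h1 := he q
        by_cases hs : g.SameEdge p q
        · rw [if_pos hs] at h1
          exact absurd (h1.trans (hnew _ _ hs).symm) hq
        · rw [if_neg hs] at h1
          exact ⟨hs, h1⟩
      -- The remaining pairs are other edges, so their requests are the same whether computed from
      -- the network before or after this update.
      have htail : syncReqs old new ps = syncReqs old' new ps := by
        refine List.flatMap_congr fun q hq => ?_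
        have h1 := he q
        rw [if_neg (hps.1 q hq)] at h1
        simp only [syncItem, h1]
      have hitem : syncReqs old new (p :: ps)
          = .update p.1 p.2 (new p.1 p.2) :: syncReqs old' new ps := by
        rw [← htail]
        simp [syncReqs, syncItem, hp]
      obtain ⟨ih1, ih2⟩ := ih hps.2 old' (fun q r hs => by
          rw [he q, he r]
          by_cases h1 : g.SameEdge p q
          · rw [if_pos h1, if_pos (h1.trans hs)]
          · rw [if_neg h1, if_neg fun h2 => h1 (h2.trans hs.symm), hold _ _ hs])
        (fun q hq => by
          obtain ⟨h1, h2⟩ := hne q hq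
          obtain ⟨p', hp', hs⟩ := hcover q (by rwa [← h2])
          rcases List.mem_cons.1 hp' with rfl | hp'
          · exact absurd hs h1
          · exact ⟨p', hp', hs⟩)
        (fun q hq => by
          obtain ⟨h1, h2⟩ := hne q hq
          have := hall q (by rwa [← h2])
          cases mode <;> simp only [DynMode.Allowed] at this ⊢ <;> rw [h2] <;> exact this)
      rw [hitem]
      exact ⟨ih1, fun rest hrest => ⟨hall p hp, ih2 rest hrest⟩⟩

/-! ### The requests for one block -/

/-- The capacity of the edges that are changed in a round, after the change. -/
def DynMode.bit : DynMode → ℕ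
  | .incremental => 1
  | .decremental => 0

/-- `1` for undirected graphs. -/
def GraphClass.beta : GraphClass → ℕ
  | .unweightedDirected => 0
  | .weightedUndirected _ => 1

/-- The stage of a gadget after a number of phases of its round. -/
def DynMode.stage : DynMode → ℕ → ℕ
  | .incremental, τ => τ
  | .decremental, τ => 3 - τ

/-- A block of the matrix, and for every round the set of rows and the set of columns that are
tested. -/
structure BlockData (B : ℕ) where
  M : Fin B → Fin B → ℕ
  u : Fin B → Fin B → ℕ
  v : Fin B → Fin B → ℕ

/-- The entries are `0` or `1`. -/
structure BlockData.Bounded {B : ℕ} (D : BlockData B) : Prop where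
  M : ∀ i j, D.M i j ≤ 1
  u : ∀ i j, D.u i j ≤ 1
  v : ∀ i j, D.v i j ≤ 1

section

variable {B : ℕ} [NeZero B]

/-- The number of phases of round `k` completed at time `θ`. -/
def phasesDone (θ k : ℕ) : ℕ := min (θ - 3 * k) 3

/-- The gadgets at time `θ`, when `θ` phases have been completed. -/
def BlockData.netAt (D : BlockData B) (mode : DynMode) (g : GraphClass) (θ : ℕ) :
    GadgetNet B where
  M := D.M
  -- Before its round a gadget has none of these edges (incremental) or all of them (decremental);
  -- `1 - mode.bit` is this default value.
  U k i := if phasesDone θ k = 0 then 1 - mode.bit else D.u k i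
  V k i := if phasesDone θ k = 0 then 1 - mode.bit else D.v k i
  stage k := mode.stage (phasesDone θ k)
  β := g.beta

/-- The gadgets without edges, apart from the edges of the source and the sink to their copies. -/
def hubNet (B : ℕ) (g : GraphClass) : GadgetNet B where
  M _ _ := 0
  U _ _ := 0
  V _ _ := 0
  stage _ := 0
  β := g.beta

/-- The start graph. -/
def startCap (B : ℕ) [NeZero B] (g : GraphClass) : DynMode → Network (B * 8)
  | .incremental, _, _ => 0
  -- Only the edges between source or sink and their copies ever need a capacity above `1`. They get
  -- it at once, since deletions cannot supply it later.
  | .decremental, u, v => if u = v then 0 else max 1 ((hubNet B g).cap u v)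

/-- The pairs of vertices for which the start graph is adjusted. -/
def initPairs (N : ℕ) (g : GraphClass) : List (Fin N × Fin N) :=
  (List.finRange (N * N)).flatMap fun e =>
    -- An undirected edge is listed in one orientation only.
    if g.beta = 0 ∨ e.divNat < e.modNat then [(e.divNat, e.modNat)] else []

/-- The edges that change in the first phase of a round because of an index. -/
def entryPairs (k i : Fin B) : List (Fin (B * 8) × Fin (B * 8)) :=
  [(vx 2 k, vx 4 i), (vx 5 i, vx 3 k), (vx 6 k, vx 4 i), (vx 2 k, vx 7 i), (vx 6 i, vx 3 k),
    (vx 5 i, vx 7 k)]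

/-- The edges that may change in the first phase of a round. -/
def firstPairs (k : Fin B) : List (Fin (B * 8) × Fin (B * 8)) :=
  (List.finRange B).flatMap (entryPairs k) ++
    [(vx 3 k, vx 1 0), (vx 2 k, vx 1 0), (vx 0 0, vx 3 k)]

/-- The edge that changes in the second phase of a round. -/
def secondPairs (k : Fin B) : List (Fin (B * 8) × Fin (B * 8)) := [(vx 0 0, vx 2 k)]

/-- The edges that may change in the third phase of a round. -/
def thirdPairs (k : Fin B) : List (Fin (B * 8) × Fin (B * 8)) :=
  [(vx 2 k, vx 1 0), (vx 0 0, vx 3 k), (vx 3 k, vx 1 0)]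

/-- The requests of a round. -/
def BlockData.roundReqs (D : BlockData B) (mode : DynMode) (g : GraphClass) (k : Fin B) :
    List (FlowRequest (B * 8)) :=
  syncReqs (D.netAt mode g (3 * k)).cap (D.netAt mode g (3 * k + 1)).cap (firstPairs k) ++
  (.query :: (syncReqs (D.netAt mode g (3 * k + 1)).cap (D.netAt mode g (3 * k + 2)).cap
    (secondPairs k) ++
  (.query :: syncReqs (D.netAt mode g (3 * k + 2)).cap (D.netAt mode g (3 * k + 3)).cap
    (thirdPairs k))))

/-- All requests for a block. -/
def BlockData.reqs (D : BlockData B) (mode : DynMode) (g : GraphClass) :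
    List (FlowRequest (B * 8)) :=
  syncReqs (startCap B g mode) (D.netAt mode g 0).cap (initPairs (B * 8) g) ++
    (List.finRange B).flatMap (D.roundReqs mode g)

theorem GraphClass.beta_le_one (g : GraphClass) : g.beta ≤ 1 := by cases g <;> simp [beta]

omit [NeZero B] in
theorem BlockData.Bounded.netAt {D : BlockData B} (hD : D.Bounded) (mode : DynMode)
    (g : GraphClass) (θ : ℕ) : (D.netAt mode g θ).Bounded where
  M := hD.M
  U i j := by
    simp only [BlockData.netAt]
    split
    · omega
    · exact hD.u i j
  V i j := by
    simp only [BlockData.netAt]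
    split
    · omega
    · exact hD.v i j
  β := g.beta_le_one

/-! ### Orientation and capacity bounds of the gadget network -/

namespace GadgetNet

/-- No pair of roles is an arc in both directions, whatever the data. Symmetrizing therefore never
adds two capacities. The second network is arbitrary because the fact is also used across different
times. -/
theorem arcAt_rev (G G' : GadgetNet B) {ρ σ : Fin 8} {i j : Fin B} (h : G.arcAt ρ i σ j ≠ 0) :
    ρ ≠ σ ∧ G'.arcAt σ j ρ i = 0 := by
  unfold arcAt at h
  split at h <;> simp [arcAt] at h ⊢

theorem arc_rev (G G' : GadgetNet B) {u v : Fin (B * 8)} (h : G.arc u v ≠ 0) :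
    u ≠ v ∧ G'.arc v u = 0 := by
  obtain ⟨ρ, i, rfl⟩ := exists_vx u
  obtain ⟨σ, j, rfl⟩ := exists_vx v
  rw [arc_vx] at h
  have := G.arcAt_rev G' h
  rw [arc_vx, Ne, vx_injective]
  exact ⟨fun h => this.1 h.1, this.2⟩

theorem cap_self (G : GadgetNet B) (u : Fin (B * 8)) : G.cap u u = 0 := by
  have h : G.arc u u = 0 := by
    by_contra h
    exact (G.arc_rev G h).1 rfl
  simp [cap, h]

theorem arc_le (G : GadgetNet B) (hG : G.Bounded) (u v : Fin (B * 8)) :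
    G.arc u v ≤ if G.β = 0 then 1 else B * 8 := by
  obtain ⟨ρ, i, rfl⟩ := exists_vx u
  obtain ⟨σ, j, rfl⟩ := exists_vx v
  have hB : 0 < B := NeZero.pos B
  have hU := hG.U
  have hM := hG.M
  have hV := hG.V
  have h01 : G.β = 0 ∨ G.β = 1 := by have := hG.β; omega
  rw [arc_vx]
  have h1 : ∀ x : ℕ, x ≤ 1 → x ≤ if G.β = 0 then 1 else B * 8 := by
    intro x hx; split <;> omega
  have h2 : ∀ x : ℕ, x ≤ 1 → G.β * x ≤ if G.β = 0 then 1 else B * 8 := by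
    intro x hx
    rcases h01 with h | h <;> simp [h]
    omega
  unfold arcAt
  split
  all_goals first
    | exact h1 _ (hU _ _)
    | exact h1 _ (hM _ _)
    | exact h1 _ (hV _ _)
    | exact h2 _ (hU _ _)
    | exact h2 _ (hM _ _)
    | exact h2 _ (hV _ _)
    | (refine h1 _ ?_; (try split_ifs) <;> omega)
    | (rcases h01 with h | h <;> simp [h] <;> split_ifs <;> omega)

theorem cap_le (G : GadgetNet B) (hG : G.Bounded) (u v : Fin (B * 8)) :
    G.cap u v ≤ if G.β = 0 then 1 else B * 8 := by
  by_cases h : G.arc u v = 0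
  · have h1 := G.arc_le hG v u
    have h2 : G.β * G.arc v u ≤ 1 * G.arc v u := Nat.mul_le_mul_right _ hG.β
    simp only [cap, h]
    omega
  · have := G.arc_le hG u v
    simpa [cap, (G.arc_rev G h).2] using this

end GadgetNet

/-- This is where `1 ≤ k` enters: the weight `B * 8` is the number of vertices, hence at most its
`k`-th power. -/
theorem GraphClass.le_maxCap {g : GraphClass} (hg : ∀ k, g = .weightedUndirected k → 1 ≤ k)
    {x : ℕ} (hx : x ≤ if g.beta = 0 then 1 else B * 8) : x ≤ g.maxCap (B * 8) := by
  cases g with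
  | unweightedDirected => simpa [beta, maxCap] using hx
  | weightedUndirected k =>
    have h1 := hg k rfl
    have h2 : (B * 8) ^ 1 ≤ (B * 8) ^ k :=
      Nat.pow_le_pow_right (by have := NeZero.pos B; omega) h1
    rw [pow_one] at h2
    simp only [beta, maxCap, one_ne_zero, if_false] at hx ⊢
    omega

theorem GadgetNet.cap_symm {G : GadgetNet B} {g : GraphClass} (hβ : G.β = g.beta)
    (p q : Fin (B * 8) × Fin (B * 8)) (h : g.SameEdge p q) : G.cap q.1 q.2 = G.cap p.1 p.2 := by
  cases g with
  | unweightedDirected => rw [show q = p from h]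
  | weightedUndirected k =>
    rcases h with rfl | rfl
    · rfl
    · simp [GadgetNet.cap, hβ, GraphClass.beta, add_comm]

end

section

variable {B : ℕ} [NeZero B]

/-! ### The phases are legal -/

/-- The pair is the orientation of a possible edge. -/
def Forward (p : Fin (B * 8) × Fin (B * 8)) : Prop :=
  ∃ G : GadgetNet B, G.arc p.1 p.2 ≠ 0

theorem pairwise_not_sameEdge (g : GraphClass) {ps : List (Fin (B * 8) × Fin (B * 8))}
    (h : ps.Nodup) (hf : ∀ p ∈ ps, Forward p) : ps.Pairwise fun p q => ¬ g.SameEdge p q := by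
  refine List.Pairwise.imp_of_mem (fun {p q} hp hq hne hs => ?_) h
  cases g with
  | unweightedDirected => exact hne (Eq.symm hs)
  | weightedUndirected k =>
    rcases hs with rfl | rfl
    · exact hne rfl
    · obtain ⟨G, hG⟩ := hf p hp
      obtain ⟨G', hG'⟩ := hf _ hq
      exact hG' (G.arc_rev G' hG).2

/-- It suffices to know how the oriented capacities change. If an arc changes, the opposite arc is
`0` in both networks by `arc_rev`, so an undirected capacity changes exactly as its one relevant arc
does, from `1 - bit` to `bit`. Such a change is an insertion or a deletion of a unit edge, as the
mode demands. -/
theorem syncReqs_phase {mode : DynMode} {g : GraphClass}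
    (hg : ∀ k, g = .weightedUndirected k → 1 ≤ k) {G G' : GadgetNet B} (hβ : G.β = g.beta)
    (hβ' : G'.β = g.beta) {ps : List (Fin (B * 8) × Fin (B * 8))} (hps : ps.Nodup)
    (hf : ∀ p ∈ ps, Forward p)
    (harc : ∀ u v, G.arc u v ≠ G'.arc u v →
      (u, v) ∈ ps ∧ G.arc u v = 1 - mode.bit ∧ G'.arc u v = mode.bit) :
    (syncReqs G.cap G'.cap ps).foldl g.apply G.cap = G'.cap ∧
      ∀ rest, mode.Legal g G'.cap rest → mode.Legal g G.cap (syncReqs G.cap G'.cap ps ++ rest) := by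
  have harc0 : ∀ u v, G.arc u v ≠ G'.arc u v → u ≠ v ∧ G.arc v u = 0 ∧ G'.arc v u = 0 := by
    intro u v h
    by_cases h0 : G.arc u v = 0
    · have h1 : G'.arc u v ≠ 0 := fun h1 => h (h0.trans h1.symm)
      exact ⟨(G'.arc_rev G h1).1, (G'.arc_rev G h1).2, (G'.arc_rev G' h1).2⟩
    · exact ⟨(G.arc_rev G h0).1, (G.arc_rev G h0).2, (G.arc_rev G' h0).2⟩
  have hb : g.beta = 0 ∨ g.beta = 1 := by have := g.beta_le_one; omega
  have hcap : ∀ u v, G.cap u v ≠ G'.cap u v → G.arc u v ≠ G'.arc u v ∨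
      (g.beta = 1 ∧ G.arc v u ≠ G'.arc v u) := by
    intro u v h
    by_contra hcon
    push Not at hcon
    refine h ?_
    simp only [GadgetNet.cap, hβ, hβ', hcon.1]
    rcases hb with h0 | h1
    · simp [h0]
    · rw [hcon.2 h1]
  have hval : ∀ u v, G.cap u v ≠ G'.cap u v →
      u ≠ v ∧ G.cap u v = 1 - mode.bit ∧ G'.cap u v = mode.bit := by
    intro u v h
    rcases hcap u v h with h1 | ⟨h1, h2⟩
    · obtain ⟨h3, h4, h5⟩ := harc0 u v h1
      obtain ⟨_, h6, h7⟩ := harc u v h1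
      simp [GadgetNet.cap, h3, h4, h5, h6, h7]
    · obtain ⟨h3, h4, h5⟩ := harc0 v u h2
      obtain ⟨_, h6, h7⟩ := harc v u h2
      simp [GadgetNet.cap, hβ, hβ', h1, h3.symm, h4, h5, h6, h7]
  refine syncReqs_spec (GadgetNet.cap_symm hβ') ps (pairwise_not_sameEdge g hps hf) G.cap
    (GadgetNet.cap_symm hβ) ?_ ?_
  · rintro ⟨u, v⟩ h
    rcases hcap u v h with h1 | ⟨h1, h2⟩
    · exact ⟨_, (harc u v h1).1, g.sameEdge_refl _⟩
    · refine ⟨_, (harc v u h2).1, ?_⟩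
      cases g with
      | unweightedDirected => simp [GraphClass.beta] at h1
      | weightedUndirected k => simp [GraphClass.SameEdge]
  · rintro ⟨u, v⟩ h
    obtain ⟨h1, h2, h3⟩ := hval u v h
    cases mode with
    | incremental =>
      refine ⟨h1, h2, ?_, ?_⟩
      · simp only [h3]; rfl
      · simp only [h3]
        refine GraphClass.le_maxCap hg ?_
        have := NeZero.pos B
        simp only [DynMode.bit]; split <;> omega
    | decremental =>
      refine ⟨?_, h3⟩
      simp only [h2]
      decide

theorem phasesDone_self (k d : ℕ) (hd : d ≤ 3) : phasesDone (3 * k + d) k = d := by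
  unfold phasesDone; omega

theorem phasesDone_of_ne {k j d d' : ℕ} (hj : j ≠ k) (hd : d ≤ 3) (hd' : d' ≤ 3) :
    phasesDone (3 * k + d) j = phasesDone (3 * k + d') j := by
  unfold phasesDone; omega

theorem forward_of {u v : Fin (B * 8)}
    (h : (⟨fun _ _ => 1, fun _ _ => 1, fun _ _ => 1, fun _ => 3, 1⟩ : GadgetNet B).arc u v ≠ 0) :
    Forward (u, v) := ⟨_, h⟩

theorem forward_firstPairs (k : Fin B) : ∀ p ∈ firstPairs k, Forward p := by
  intro p hp
  simp only [firstPairs, entryPairs, List.mem_append, List.mem_flatMap, List.mem_cons,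
    List.not_mem_nil, or_false] at hp
  rcases hp with ⟨i, -, rfl | rfl | rfl | rfl | rfl | rfl⟩ | rfl | rfl | rfl <;>
    exact forward_of (by simp [GadgetNet.arcAt])

theorem forward_secondPairs (k : Fin B) : ∀ p ∈ secondPairs k, Forward p := by
  intro p hp
  simp only [secondPairs, List.mem_cons, List.not_mem_nil, or_false] at hp
  subst hp
  exact forward_of (by simp [GadgetNet.arcAt])

theorem forward_thirdPairs (k : Fin B) : ∀ p ∈ thirdPairs k, Forward p := by
  intro p hp
  simp only [thirdPairs, List.mem_cons, List.not_mem_nil, or_false] at hp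
  rcases hp with rfl | rfl | rfl <;> exact forward_of (by simp [GadgetNet.arcAt])

theorem nodup_firstPairs (k : Fin B) : (firstPairs k).Nodup := by
  refine List.nodup_append.2 ⟨List.nodup_flatMap.2 ⟨?_, ?_⟩, ?_, ?_⟩
  · intro i _
    simp [entryPairs, vx_injective]
  · refine List.Pairwise.imp ?_ (List.nodup_finRange B)
    intro i j hij
    simp [Function.onFun, entryPairs, List.disjoint_left, vx_injective, hij]
  · simp [vx_injective]
  · simp only [List.mem_flatMap, List.mem_finRange, true_and, entryPairs, List.mem_cons,
      List.not_mem_nil, or_false]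
    rintro _ ⟨i, rfl | rfl | rfl | rfl | rfl | rfl⟩ _ (rfl | rfl | rfl) <;>
      simp [Prod.ext_iff, vx_injective]

theorem nodup_thirdPairs (k : Fin B) : (thirdPairs k).Nodup := by
  simp [thirdPairs, vx_injective]

theorem GadgetNet.arcAt_cases {G : GadgetNet B} {ρ σ : Fin 8} {i j : Fin B}
    (h : G.arcAt ρ i σ j ≠ 0) :
    (ρ, σ) ∈ ([(0, 2), (0, 3), (2, 1), (3, 1), (2, 4), (4, 5), (5, 3), (0, 6), (7, 1), (6, 4), (6, 5),
      (6, 3), (2, 7), (4, 7), (5, 7)] : List (Fin 8 × Fin 8)) := by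
  unfold arcAt at h
  split at h <;> simp at h ⊢

/-- The matrix edges, their companions and the edges to the copies depend only on `M` and `β`. What
remains is governed by a stage or by one entry of `U` or `V`, and the latter value is the capacity
itself, since a companion edge can change only if `β = 1`. -/
theorem GadgetNet.arc_change {G G' : GadgetNet B} (hM : G.M = G'.M) (hβ : G.β = G'.β)
    (hb : G.β ≤ 1) {u v : Fin (B * 8)} (h : G.arc u v ≠ G'.arc u v) :
    (∃ k, ((u, v) = (vx 0 0, vx 2 k) ∧ ¬ (2 ≤ G.stage k ↔ 2 ≤ G'.stage k)) ∨
      ((u, v) = (vx 0 0, vx 3 k) ∧ ¬ (3 ≤ G.stage k ↔ 3 ≤ G'.stage k)) ∨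
      ((u, v) = (vx 2 k, vx 1 0) ∧ ¬ (3 ≤ G.stage k ↔ 3 ≤ G'.stage k)) ∨
      ((u, v) = (vx 3 k, vx 1 0) ∧ ¬ (1 ≤ G.stage k ↔ 1 ≤ G'.stage k))) ∨
    (∃ k i, ((u, v) = (vx 2 k, vx 4 i) ∨ (u, v) = (vx 6 k, vx 4 i) ∨ (u, v) = (vx 2 k, vx 7 i)) ∧
      G.U k i ≠ G'.U k i ∧ G.arc u v = G.U k i ∧ G'.arc u v = G'.U k i) ∨
    (∃ k i, ((u, v) = (vx 5 i, vx 3 k) ∨ (u, v) = (vx 6 i, vx 3 k) ∨ (u, v) = (vx 5 i, vx 7 k)) ∧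
      G.V k i ≠ G'.V k i ∧ G.arc u v = G.V k i ∧ G'.arc u v = G'.V k i) := by
  obtain ⟨ρ, i, rfl⟩ := exists_vx u
  obtain ⟨σ, j, rfl⟩ := exists_vx v
  rw [arc_vx, arc_vx] at h
  simp only [Prod.mk.injEq, vx_injective, arc_vx]
  have h01 : G'.β = 0 ∨ G'.β = 1 := by omega
  have hmem : (ρ, σ) ∈ ([(0, 2), (0, 3), (2, 1), (3, 1), (2, 4), (4, 5), (5, 3), (0, 6), (7, 1),
      (6, 4), (6, 5), (6, 3), (2, 7), (4, 7), (5, 7)] : List (Fin 8 × Fin 8)) := by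
    by_cases h0 : G.arcAt ρ i σ j = 0
    · exact arcAt_cases fun h1 => h (h0.trans h1.symm)
    · exact arcAt_cases h0
  simp only [List.mem_cons, List.not_mem_nil, or_false, Prod.mk.injEq] at hmem
  rcases hmem with ⟨rfl, rfl⟩ | ⟨rfl, rfl⟩ | ⟨rfl, rfl⟩ | ⟨rfl, rfl⟩ | ⟨rfl, rfl⟩ | ⟨rfl, rfl⟩ |
    ⟨rfl, rfl⟩ | ⟨rfl, rfl⟩ | ⟨rfl, rfl⟩ | ⟨rfl, rfl⟩ | ⟨rfl, rfl⟩ | ⟨rfl, rfl⟩ | ⟨rfl, rfl⟩ |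
    ⟨rfl, rfl⟩ | ⟨rfl, rfl⟩
  · left
    by_cases hi : i = 0
    · refine ⟨j, Or.inl ⟨by simp [hi], fun hiff => h ?_⟩⟩
      simp only [arcAt, hiff]
    · simp [arcAt, hi] at h
  · left
    by_cases hi : i = 0
    · refine ⟨j, Or.inr (Or.inl ⟨by simp [hi], fun hiff => h ?_⟩)⟩
      simp only [arcAt, hiff]
    · simp [arcAt, hi] at h
  · left
    by_cases hi : j = 0
    · refine ⟨i, Or.inr (Or.inr (Or.inl ⟨by simp [hi], fun hiff => h ?_⟩))⟩
      simp only [arcAt, hiff]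
    · simp [arcAt, hi] at h
  · left
    by_cases hi : j = 0
    · refine ⟨i, Or.inr (Or.inr (Or.inr ⟨by simp [hi], fun hiff => h ?_⟩))⟩
      simp only [arcAt, hiff]
    · simp [arcAt, hi] at h
  · right; left
    exact ⟨i, j, by simp, h, rfl, rfl⟩
  · simp [arcAt, hM] at h
  · right; right
    exact ⟨j, i, by simp, h, rfl, rfl⟩
  · simp [arcAt, hβ] at h
  · simp [arcAt, hβ] at h
  · right; left
    rcases h01 with hb | hb <;> simp [arcAt, hβ, hb] at h
    exact ⟨i, j, by simp, h, by simp [arcAt, hβ, hb], by simp [arcAt, hb]⟩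
  · simp [arcAt, hβ, hM] at h
  · right; right
    rcases h01 with hb | hb <;> simp [arcAt, hβ, hb] at h
    exact ⟨j, i, by simp, h, by simp [arcAt, hβ, hb], by simp [arcAt, hb]⟩
  · right; left
    rcases h01 with hb | hb <;> simp [arcAt, hβ, hb] at h
    exact ⟨i, j, by simp, h, by simp [arcAt, hβ, hb], by simp [arcAt, hb]⟩
  · simp [arcAt, hβ, hM] at h
  · right; right
    rcases h01 with hb | hb <;> simp [arcAt, hβ, hb] at h
    exact ⟨j, i, by simp, h, by simp [arcAt, hβ, hb], by simp [arcAt, hb]⟩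

/-- All other gadgets have a constant number of completed phases while round `k` runs, and the sets
of gadget `k` are replaced only when its first phase is done. -/
theorem arc_netAt_change {D : BlockData B} (hD : D.Bounded) (mode : DynMode) (g : GraphClass) (k : Fin B)
    {d : ℕ} (hd : d ≤ 2) {u v : Fin (B * 8)}
    (h : (D.netAt mode g (3 * k + d)).arc u v ≠ (D.netAt mode g (3 * k + (d + 1))).arc u v) :
    (((u, v) = (vx 0 0, vx 2 k) ∧ ¬ (2 ≤ mode.stage d ↔ 2 ≤ mode.stage (d + 1))) ∨
      ((u, v) = (vx 0 0, vx 3 k) ∧ ¬ (3 ≤ mode.stage d ↔ 3 ≤ mode.stage (d + 1))) ∨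
      ((u, v) = (vx 2 k, vx 1 0) ∧ ¬ (3 ≤ mode.stage d ↔ 3 ≤ mode.stage (d + 1))) ∨
      ((u, v) = (vx 3 k, vx 1 0) ∧ ¬ (1 ≤ mode.stage d ↔ 1 ≤ mode.stage (d + 1)))) ∨
    (d = 0 ∧ (∃ i, (u, v) ∈ entryPairs k i) ∧
      (D.netAt mode g (3 * k + d)).arc u v = 1 - mode.bit ∧
      (D.netAt mode g (3 * k + (d + 1))).arc u v ≤ 1) := by
  have h0 : phasesDone (3 * k + d) k = d := phasesDone_self k d (by omega)
  have h1 : phasesDone (3 * k + (d + 1)) k = d + 1 := phasesDone_self k _ (by omega)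
  have hne : ∀ a : Fin B, a ≠ k →
      phasesDone (3 * k + (d + 1)) a = phasesDone (3 * k + d) a :=
    fun a ha => phasesDone_of_ne (fun e => ha (Fin.ext e)) (by omega) (by omega)
  rcases GadgetNet.arc_change (G := D.netAt mode g (3 * k + d))
      (G' := D.netAt mode g (3 * k + (d + 1))) rfl rfl g.beta_le_one h with ⟨a, ha⟩ | ⟨a, i, h2, h3, h4, h5⟩ |
    ⟨a, i, h2, h3, h4, h5⟩
  · by_cases hak : a = k
    · subst hak
      left
      simpa only [BlockData.netAt, h0, h1] using ha
    · simp [BlockData.netAt, hne a hak] at ha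
  · by_cases hak : a = k
    · subst hak
      right
      rw [h4, h5]
      simp only [BlockData.netAt, h0, h1] at h3 ⊢
      by_cases hd0 : d = 0
      · subst hd0
        refine ⟨rfl, ⟨i, ?_⟩, by simp, by simpa using hD.u a i⟩
        rcases h2 with h2 | h2 | h2 <;> simp [h2, entryPairs]
      · simp [hd0] at h3
    · simp [BlockData.netAt, hne a hak] at h3
  · by_cases hak : a = k
    · subst hak
      right
      rw [h4, h5]
      simp only [BlockData.netAt, h0, h1] at h3 ⊢
      by_cases hd0 : d = 0
      · subst hd0
        refine ⟨rfl, ⟨i, ?_⟩, by simp, by simpa using hD.v a i⟩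
        rcases h2 with h2 | h2 | h2 <;> simp [h2, entryPairs]
      · simp [hd0] at h3
    · simp [BlockData.netAt, hne a hak] at h3

theorem arc_first {D : BlockData B} (hD : D.Bounded) (mode : DynMode) (g : GraphClass) (k : Fin B)
    (u v : Fin (B * 8))
    (h : (D.netAt mode g (3 * k)).arc u v ≠ (D.netAt mode g (3 * k + 1)).arc u v) :
    (u, v) ∈ firstPairs k ∧ (D.netAt mode g (3 * k)).arc u v = 1 - mode.bit ∧
      (D.netAt mode g (3 * k + 1)).arc u v = mode.bit := by
  have h0 : phasesDone (3 * k) k = 0 := phasesDone_self k 0 (by omega)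
  have h1 : phasesDone (3 * k + 1) k = 1 := phasesDone_self k 1 (by omega)
  have hc := arc_netAt_change hD mode g k (d := 0) (by omega) h
  simp only [Nat.add_zero, Nat.zero_add] at hc
  rcases hc with (⟨hp, hs⟩ | ⟨hp, hs⟩ | ⟨hp, hs⟩ | ⟨hp, hs⟩) | ⟨-, ⟨i, hi⟩, h2, h3⟩
  on_goal 5 =>
    refine ⟨?_, h2, ?_⟩
    · exact List.mem_append_left _ (List.mem_flatMap.2 ⟨i, List.mem_finRange i, hi⟩)
    · rw [h2] at h
      cases mode <;> simp only [DynMode.bit] at h ⊢ <;> omega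
  all_goals
    obtain ⟨rfl, rfl⟩ := Prod.mk.inj hp
    cases mode <;> simp [DynMode.stage] at hs <;>
      simp [firstPairs, GadgetNet.arcAt, BlockData.netAt, DynMode.stage, DynMode.bit, h0, h1]

theorem arc_second {D : BlockData B} (hD : D.Bounded) (mode : DynMode) (g : GraphClass) (k : Fin B)
    (u v : Fin (B * 8))
    (h : (D.netAt mode g (3 * k + 1)).arc u v ≠ (D.netAt mode g (3 * k + 2)).arc u v) :
    (u, v) ∈ secondPairs k ∧ (D.netAt mode g (3 * k + 1)).arc u v = 1 - mode.bit ∧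
      (D.netAt mode g (3 * k + 2)).arc u v = mode.bit := by
  have h0 : phasesDone (3 * k + 1) k = 1 := phasesDone_self k 1 (by omega)
  have h1 : phasesDone (3 * k + 2) k = 2 := phasesDone_self k 2 (by omega)
  rcases arc_netAt_change hD mode g k (d := 1) (by omega) h with
    (⟨hp, hs⟩ | ⟨hp, hs⟩ | ⟨hp, hs⟩ | ⟨hp, hs⟩) | ⟨h5, -⟩
  on_goal 5 => omega
  all_goals
    obtain ⟨rfl, rfl⟩ := Prod.mk.inj hp
    cases mode <;> simp [DynMode.stage] at hs <;>
      simp [secondPairs, GadgetNet.arcAt, BlockData.netAt, DynMode.stage, DynMode.bit, h0, h1]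

theorem arc_third {D : BlockData B} (hD : D.Bounded) (mode : DynMode) (g : GraphClass) (k : Fin B)
    (u v : Fin (B * 8))
    (h : (D.netAt mode g (3 * k + 2)).arc u v ≠ (D.netAt mode g (3 * k + 3)).arc u v) :
    (u, v) ∈ thirdPairs k ∧ (D.netAt mode g (3 * k + 2)).arc u v = 1 - mode.bit ∧
      (D.netAt mode g (3 * k + 3)).arc u v = mode.bit := by
  have h0 : phasesDone (3 * k + 2) k = 2 := phasesDone_self k 2 (by omega)
  have h1 : phasesDone (3 * k + 3) k = 3 := phasesDone_self k 3 (by omega)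
  rcases arc_netAt_change hD mode g k (d := 2) (by omega) h with
    (⟨hp, hs⟩ | ⟨hp, hs⟩ | ⟨hp, hs⟩ | ⟨hp, hs⟩) | ⟨h5, -⟩
  on_goal 5 => omega
  all_goals
    obtain ⟨rfl, rfl⟩ := Prod.mk.inj hp
    cases mode <;> simp [DynMode.stage] at hs <;>
      simp [thirdPairs, GadgetNet.arcAt, BlockData.netAt, DynMode.stage, DynMode.bit, h0, h1]

/-! ### The initial adjustment -/

theorem startCap_symm (g : GraphClass) (mode : DynMode) (p q : Fin (B * 8) × Fin (B * 8))
    (h : g.SameEdge p q) : startCap B g mode q.1 q.2 = startCap B g mode p.1 p.2 := by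
  cases mode with
  | incremental => rfl
  | decremental =>
    have h1 := GadgetNet.cap_symm (G := hubNet B g) rfl p q h
    have h2 : q.1 = q.2 ↔ p.1 = p.2 := by
      cases g with
      | unweightedDirected => rw [show q = p from h]
      | weightedUndirected k => rcases h with rfl | rfl <;> simp [eq_comm]
    simp only [startCap, h1, h2]

omit [NeZero B] in
theorem hubNet_bounded (g : GraphClass) : (hubNet B g).Bounded :=
  ⟨by simp [hubNet], by simp [hubNet], by simp [hubNet], g.beta_le_one⟩

theorem isStart_startCap {g : GraphClass} (hg : ∀ k, g = .weightedUndirected k → 1 ≤ k)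
    (mode : DynMode) : mode.IsStart g (startCap B g mode) := by
  cases mode with
  | incremental => intro u v; rfl
  | decremental =>
    refine ⟨fun u => by simp [startCap], fun u v huv => ⟨by simp [startCap, huv], ?_⟩, ?_⟩
    · refine GraphClass.le_maxCap hg ?_
      have h1 := (hubNet B g).cap_le (hubNet_bounded g) u v
      have h2 : (hubNet B g).β = g.beta := rfl
      rw [h2] at h1
      have := NeZero.pos B
      simp only [startCap, huv, if_false]
      split_ifs at h1 ⊢ <;> omega
    · cases g with
      | unweightedDirected => trivial
      | weightedUndirected k =>
        intro u v
        exact startCap_symm (.weightedUndirected k) .decremental (v, u) (u, v) (Or.inr rfl)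

/-- Every edge needed at time `0` has its right capacity in the complete start graph already. This
makes the initial adjustment of the decremental setting consist of deletions only. -/
theorem arc_full {D : BlockData B} (hD : D.Bounded) (g : GraphClass) (u v : Fin (B * 8))
    (h : (D.netAt .decremental g 0).arc u v ≠ 0) :
    (D.netAt .decremental g 0).arc u v = max 1 ((hubNet B g).arc u v) := by
  obtain ⟨ρ, i, rfl⟩ := exists_vx u
  obtain ⟨σ, j, rfl⟩ := exists_vx v
  rw [GadgetNet.arc_vx] at h ⊢
  rw [GadgetNet.arc_vx]
  have hM : D.M i j ≠ 0 → D.M i j = 1 := fun h => by have := hD.M i j; omega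
  have h01 : g.beta = 0 ∨ g.beta = 1 := by have := g.beta_le_one; omega
  have hB := NeZero.pos B
  have hmem := GadgetNet.arcAt_cases h
  simp only [List.mem_cons, List.not_mem_nil, or_false, Prod.mk.injEq] at hmem
  rcases hmem with ⟨rfl, rfl⟩ | ⟨rfl, rfl⟩ | ⟨rfl, rfl⟩ | ⟨rfl, rfl⟩ | ⟨rfl, rfl⟩ | ⟨rfl, rfl⟩ |
    ⟨rfl, rfl⟩ | ⟨rfl, rfl⟩ | ⟨rfl, rfl⟩ | ⟨rfl, rfl⟩ | ⟨rfl, rfl⟩ | ⟨rfl, rfl⟩ | ⟨rfl, rfl⟩ |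
    ⟨rfl, rfl⟩ | ⟨rfl, rfl⟩ <;> rcases h01 with h0 | h0 <;>
    simp [GadgetNet.arcAt, BlockData.netAt, hubNet, phasesDone, DynMode.stage, DynMode.bit, h0]
      at h hM ⊢ <;> first | done | omega | exact hM h | (simp [h]; done) | (simp [h]; omega)

theorem cap_full {D : BlockData B} (hD : D.Bounded) (g : GraphClass) (u v : Fin (B * 8))
    (h : (D.netAt .decremental g 0).cap u v ≠ 0) :
    u ≠ v ∧ (D.netAt .decremental g 0).cap u v = max 1 ((hubNet B g).cap u v) := by
  have h01 : g.beta = 0 ∨ g.beta = 1 := by have := g.beta_le_one; omega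
  have e1 : (D.netAt .decremental g 0).β = g.beta := rfl
  have e2 : (hubNet B g).β = g.beta := rfl
  by_cases h0 : (D.netAt .decremental g 0).arc u v = 0
  · have h1 : g.beta = 1 := by
      rcases h01 with h1 | h1
      · simp [GadgetNet.cap, h0, e1, h1] at h
      · exact h1
    have h2 : (D.netAt .decremental g 0).arc v u ≠ 0 := by
      intro h2; simp [GadgetNet.cap, h0, h2] at h
    refine ⟨((D.netAt .decremental g 0).arc_rev (hubNet B g) h2).1.symm, ?_⟩
    simp only [GadgetNet.cap, h0, e1, e2, h1, arc_full hD g v u h2,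
      ((D.netAt .decremental g 0).arc_rev (hubNet B g) h2).2]
    simp
  · refine ⟨((D.netAt .decremental g 0).arc_rev (hubNet B g) h0).1, ?_⟩
    simp only [GadgetNet.cap, arc_full hD g u v h0,
      ((D.netAt .decremental g 0).arc_rev (hubNet B g) h0).2,
      ((D.netAt .decremental g 0).arc_rev (D.netAt .decremental g 0) h0).2]
    simp

end

theorem mem_initPairs {N : ℕ} {g : GraphClass} {p : Fin N × Fin N} :
    p ∈ initPairs N g ↔ g.beta = 0 ∨ p.1 < p.2 := by
  simp only [initPairs, List.mem_flatMap, List.mem_finRange, true_and]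
  constructor
  · rintro ⟨e, he⟩
    split_ifs at he with h
    · rw [List.mem_singleton] at he
      subst he
      exact h
    · simp at he
  · intro h
    refine ⟨finProdFinEquiv p, ?_⟩
    have h1 : ((finProdFinEquiv p).divNat, (finProdFinEquiv p).modNat) = p :=
      finProdFinEquiv.symm_apply_apply p
    have h2 := congrArg Prod.fst h1
    have h3 := congrArg Prod.snd h1
    simp only at h2 h3
    rw [h2, h3, if_pos h]
    simp

theorem nodup_initPairs (N : ℕ) (g : GraphClass) : (initPairs N g).Nodup := by
  refine List.nodup_flatMap.2 ⟨fun e _ => by split <;> simp, ?_⟩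
  refine List.Pairwise.imp ?_ (List.nodup_finRange (N * N))
  intro e e' hee
  have h : (e.divNat, e.modNat) ≠ (e'.divNat, e'.modNat) :=
    fun h => hee (finProdFinEquiv.symm.injective h)
  simp only [Function.onFun]
  split <;> split <;> simp
  simpa [Prod.ext_iff, eq_comm] using h

theorem pairwise_initPairs (N : ℕ) (g : GraphClass) :
    (initPairs N g).Pairwise fun p q => ¬ g.SameEdge p q := by
  refine List.Pairwise.imp_of_mem (fun {p q} hp hq hne hs => ?_) (nodup_initPairs N g)
  rw [mem_initPairs] at hp hq
  cases g with
  | unweightedDirected => exact hne (Eq.symm hs)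
  | weightedUndirected k =>
    simp only [GraphClass.beta, one_ne_zero, false_or] at hp hq
    rcases hs with rfl | rfl
    · exact hne rfl
    · exact absurd hp (not_lt.2 hq.le)

theorem length_initPairs_le (N : ℕ) (g : GraphClass) : (initPairs N g).length ≤ N * N := by
  rw [initPairs, List.length_flatMap]
  calc _ ≤ ((List.finRange (N * N)).map fun _ => 1).sum := by
        refine List.sum_le_sum fun e _ => ?_
        split <;> simp
    _ = N * N := by simp

section

variable {B : ℕ} [NeZero B]

theorem syncReqs_init {mode : DynMode} {g : GraphClass}
    (hg : ∀ k, g = .weightedUndirected k → 1 ≤ k) {D : BlockData B} (hD : D.Bounded) :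
    (syncReqs (startCap B g mode) (D.netAt mode g 0).cap (initPairs (B * 8) g)).foldl g.apply
        (startCap B g mode) = (D.netAt mode g 0).cap ∧
      ∀ rest, mode.Legal g (D.netAt mode g 0).cap rest → mode.Legal g (startCap B g mode)
        (syncReqs (startCap B g mode) (D.netAt mode g 0).cap (initPairs (B * 8) g) ++ rest) := by
  have hcap := GadgetNet.cap_symm (G := D.netAt mode g 0) (g := g) rfl
  refine syncReqs_spec hcap _ (pairwise_initPairs _ g) _ (startCap_symm g mode) ?_ ?_
  · rintro ⟨u, v⟩ h
    by_cases hb : g.beta = 0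
    · exact ⟨(u, v), mem_initPairs.2 (Or.inl hb), g.sameEdge_refl _⟩
    · have huv : u ≠ v := by
        rintro rfl
        refine h ?_
        rw [GadgetNet.cap_self]
        cases mode <;> simp [startCap]
      rcases lt_or_gt_of_ne huv with h1 | h1
      · exact ⟨(u, v), mem_initPairs.2 (Or.inr h1), g.sameEdge_refl _⟩
      · refine ⟨(v, u), mem_initPairs.2 (Or.inr h1), ?_⟩
        cases g with
        | unweightedDirected => exact absurd rfl hb
        | weightedUndirected k => exact Or.inr rfl
  · rintro ⟨u, v⟩ h
    cases mode with
    | incremental =>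
      simp only [startCap] at h
      refine ⟨?_, rfl, by simp only; omega, ?_⟩
      · intro huv
        exact h (by rw [show u = v from huv, GadgetNet.cap_self])
      · exact GraphClass.le_maxCap hg (GadgetNet.cap_le _ (hD.netAt _ _ _) u v)
    | decremental =>
      have h1 : (D.netAt .decremental g 0).cap u v = 0 := by
        by_contra h0
        obtain ⟨h2, h3⟩ := cap_full hD g u v h0
        refine h ?_
        simp only [startCap, h2, if_false, h3]
      exact ⟨fun h0 => h (h0.trans h1.symm), h1⟩

variable {mode : DynMode} {g : GraphClass}

/-! ### Legality, length and meaning of the whole request sequence -/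

theorem syncReqs_first (hg : ∀ k, g = .weightedUndirected k → 1 ≤ k) {D : BlockData B}
    (hD : D.Bounded) (k : Fin B) :
    (syncReqs (D.netAt mode g (3 * k)).cap (D.netAt mode g (3 * k + 1)).cap
        (firstPairs k)).foldl g.apply (D.netAt mode g (3 * k)).cap
          = (D.netAt mode g (3 * k + 1)).cap ∧
      ∀ rest, mode.Legal g (D.netAt mode g (3 * k + 1)).cap rest →
        mode.Legal g (D.netAt mode g (3 * k)).cap
          (syncReqs (D.netAt mode g (3 * k)).cap (D.netAt mode g (3 * k + 1)).cap
            (firstPairs k) ++ rest) :=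
  syncReqs_phase hg rfl rfl (nodup_firstPairs k) (forward_firstPairs k) (arc_first hD mode g k)

theorem syncReqs_second (hg : ∀ k, g = .weightedUndirected k → 1 ≤ k) {D : BlockData B}
    (hD : D.Bounded) (k : Fin B) :
    (syncReqs (D.netAt mode g (3 * k + 1)).cap (D.netAt mode g (3 * k + 2)).cap
        (secondPairs k)).foldl g.apply (D.netAt mode g (3 * k + 1)).cap
          = (D.netAt mode g (3 * k + 2)).cap ∧
      ∀ rest, mode.Legal g (D.netAt mode g (3 * k + 2)).cap rest →
        mode.Legal g (D.netAt mode g (3 * k + 1)).cap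
          (syncReqs (D.netAt mode g (3 * k + 1)).cap (D.netAt mode g (3 * k + 2)).cap
            (secondPairs k) ++ rest) :=
  syncReqs_phase hg rfl rfl (by simp [secondPairs]) (forward_secondPairs k)
    (arc_second hD mode g k)

theorem syncReqs_third (hg : ∀ k, g = .weightedUndirected k → 1 ≤ k) {D : BlockData B}
    (hD : D.Bounded) (k : Fin B) :
    (syncReqs (D.netAt mode g (3 * k + 2)).cap (D.netAt mode g (3 * k + 3)).cap
        (thirdPairs k)).foldl g.apply (D.netAt mode g (3 * k + 2)).cap
          = (D.netAt mode g (3 * k + 3)).cap ∧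
      ∀ rest, mode.Legal g (D.netAt mode g (3 * k + 3)).cap rest →
        mode.Legal g (D.netAt mode g (3 * k + 2)).cap
          (syncReqs (D.netAt mode g (3 * k + 2)).cap (D.netAt mode g (3 * k + 3)).cap
            (thirdPairs k) ++ rest) :=
  syncReqs_phase hg rfl rfl (nodup_thirdPairs k) (forward_thirdPairs k) (arc_third hD mode g k)

theorem legal_query {n : ℕ} {cap : Network n} {rest : List (FlowRequest n)}
    (h : mode.Legal g cap rest) : mode.Legal g cap (.query :: rest) :=
  ⟨by cases mode <;> trivial, h⟩

theorem legal_rounds (hg : ∀ k, g = .weightedUndirected k → 1 ≤ k) {D : BlockData B}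
    (hD : D.Bounded) : ∀ d k : ℕ, k + d = B →
      mode.Legal g (D.netAt mode g (3 * k)).cap
        (((List.finRange B).drop k).flatMap (D.roundReqs mode g)) := by
  intro d
  induction d with
  | zero =>
    intro k hk
    rw [List.drop_eq_nil_of_le (by simp; omega)]
    trivial
  | succ d ih =>
    intro k hk
    have hkB : k < B := by omega
    rw [List.drop_eq_getElem_cons (by simpa using hkB), List.flatMap_cons, List.getElem_finRange]
    simp only [BlockData.roundReqs, List.append_assoc, List.cons_append, Fin.cast_mk]
    refine (syncReqs_first hg hD ⟨k, hkB⟩).2 _ (legal_query ?_)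
    refine (syncReqs_second hg hD ⟨k, hkB⟩).2 _ (legal_query ?_)
    -- The time `3 * k + 3` after the third phase is definitionally the time `3 * (k + 1)` at which
    -- the next round begins.
    exact (syncReqs_third hg hD ⟨k, hkB⟩).2 _ (ih (k + 1) (by omega))

theorem legal_reqs (hg : ∀ k, g = .weightedUndirected k → 1 ≤ k) {D : BlockData B}
    (hD : D.Bounded) : mode.Legal g (startCap B g mode) (D.reqs mode g) := by
  refine (syncReqs_init hg hD).2 _ ?_
  simpa using legal_rounds hg hD B 0 (by omega)

/-- The adjustment of the start graph takes at most `(8 * B)²` requests. A round takes at most `6 *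
B + 3`, `1` and `3` updates and two queries, hence at most `15 * B` requests; and `64 + 15 = 79`. -/
theorem length_reqs_le (D : BlockData B) : (D.reqs mode g).length ≤ 79 * (B * B) := by
  have h1 := (length_syncReqs_le (startCap B g mode) (D.netAt mode g 0).cap
    (initPairs (B * 8) g)).trans (length_initPairs_le (B * 8) g)
  have h2 : ((List.finRange B).flatMap (D.roundReqs mode g)).length ≤ B * (15 * B) := by
    rw [List.length_flatMap]
    calc _ ≤ ((List.finRange B).map fun _ => 15 * B).sum := by
          refine List.sum_le_sum fun k _ => ?_
          have hB := NeZero.pos B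
          have e1 := length_syncReqs_le (D.netAt mode g (3 * k)).cap
            (D.netAt mode g (3 * k + 1)).cap (firstPairs k)
          have e2 := length_syncReqs_le (D.netAt mode g (3 * k + 1)).cap
            (D.netAt mode g (3 * k + 2)).cap (secondPairs k)
          have e3 := length_syncReqs_le (D.netAt mode g (3 * k + 2)).cap
            (D.netAt mode g (3 * k + 3)).cap (thirdPairs k)
          have e4 : (firstPairs k).length = B * 6 + 3 := by
            simp [firstPairs, List.length_flatMap, entryPairs]
          have e5 : (secondPairs k).length = 1 := rfl
          have e6 : (thirdPairs k).length = 3 := rfl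
          simp only [BlockData.roundReqs, List.length_append, List.length_cons]
          omega
      _ = B * (15 * B) := by simp
  simp only [BlockData.reqs, List.length_append]
  have e : B * 8 * (B * 8) = 64 * (B * B) := by ring
  have e' : B * (15 * B) = 15 * (B * B) := by ring
  omega

/-- The two answers in a round tell whether there is a witness. -/
theorem query_answers {D : BlockData B} (hD : D.Bounded) (k : Fin B) {x₁ x₂ : ℝ}
    (hx₁ : IsMaxFlowValue (D.netAt mode g (3 * k + 1)).cap (vx 0 0) (vx 1 0) x₁)
    (hx₂ : IsMaxFlowValue (D.netAt mode g (3 * k + 2)).cap (vx 0 0) (vx 1 0) x₂) :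
    (match mode with
      | .incremental => x₁ < x₂
      | .decremental => x₂ < x₁) ↔ ∃ a b, D.u k a = 1 ∧ D.M a b = 1 ∧ D.v k b = 1 := by
  have h1 : phasesDone (3 * k + 1) k = 1 := phasesDone_self k 1 (by omega)
  have h2 : phasesDone (3 * k + 2) k = 2 := phasesDone_self k 2 (by omega)
  have hne : ∀ j : Fin B, j ≠ k → phasesDone (3 * k + 2) j = phasesDone (3 * k + 1) j :=
    fun j hj => phasesDone_of_ne (fun e => hj (Fin.ext e)) (by omega) (by omega)
  have h03 : ∀ j : Fin B, j ≠ k →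
      phasesDone (3 * k + 1) j = 0 ∨ phasesDone (3 * k + 1) j = 3 := by
    intro j hj
    have : (j : ℕ) ≠ k := fun e => hj (Fin.ext e)
    unfold phasesDone
    omega
  -- Between the two queries only the stage of gadget `k` changes, so the two networks have the form
  -- compared in `value_lt_iff`.
  have hUV : (D.netAt mode g (3 * k + 2)) =
      { D.netAt mode g (3 * k + 1) with stage := (D.netAt mode g (3 * k + 2)).stage } := by
    simp only [BlockData.netAt, GadgetNet.mk.injEq, true_and, and_true]
    constructor <;> funext j i <;> by_cases hj : j = k
    · subst hj; simp [h1, h2]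
    · rw [hne j hj]
    · subst hj; simp [h1, h2]
    · rw [hne j hj]
  have hU : ∀ a, (D.netAt mode g (3 * k + 1)).U k a = D.u k a := by
    intro a; simp [BlockData.netAt, h1]
  have hV : ∀ a, (D.netAt mode g (3 * k + 1)).V k a = D.v k a := by
    intro a; simp [BlockData.netAt, h1]
  have hB := hD.netAt mode g (3 * k + 1)
  rw [hUV] at hx₂
  cases mode with
  | incremental =>
    have := GadgetNet.value_lt_iff hB (k := k) (σ₁ := (D.netAt .incremental g (3 * k + 1)).stage)
      (σ₂ := (D.netAt .incremental g (3 * k + 2)).stage) h1 h2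
      (fun j hj => (hne j hj).symm) (fun j hj => by
        simp only [BlockData.netAt, DynMode.stage, hne j hj]; exact h03 j hj) hx₁ hx₂
    simp only [hU, hV] at this
    exact this
  -- The stages descend here, so the first query sees the active gadget and the second one the
  -- inactive gadget.
  | decremental =>
    have := GadgetNet.value_lt_iff hB (k := k) (σ₂ := (D.netAt .decremental g (3 * k + 1)).stage)
      (σ₁ := (D.netAt .decremental g (3 * k + 2)).stage)
      (by simp [BlockData.netAt, DynMode.stage, h2])
      (by simp [BlockData.netAt, DynMode.stage, h1])
      (fun j hj => by simp only [BlockData.netAt, hne j hj]) (fun j hj => by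
        simp only [BlockData.netAt, DynMode.stage]; have := h03 j hj; omega) hx₂ hx₁
    simp only [hU, hV] at this
    exact this

end

/-! ### Simulating the data structure of one block -/

section
variable (L : Layout) (st : St)

@[simp] theorem SrcExpr.eval_setInst (q : ℕ) (μ : RamMem) :
    ∀ e : SrcExpr, e.eval L (st.setInst q μ) = e.eval L st
  | .const _ => rfl
  | .size => rfl
  | .reg _ => rfl
  | .mat e => by rw [eval_mat, eval_mat, eval_setInst q μ e]
  | .vec e => by rw [eval_vec, eval_vec, eval_setInst q μ e]; rfl
  | .ans e => by rw [eval_ans, eval_ans, eval_setInst q μ e]; rfl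
  | .bin o a b => by
    change o.toRam.eval _ _ = o.toRam.eval _ _
    rw [eval_setInst q μ a, eval_setInst q μ b]

@[simp] theorem St.setInst_setInst (q : ℕ) (μ μ' : RamMem) :
    (st.setInst q μ).setInst q μ' = st.setInst q μ' := by simp [St.setInst]

@[simp] theorem St.setInst_self (q : ℕ) : st.setInst q (st.inst q) = st := by simp [St.setInst]

@[simp] theorem St.reg_setInst (q : ℕ) (μ : RamMem) : (st.setInst q μ).reg = st.reg := rfl
@[simp] theorem St.vec_setInst (q : ℕ) (μ : RamMem) : (st.setInst q μ).vec = st.vec := rfl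
@[simp] theorem St.ans_setInst (q : ℕ) (μ : RamMem) : (st.setInst q μ).ans = st.ans := rfl
@[simp] theorem St.inst_setInst (q : ℕ) (μ : RamMem) : (st.setInst q μ).inst q = μ := by
  simp [St.setInst]
@[simp] theorem St.vec_setReg (r : Fin 32) (v : ℕ) : (st.setReg r v).vec = st.vec := rfl
@[simp] theorem St.ans_setReg (r : Fin 32) (v : ℕ) : (st.setReg r v).ans = st.ans := rfl
@[simp] theorem St.inst_setReg (r : Fin 32) (v : ℕ) : (st.setReg r v).inst = st.inst := rfl
@[simp] theorem St.reg_setReg (r : Fin 32) (v : ℕ) : (st.setReg r v).reg r = v := by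
  simp [St.setReg]
theorem St.reg_setReg_of_ne {r r' : Fin 32} (h : r' ≠ r) (v : ℕ) :
    (st.setReg r v).reg r' = st.reg r' := by simp [St.setReg, h]
@[simp] theorem St.reg_setAns (i v : ℕ) : (st.setAns i v).reg = st.reg := rfl
@[simp] theorem St.vec_setAns (i v : ℕ) : (st.setAns i v).vec = st.vec := rfl
@[simp] theorem St.inst_setAns (i v : ℕ) : (st.setAns i v).inst = st.inst := rfl
@[simp] theorem St.ans_setAns (i v : ℕ) : (st.setAns i v).ans = Function.update st.ans i v := rfl

end

/-- The states agree up to the temporary registers and the region `q`. -/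
structure St.Agree (q : ℕ) (st st' : St) : Prop where
  vec : st'.vec = st.vec
  ans : st'.ans = st.ans
  reg : ∀ r : Fin 32, r < 12 → st'.reg r = st.reg r
  inst : ∀ q', q' ≠ q → st'.inst q' = st.inst q'

namespace St.Agree

variable {q : ℕ} {st st' st'' : St}

theorem refl : St.Agree q st st := ⟨rfl, rfl, fun _ _ => rfl, fun _ _ => rfl⟩

theorem trans (h : St.Agree q st st') (h' : St.Agree q st' st'') : St.Agree q st st'' :=
  ⟨h'.vec.trans h.vec, h'.ans.trans h.ans, fun r hr => (h'.reg r hr).trans (h.reg r hr),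
    fun q' hq => (h'.inst q' hq).trans (h.inst q' hq)⟩

theorem setReg (h : St.Agree q st st') {r : Fin 32} (hr : 12 ≤ r) (v : ℕ) :
    St.Agree q st (st'.setReg r v) :=
  ⟨h.vec, h.ans, fun r' hr' => by
    rw [St.reg_setReg_of_ne _ (ne_of_lt (lt_of_lt_of_le hr' hr))]; exact h.reg r' hr', h.inst⟩

theorem setInst (h : St.Agree q st st') (μ : RamMem) : St.Agree q st (st'.setInst q μ) :=
  ⟨h.vec, h.ans, h.reg, fun q' hq => by simpa [St.setInst, hq] using h.inst q' hq⟩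

end St.Agree

namespace DynFlowAlgorithm

variable (A : DynFlowAlgorithm) (g : GraphClass) (W : ℕ) {n : ℕ} (s t : Fin n)

/-- In memory `μ` the requests `l ++ rest` are handled in total time `τ`, and the requests `l` lead
to the network `F`. -/
def Pending (F : Network n) (l rest : List (FlowRequest n)) (μ : RamMem) (τ : ℕ) : Prop :=
  -- The current network remains implicit: while the updates of a phase are issued, only the network
  -- at their end matters, because only there a query is asked.
  ∃ cap, l.foldl g.apply cap = F ∧ A.Handles g W s t cap μ (l ++ rest) τ

variable {A g W s t}

theorem pending_nil {F : Network n} {rest : List (FlowRequest n)} {μ : RamMem} {τ : ℕ}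
    (h : A.Pending g W s t F [] rest μ τ) : A.Handles g W s t F μ rest τ := by
  obtain ⟨cap, rfl, h⟩ := h
  exact h

theorem pending_update {F : Network n} {u v : Fin n} {c : ℕ} {l rest : List (FlowRequest n)}
    {μ : RamMem} {τ : ℕ} (h : A.Pending g W s t F (.update u v c :: l) rest μ τ) :
    ∃ μ' τ₁ τ₂, RamExec W A.update
      (Function.update (Function.update (Function.update μ 0 (u : ℕ)) 1 (v : ℕ)) 2 c) μ' τ₁ ∧
      A.Pending g W s t F l rest μ' τ₂ ∧ τ = τ₁ + τ₂ := by
  obtain ⟨cap, hF, μ', τ₁, τ₂, h1, -, h2, h3⟩ := h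
  exact ⟨μ', τ₁, τ₂, h1, ⟨_, hF, h2⟩, h3⟩

/-- Issue an update if a condition holds. -/
def tryUpdate (A : DynFlowAlgorithm) (f u v c : SrcExpr) : RamProg :=
  f.branch (assignCell 0 u ;; assignCell 1 v ;; assignCell 2 c ;; A.update.reloc) .skip

/-- Ask for the maximal value of a flow and keep the answer in a register. -/
def ask (A : DynFlowAlgorithm) (r : Fin 32) : RamProg := A.query.reloc ;; fetch r

variable {L : Layout} {st : St} {φ τ q : ℕ} {Q : St → ℕ → Prop}

/-- The condition decides whether the item is empty. The four time units pay for the test and the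
three argument cells; the update itself is paid by the credits. -/
theorem wp_tryUpdate {f u v c : SrcExpr} {μ : RamMem} (hq : q < L.cnt)
    (hb : st.reg 0 = L.base q) (hW : W ≤ L.S) (hS : 3 ≤ L.S) (hnV : n ≤ L.V)
    {old new F : Network n} {p : Fin n × Fin n} {l rest : List (FlowRequest n)}
    (hP : A.Pending g W s t F (syncItem old new p ++ l) rest μ τ)
    (hf : f.eval L st ≠ 0 ↔ old p.1 p.2 ≠ new p.1 p.2) (hu : u.eval L st = p.1)
    (hv : v.eval L st = p.2) (hc : old p.1 p.2 ≠ new p.1 p.2 →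
      c.eval L st = new p.1 p.2 ∧ new p.1 p.2 < L.V)
    (hQ : ∀ μ' τ', A.Pending g W s t F l rest μ' τ' → Q (st.setInst q μ') (φ + 30 * τ')) :
    L.WP (A.tryUpdate f u v c) 4 Q (st.setInst q μ) (φ + 30 * τ) := by
  refine Layout.WP.branch (T := 3) (fun h => ?_) (fun h => ?_)
  · rw [eval_setInst] at h
    have hne := hf.1 h
    obtain ⟨hc1, hc2⟩ := hc hne
    rw [syncItem, if_neg hne] at hP
    obtain ⟨μ', τ₁, τ₂, he, hP', rfl⟩ := pending_update hP
    refine Layout.WP.seq (T₁ := 1) (T₂ := 2) (Layout.WP.assignCell hq hb (by simp; omega)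
      (by rw [eval_setInst, hu]; have := p.1.2; omega) ?_)
    refine Layout.WP.seq (T₁ := 1) (T₂ := 1) (Layout.WP.assignCell hq hb (by simp; omega)
      (by rw [eval_setInst, eval_setInst, hv]; have := p.2.2; omega) ?_)
    refine Layout.WP.seq (T₁ := 1) (T₂ := 0) (Layout.WP.assignCell hq hb (by simp; omega)
      (by rw [eval_setInst, eval_setInst, eval_setInst, hc1]; exact hc2) ?_)
    have e : φ + 30 * (τ₁ + τ₂) = (φ + 30 * τ₂) + 30 * τ₁ := by ring
    rw [e]
    refine Layout.WP.call (W := W) (μ' := μ') hq hb hW ?_ ?_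
    · simpa [hu, hv, hc1] using he
    · simpa using hQ _ _ hP'
  · rw [eval_setInst] at h
    have he : old p.1 p.2 = new p.1 p.2 := by
      by_contra hne; exact hf.2 hne h
    rw [syncItem, if_pos he] at hP
    exact Layout.WP.mono_time (Layout.WP.skip (hQ _ _ hP)) (by omega)

theorem wp_ask {r : Fin 32} {μ : RamMem} (hq : q < L.cnt) (hb : st.reg 0 = L.base q)
    (hW : W ≤ L.S) (hS : 3 ≤ L.S) {F : Network n} {rest : List (FlowRequest n)}
    (hP : A.Handles g W s t F μ (.query :: rest) τ)
    (hQ : ∀ μ' τ', IsMaxFlowValue F s t (μ' 0 : ℝ) → A.Handles g W s t F μ' rest τ' →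
      Q ((st.setInst q μ').setReg r (μ' 0)) (φ + 30 * τ')) :
    L.WP (A.ask r) 1 Q (st.setInst q μ) (φ + 30 * τ) := by
  obtain ⟨μ', τ₁, τ₂, h1, h2, h3, rfl⟩ := hP
  refine Layout.WP.seq (T₁ := 0) (T₂ := 1) ?_
  have e : φ + 30 * (τ₁ + τ₂) = (φ + 30 * τ₂) + 30 * τ₁ := by ring
  rw [e]
  refine Layout.WP.call (W := W) (μ' := μ') hq hb hW (by rw [St.inst_setInst]; exact h1) ?_
  rw [St.setInst_setInst]
  refine Layout.WP.fetch hq hb (by omega) fun _ => ?_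
  rw [St.inst_setInst]
  exact hQ _ _ (h2 rfl) h3

end DynFlowAlgorithm

/-! ### The program for one block in one round -/

/-- The test whether a row of the block exists and has no witness yet. -/
def rowTest : SrcExpr :=
  ((reg 7 * reg 2 + reg 12).ltb size) * (1 - ans (reg 7 * reg 2 + reg 12))

/-- The entry of the vector that belongs to a column of the block. -/
def colTest : SrcExpr :=
  ((reg 8 * reg 2 + reg 12).ltb size) * vec (reg 8 * reg 2 + reg 12)

namespace DynFlowAlgorithm

/-- The updates of the first phase that belong to one index. -/
def entryStep (A : DynFlowAlgorithm) (b β : ℕ) : RamProg :=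
  assign 13 (rowTest.eqb (const b)) ;;
  assign 14 (colTest.eqb (const b)) ;;
  A.tryUpdate (reg 13) (2 + 8 * reg 6) (4 + 8 * reg 12) (const b) ;;
  A.tryUpdate (reg 14) (5 + 8 * reg 12) (3 + 8 * reg 6) (const b) ;;
  A.tryUpdate (const β * reg 13) (6 + 8 * reg 6) (4 + 8 * reg 12) (const b) ;;
  A.tryUpdate (const β * reg 13) (2 + 8 * reg 6) (7 + 8 * reg 12) (const b) ;;
  A.tryUpdate (const β * reg 14) (6 + 8 * reg 12) (3 + 8 * reg 6) (const b) ;;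
  A.tryUpdate (const β * reg 14) (5 + 8 * reg 12) (7 + 8 * reg 6) (const b)

/-- All requests for a block in a round.  The answers are kept in registers. -/
def blockStep (A : DynFlowAlgorithm) (b β : ℕ) : RamProg :=
  forLoop 12 (reg 2) (A.entryStep b β) ;;
  A.tryUpdate (const b) (3 + 8 * reg 6) 1 (const b) ;;
  A.tryUpdate (const (1 - b)) (2 + 8 * reg 6) 1 (const b) ;;
  A.tryUpdate (const (1 - b)) 0 (3 + 8 * reg 6) (const b) ;;
  A.ask 15 ;;
  A.tryUpdate 1 0 (2 + 8 * reg 6) (const b) ;;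
  A.ask 16 ;;
  A.tryUpdate (const b) (2 + 8 * reg 6) 1 (const b) ;;
  A.tryUpdate (const b) 0 (3 + 8 * reg 6) (const b) ;;
  A.tryUpdate (const (1 - b)) (3 + 8 * reg 6) 1 (const b)

end DynFlowAlgorithm

theorem val_vx {B : ℕ} (ρ : Fin 8) (i : Fin B) : (vx ρ i : ℕ) = ρ + 8 * i := rfl

/-- The bounds under which a data structure fits into a region. -/
structure Layout.Room (L : Layout) (W N : ℕ) : Prop where
  W_le : W ≤ L.S
  S_ge : 3 + N * N ≤ L.S
  V_ge : L.S ≤ L.V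
  lt_V : N < L.V
  pos : 8 ≤ N

theorem entry_caps {B : ℕ} [NeZero B] (D : BlockData B) (mode : DynMode) (g : GraphClass)
    (k i : Fin B) {θ : ℕ} {U V : ℕ} (hU : (D.netAt mode g θ).U k i = U)
    (hV : (D.netAt mode g θ).V k i = V) :
    (D.netAt mode g θ).cap (vx 2 k) (vx 4 i) = U ∧ (D.netAt mode g θ).cap (vx 5 i) (vx 3 k) = V ∧
    (D.netAt mode g θ).cap (vx 6 k) (vx 4 i) = g.beta * U ∧
    (D.netAt mode g θ).cap (vx 2 k) (vx 7 i) = g.beta * U ∧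
    (D.netAt mode g θ).cap (vx 6 i) (vx 3 k) = g.beta * V ∧
    (D.netAt mode g θ).cap (vx 5 i) (vx 7 k) = g.beta * V := by
  have hβ : (D.netAt mode g θ).β = g.beta := rfl
  simp [GadgetNet.cap, GadgetNet.arcAt, hU, hV, hβ]

/-- Before the first phase an entry has its default value `1 - b`, so it has to be changed exactly
if the wanted value `x` is `b`. This is the flag that the program computes. -/
theorem flag_iff {b x : ℕ} (hb : b ≤ 1) (hx : x ≤ 1) :
    eqNat x b ≠ 0 ↔ 1 - b ≠ x := by
  unfold eqNat; split <;> omega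

theorem mul_flag_iff {b x β : ℕ} (hb : b ≤ 1) (hx : x ≤ 1) (hβ : β ≤ 1) :
    β * eqNat x b ≠ 0 ↔ β * (1 - b) ≠ β * x := by
  have : β = 0 ∨ β = 1 := by omega
  rcases this with rfl | rfl
  · simp
  · simpa using flag_iff hb hx

theorem mul_new_eq {b x β : ℕ} (hb : b ≤ 1) (hx : x ≤ 1) (hβ : β ≤ 1)
    (h : β * (1 - b) ≠ β * x) : b = β * x := by
  have : β = 0 ∨ β = 1 := by omega
  rcases this with rfl | rfl
  · simp at h
  · omega

theorem DynMode.bit_le_one (mode : DynMode) : mode.bit ≤ 1 := by cases mode <;> simp [bit]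

namespace DynFlowAlgorithm

variable {A : DynFlowAlgorithm} {mode : DynMode} {g : GraphClass} {W : ℕ} {B : ℕ} [NeZero B]
  {s t : Fin (B * 8)} {L : Layout} {st : St} {φ τ q : ℕ} {Q : St → ℕ → Prop}

/-- Two flags and six conditional updates, in the order of `entryPairs`. The four updates at copies
are guarded by the factor `β` and thus vanish for directed graphs. -/
theorem wp_entryStep (hq : q < L.cnt) (hb : st.reg 0 = L.base q) (hL : L.Room W (B * 8))
    {D : BlockData B} (hD : D.Bounded) {k i : Fin B} (h6 : st.reg 6 = k) (h12 : st.reg 12 = i)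
    (hu : rowTest.eval L st = D.u k i) (hv : colTest.eval L st = D.v k i)
    {F : Network (B * 8)} {l rest : List (FlowRequest (B * 8))}
    (hP : A.Pending g W s t F (syncReqs (D.netAt mode g (3 * k)).cap
      (D.netAt mode g (3 * k + 1)).cap (entryPairs k i) ++ l) rest (st.inst q) τ)
    (hQ : ∀ st' τ', St.Agree q st st' → st'.reg 12 = st.reg 12 →
      A.Pending g W s t F l rest (st'.inst q) τ' → Q st' (φ + 30 * τ')) :
    L.WP (A.entryStep mode.bit g.beta) 26 Q st (φ + 30 * τ) := by
  have hW := hL.W_le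
  have hS : 3 ≤ L.S := le_trans (by omega) hL.S_ge
  have hlt := hL.lt_V
  have hb1 := mode.bit_le_one
  have hβ := g.beta_le_one
  have hu1 := hD.u k i
  have hv1 := hD.v k i
  have hBV : 1 < L.V := by have := hL.pos; omega
  have h0 : phasesDone (3 * k) k = 0 := phasesDone_self k 0 (by omega)
  have h1 : phasesDone (3 * k + 1) k = 1 := phasesDone_self k 1 (by omega)
  obtain ⟨o1, o2, o3, o4, o5, o6⟩ := entry_caps D mode g k i (θ := 3 * k)
    (U := 1 - mode.bit) (V := 1 - mode.bit)
    (by simp [BlockData.netAt, h0]) (by simp [BlockData.netAt, h0])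
  obtain ⟨n1, n2, n3, n4, n5, n6⟩ := entry_caps D mode g k i (θ := 3 * k + 1)
    (U := D.u k i) (V := D.v k i) (by simp [BlockData.netAt, h1]) (by simp [BlockData.netAt, h1])
  have hmul : ∀ x, x ≤ 1 → g.beta * x < L.V := fun x hx =>
    lt_of_le_of_lt (Nat.mul_le_mul hβ hx) (by omega)
  simp only [syncReqs, entryPairs, List.flatMap_cons, List.flatMap_nil, List.append_assoc,
    List.nil_append] at hP
  have e13 : ∀ x : ℕ, eqNat x mode.bit < L.V :=
    fun x => lt_of_le_of_lt (eqNat_le_one _ _) hBV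
  refine Layout.WP.seq (T₁ := 1) (T₂ := 25) (Layout.WP.assign (by simpa using e13 _) ?_)
  refine Layout.WP.seq (T₁ := 1) (T₂ := 24) (Layout.WP.assign (by simpa using e13 _) ?_)
  -- The second flag is computed after register 13 was overwritten, which `colTest` does not read.
  have hv' : ∀ w, colTest.eval L (st.setReg 13 w) = colTest.eval L st := by
    intro w; simp [colTest, St.reg_setReg_of_ne]
  simp only [eval_eqb, eval_const, hv', hu, hv]
  set st₁ := (st.setReg 13 (eqNat (D.u k i) mode.bit)).setReg 14
    (eqNat (D.v k i) mode.bit) with hst₁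
  have r0 : st₁.reg 0 = L.base q := by simp [hst₁, St.reg_setReg_of_ne, hb]
  have r6 : st₁.reg 6 = k := by simp [hst₁, St.reg_setReg_of_ne, h6]
  have r12 : st₁.reg 12 = i := by simp [hst₁, St.reg_setReg_of_ne, h12]
  have r13 : st₁.reg 13 = eqNat (D.u k i) mode.bit := by
    simp [hst₁, St.reg_setReg_of_ne]
  have r14 : st₁.reg 14 = eqNat (D.v k i) mode.bit := by
    simp [hst₁]
  have ag : St.Agree q st st₁ := (St.Agree.refl.setReg (by decide) _).setReg (by decide) _
  have rq : st₁.inst q = st.inst q := by simp [hst₁]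
  rw [← rq] at hP
  clear_value st₁
  rw [← St.setInst_self st₁ q]
  refine Layout.WP.seq (T₁ := 4) (T₂ := 20) (wp_tryUpdate hq r0 hW hS hlt.le hP
    (by simpa [r13, o1, n1] using flag_iff hb1 hu1) (by simp [r6, val_vx])
    (by simp [r12, val_vx]) (fun h => ?_) fun μ₁ τ₁ hP₁ => ?_)
  · simp only [o1, n1, eval_const] at h ⊢; omega
  refine Layout.WP.seq (T₁ := 4) (T₂ := 16) (wp_tryUpdate hq r0 hW hS hlt.le hP₁
    (by simpa [r14, o2, n2] using flag_iff hb1 hv1) (by simp [r12, val_vx])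
    (by simp [r6, val_vx]) (fun h => ?_) fun μ₂ τ₂ hP₂ => ?_)
  · simp only [o2, n2, eval_const] at h ⊢; omega
  refine Layout.WP.seq (T₁ := 4) (T₂ := 12) (wp_tryUpdate hq r0 hW hS hlt.le hP₂
    (by simpa [r13, o3, n3] using mul_flag_iff hb1 hu1 hβ) (by simp [r6, val_vx])
    (by simp [r12, val_vx]) (fun h => ?_) fun μ₃ τ₃ hP₃ => ?_)
  · simp only [o3, n3, eval_const] at h ⊢
    exact ⟨mul_new_eq hb1 hu1 hβ h, hmul _ hu1⟩
  refine Layout.WP.seq (T₁ := 4) (T₂ := 8) (wp_tryUpdate hq r0 hW hS hlt.le hP₃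
    (by simpa [r13, o4, n4] using mul_flag_iff hb1 hu1 hβ) (by simp [r6, val_vx])
    (by simp [r12, val_vx]) (fun h => ?_) fun μ₄ τ₄ hP₄ => ?_)
  · simp only [o4, n4, eval_const] at h ⊢
    exact ⟨mul_new_eq hb1 hu1 hβ h, hmul _ hu1⟩
  refine Layout.WP.seq (T₁ := 4) (T₂ := 4) (wp_tryUpdate hq r0 hW hS hlt.le hP₄
    (by simpa [r14, o5, n5] using mul_flag_iff hb1 hv1 hβ) (by simp [r12, val_vx])
    (by simp [r6, val_vx]) (fun h => ?_) fun μ₅ τ₅ hP₅ => ?_)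
  · simp only [o5, n5, eval_const] at h ⊢
    exact ⟨mul_new_eq hb1 hv1 hβ h, hmul _ hv1⟩
  refine wp_tryUpdate hq r0 hW hS hlt.le hP₅
    (by simpa [r14, o6, n6] using mul_flag_iff hb1 hv1 hβ) (by simp [r12, val_vx])
    (by simp [r6, val_vx]) (fun h => ?_) fun μ₆ τ₆ hP₆ => ?_
  · simp only [o6, n6, eval_const] at h ⊢
    exact ⟨mul_new_eq hb1 hv1 hβ h, hmul _ hv1⟩
  exact hQ _ _ (ag.setInst _) (by simp [r12, h12]) (by simpa using hP₆)

end DynFlowAlgorithm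

theorem syncReqs_append {n : ℕ} (old new : Network n) (ps qs : List (Fin n × Fin n)) :
    syncReqs old new (ps ++ qs) = syncReqs old new ps ++ syncReqs old new qs := by
  simp [syncReqs]

theorem syncReqs_cons {n : ℕ} (old new : Network n) (p : Fin n × Fin n)
    (ps : List (Fin n × Fin n)) :
    syncReqs old new (p :: ps) = syncItem old new p ++ syncReqs old new ps := rfl

theorem gadget_caps {B : ℕ} [NeZero B] (D : BlockData B) (mode : DynMode) (g : GraphClass)
    (k : Fin B) {d : ℕ} (hd : d ≤ 3) :
    (D.netAt mode g (3 * k + d)).cap (vx 3 k) (vx 1 0) = (if 1 ≤ mode.stage d then 1 else 0) ∧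
    (D.netAt mode g (3 * k + d)).cap (vx 2 k) (vx 1 0) = (if 3 ≤ mode.stage d then 1 else 0) ∧
    (D.netAt mode g (3 * k + d)).cap (vx 0 0) (vx 3 k) = (if 3 ≤ mode.stage d then 1 else 0) ∧
    (D.netAt mode g (3 * k + d)).cap (vx 0 0) (vx 2 k) = (if 2 ≤ mode.stage d then 1 else 0) := by
  have h := phasesDone_self k d hd
  simp [GadgetNet.cap, GadgetNet.arcAt, BlockData.netAt, h]

namespace DynFlowAlgorithm

variable {A : DynFlowAlgorithm} {mode : DynMode} {g : GraphClass} {W : ℕ} {B : ℕ} [NeZero B]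
  {L : Layout} {st : St} {φ τ q : ℕ} {Q : St → ℕ → Prop}

/-- `hu` and `hv` say that what the program reads off the partial answer and the current vector are
the sets prescribed for this round. Nothing about later rounds is read, although `D` contains them.
-/
theorem wp_blockStep (hg : ∀ k, g = .weightedUndirected k → 1 ≤ k) (hq : q < L.cnt)
    (hb : st.reg 0 = L.base q) (hL : L.Room W (B * 8))
    {D : BlockData B} (hD : D.Bounded) {k : Fin B} (h2 : st.reg 2 = B) (h6 : st.reg 6 = k)
    (hu : ∀ i : Fin B, ltNat (st.reg 7 * st.reg 2 + i) L.n *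
      (1 - st.ans ((st.reg 7 * st.reg 2 + i) % L.n)) = D.u k i)
    (hv : ∀ i : Fin B, ltNat (st.reg 8 * st.reg 2 + i) L.n *
      st.vec ((st.reg 8 * st.reg 2 + i) % L.n) = D.v k i)
    {rest : List (FlowRequest (B * 8))}
    (hH : A.Handles g W (vx 0 0) (vx 1 0) (D.netAt mode g (3 * k)).cap (st.inst q)
      (D.roundReqs mode g k ++ rest) τ)
    (hQ : ∀ st' τ', St.Agree q st st' →
      A.Handles g W (vx 0 0) (vx 1 0) (D.netAt mode g (3 * k + 3)).cap (st'.inst q) rest τ' →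
      IsMaxFlowValue (D.netAt mode g (3 * k + 1)).cap (vx 0 0) (vx 1 0) (st'.reg 15 : ℝ) →
      IsMaxFlowValue (D.netAt mode g (3 * k + 2)).cap (vx 0 0) (vx 1 0) (st'.reg 16 : ℝ) →
      Q st' (φ + 30 * τ')) :
    L.WP (A.blockStep mode.bit g.beta) (B * 28 + 32) Q st (φ + 30 * τ) := by
  have hW := hL.W_le
  have hS : 3 ≤ L.S := le_trans (by omega) hL.S_ge
  have hlt := hL.lt_V
  have hBV : 1 < L.V := by have := hL.pos; omega
  have hb01 : mode.bit < L.V := lt_of_le_of_lt mode.bit_le_one hBV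
  have f1 := (syncReqs_first (mode := mode) hg hD k).1
  have f2 := (syncReqs_second (mode := mode) hg hD k).1
  have f3 := (syncReqs_third (mode := mode) hg hD k).1
  obtain ⟨a1, a2, a3, a4⟩ := gadget_caps D mode g k (d := 0) (by omega)
  obtain ⟨b1, b2, b3, b4⟩ := gadget_caps D mode g k (d := 1) (by omega)
  obtain ⟨c1, c2, c3, c4⟩ := gadget_caps D mode g k (d := 2) (by omega)
  obtain ⟨d1, d2, d3, d4⟩ := gadget_caps D mode g k (d := 3) (by omega)
  rw [Nat.add_zero] at a1 a2 a3 a4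
  simp only [BlockData.roundReqs, List.append_assoc, List.cons_append, firstPairs,
    syncReqs_append] at hH
  simp only [firstPairs, syncReqs_append] at f1
  refine Layout.WP.seq (T₁ := B * 28 + 2) (T₂ := 30) ?_
  -- The invariant: the pairs of the indices from `i` on are still pending, and the credits besides
  -- `φ` are 30 times the time that the simulated run has left.
  refine Layout.WP.forLoop (T := 26) (fun i st' φ' => St.Agree q st st' ∧ st'.reg 12 = i ∧
    ∃ τ', φ' = φ + 30 * τ' ∧ A.Pending g W (vx 0 0) (vx 1 0) (D.netAt mode g (3 * k + 1)).cap
      (syncReqs (D.netAt mode g (3 * k)).cap (D.netAt mode g (3 * k + 1)).cap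
        (((List.finRange B).drop i).flatMap (entryPairs k)) ++
      syncReqs (D.netAt mode g (3 * k)).cap (D.netAt mode g (3 * k + 1)).cap
        [(vx 3 k, vx 1 0), (vx 2 k, vx 1 0), (vx 0 0, vx 3 k)])
      (.query :: (syncReqs (D.netAt mode g (3 * k + 1)).cap (D.netAt mode g (3 * k + 2)).cap
        (secondPairs k) ++ (.query :: (syncReqs (D.netAt mode g (3 * k + 2)).cap
          (D.netAt mode g (3 * k + 3)).cap (thirdPairs k) ++ rest)))) (st'.inst q) τ')
    B (by omega) ?_ ?_ ?_ ?_ ?_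
  · rintro i - st' φ' ⟨ag, -, -⟩
    simpa using (ag.reg 2 (by decide)).trans h2
  · rintro i - st' φ' ⟨-, h12, -⟩
    exact h12
  · rintro i hi st' φ' ⟨ag, h12, τ', rfl, hP⟩
    rw [List.drop_eq_getElem_cons (by simpa using hi), List.flatMap_cons, List.getElem_finRange,
      syncReqs_append, List.append_assoc] at hP
    have e2 := ag.reg 2 (by decide)
    have e7 := ag.reg 7 (by decide)
    have e8 := ag.reg 8 (by decide)
    refine wp_entryStep hq ((ag.reg 0 (by decide)).trans hb) hL hD (k := k) (i := ⟨i, hi⟩)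
      ((ag.reg 6 (by decide)).trans h6) h12 ?_ ?_ hP ?_
    · simpa [rowTest, e2, e7, h12, ag.ans] using hu ⟨i, hi⟩
    · simpa [colTest, e2, e8, h12, ag.vec] using hv ⟨i, hi⟩
    · intro st'' τ'' ag' h12' hP'
      exact ⟨h12'.trans h12, (ag.trans ag').setReg (by decide) _, St.reg_setReg _ _ _, τ'', rfl,
        hP'⟩
  · exact ⟨St.Agree.refl.setReg (by decide) _, St.reg_setReg _ _ _, τ, rfl, _, f1, by
      simpa using hH⟩
  rintro st₁ φ₁ ⟨ag, -, τ₁, rfl, hP₁⟩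
  rw [List.drop_eq_nil_of_le (by simp)] at hP₁
  simp only [List.flatMap_nil, syncReqs_cons] at hP₁
  have r0 : st₁.reg 0 = L.base q := (ag.reg 0 (by decide)).trans hb
  have r6 : st₁.reg 6 = k := (ag.reg 6 (by decide)).trans h6
  rw [← St.setInst_self st₁ q]
  refine Layout.WP.seq (T₁ := 4) (T₂ := 26) (wp_tryUpdate hq r0 hW hS hlt.le hP₁ ?_
    (by simp [r6, val_vx]) (by simp [val_vx]) ?_ fun μ₂ τ₂ hP₂ => ?_)
  · rw [a1, b1]; cases mode <;> simp [DynMode.bit, DynMode.stage]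
  · rw [a1, b1]; intro h; rw [eval_const]
    cases mode <;> simp [DynMode.bit, DynMode.stage] at h ⊢; omega
  refine Layout.WP.seq (T₁ := 4) (T₂ := 22) (wp_tryUpdate hq r0 hW hS hlt.le hP₂ ?_
    (by simp [r6, val_vx]) (by simp [val_vx]) ?_ fun μ₃ τ₃ hP₃ => ?_)
  · rw [a2, b2]; cases mode <;> simp [DynMode.bit, DynMode.stage]
  · rw [a2, b2]; intro h; rw [eval_const]
    cases mode <;> simp [DynMode.bit, DynMode.stage] at h ⊢; omega
  refine Layout.WP.seq (T₁ := 4) (T₂ := 18) (wp_tryUpdate hq r0 hW hS hlt.le hP₃ ?_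
    (by simp [val_vx]) (by simp [r6, val_vx]) ?_ fun μ₄ τ₄ hP₄ => ?_)
  · rw [a3, b3]; cases mode <;> simp [DynMode.bit, DynMode.stage]
  · rw [a3, b3]; intro h; rw [eval_const]
    cases mode <;> simp [DynMode.bit, DynMode.stage] at h ⊢; omega
  refine Layout.WP.seq (T₁ := 1) (T₂ := 17) (wp_ask hq r0 hW hS (pending_nil hP₄)
    fun μ₅ τ₅ hm₅ hH₅ => ?_)
  -- After the query the network is known again, and `f2` tells where the updates of the second
  -- phase lead.
  have hP₅ : A.Pending g W (vx 0 0) (vx 1 0) _ _ _ μ₅ τ₅ := ⟨_, f2, hH₅⟩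
  simp only [secondPairs, syncReqs_cons] at hP₅
  set st₂ := (st₁.setReg 15 (μ₅ 0)) with hst₂
  have es : ∀ μ, (st₁.setInst q μ).setReg 15 (μ₅ 0) = st₂.setInst q μ := fun μ => rfl
  rw [es]
  have ag₂ : St.Agree q st st₂ := ag.setReg (by decide) _
  have r0' : st₂.reg 0 = L.base q := (ag₂.reg 0 (by decide)).trans hb
  have r6' : st₂.reg 6 = k := (ag₂.reg 6 (by decide)).trans h6
  refine Layout.WP.seq (T₁ := 4) (T₂ := 13) (wp_tryUpdate hq r0' hW hS hlt.le hP₅ ?_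
    (by simp [val_vx]) (by simp [r6', val_vx]) ?_ fun μ₆ τ₆ hP₆ => ?_)
  · rw [b4, c4]; cases mode <;> simp [DynMode.stage]
  · rw [b4, c4]; intro h; rw [eval_const]
    cases mode <;> simp [DynMode.bit, DynMode.stage]; omega; omega
  refine Layout.WP.seq (T₁ := 1) (T₂ := 12) (wp_ask hq r0' hW hS (pending_nil hP₆)
    fun μ₇ τ₇ hm₇ hH₇ => ?_)
  have hP₇ : A.Pending g W (vx 0 0) (vx 1 0) _ _ _ μ₇ τ₇ := ⟨_, f3, hH₇⟩
  simp only [thirdPairs, syncReqs_cons] at hP₇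
  set st₃ := (st₂.setReg 16 (μ₇ 0)) with hst₃
  have es' : ∀ μ, (st₂.setInst q μ).setReg 16 (μ₇ 0) = st₃.setInst q μ := fun μ => rfl
  rw [es']
  have ag₃ : St.Agree q st st₃ := ag₂.setReg (by decide) _
  have r0'' : st₃.reg 0 = L.base q := (ag₃.reg 0 (by decide)).trans hb
  have r6'' : st₃.reg 6 = k := (ag₃.reg 6 (by decide)).trans h6
  refine Layout.WP.seq (T₁ := 4) (T₂ := 8) (wp_tryUpdate hq r0'' hW hS hlt.le hP₇ ?_
    (by simp [r6'', val_vx]) (by simp [val_vx]) ?_ fun μ₈ τ₈ hP₈ => ?_)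
  · rw [c2, d2]; cases mode <;> simp [DynMode.bit, DynMode.stage]
  · rw [c2, d2]; intro h; rw [eval_const]
    cases mode <;> simp [DynMode.bit, DynMode.stage] at h ⊢; omega
  refine Layout.WP.seq (T₁ := 4) (T₂ := 4) (wp_tryUpdate hq r0'' hW hS hlt.le hP₈ ?_
    (by simp [val_vx]) (by simp [r6'', val_vx]) ?_ fun μ₉ τ₉ hP₉ => ?_)
  · rw [c3, d3]; cases mode <;> simp [DynMode.bit, DynMode.stage]
  · rw [c3, d3]; intro h; rw [eval_const]
    cases mode <;> simp [DynMode.bit, DynMode.stage] at h ⊢; omega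
  refine wp_tryUpdate hq r0'' hW hS hlt.le hP₉ ?_
    (by simp [r6'', val_vx]) (by simp [val_vx]) ?_ fun μ' τ' hP' => ?_
  · rw [c1, d1]; cases mode <;> simp [DynMode.bit, DynMode.stage]
  · rw [c1, d1]; intro h; rw [eval_const]
    cases mode <;> simp [DynMode.bit, DynMode.stage] at h ⊢; omega
  refine hQ _ _ (ag₃.setInst _) ?_ ?_ ?_
  · simpa using pending_nil hP'
  · simpa [hst₃, hst₂, St.reg_setReg_of_ne] using hm₅
  · simpa [hst₃] using hm₇

end DynFlowAlgorithm

/-! ### Rows with a witness, and the scan of a block -/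

/-- Whether a row has a witness in one of the first `z` blocks. -/
noncomputable def rowHit (n : ℕ) (mat vec : ℕ → ℕ) (B X z I : ℕ) : ℕ :=
  open Classical in
  if ∃ J < n, I / B * X + J / B < z ∧ mat (I * n + J) ≠ 0 ∧ vec J ≠ 0 then 1 else 0

theorem rowHit_le_one (n : ℕ) (mat vec : ℕ → ℕ) (B X z I : ℕ) :
    rowHit n mat vec B X z I ≤ 1 := by
  unfold rowHit; split <;> omega

theorem rowHit_zero (n : ℕ) (mat vec : ℕ → ℕ) (B X I : ℕ) : rowHit n mat vec B X 0 I = 0 := by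
  simp [rowHit]

/-- The number `x * X + y` determines the block, because column block numbers are below `X`. So
exactly one block is added. -/
theorem rowHit_succ {n : ℕ} {mat vec : ℕ → ℕ} {B X x y I : ℕ} (hy : y < X)
    (hX : ∀ J < n, J / B < X) :
    rowHit n mat vec B X (x * X + y + 1) I = 1 ↔ rowHit n mat vec B X (x * X + y) I = 1 ∨
      (I / B = x ∧ ∃ J < n, J / B = y ∧ mat (I * n + J) ≠ 0 ∧ vec J ≠ 0) := by
  have key : ∀ J < n, I / B * X + J / B = x * X + y ↔ (I / B = x ∧ J / B = y) := by
    intro J hJ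
    have h1 := hX J hJ
    constructor
    · intro h
      have h2 : (I / B * X + J / B) / X = (x * X + y) / X := by rw [h]
      rw [mul_comm, mul_comm x, Nat.mul_add_div (by omega), Nat.mul_add_div (by omega),
        Nat.div_eq_of_lt h1, Nat.div_eq_of_lt hy] at h2
      have h3 : I / B = x := by omega
      rw [h3] at h
      exact ⟨h3, by omega⟩
    · rintro ⟨h2, h3⟩
      rw [h2, h3]
  unfold rowHit
  simp only [ite_eq_left_iff, zero_ne_one, imp_false, not_not]
  constructor
  · rintro ⟨J, hJ, h1, h2⟩
    rcases Nat.lt_succ_iff_lt_or_eq.1 h1 with h3 | h3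
    · exact Or.inl ⟨J, hJ, h3, h2⟩
    · obtain ⟨h4, h5⟩ := (key J hJ).1 h3
      exact Or.inr ⟨h4, J, hJ, h5, h2⟩
  · rintro (⟨J, hJ, h1, h2⟩ | ⟨h1, J, hJ, h2, h3⟩)
    · exact ⟨J, hJ, by omega, h2⟩
    · exact ⟨J, hJ, by have := (key J hJ).2 ⟨h1, h2⟩; omega, h3⟩

theorem eq_of_le_one_of_iff {a b : ℕ} (ha : a ≤ 1) (hb : b ≤ 1) (h : a = 1 ↔ b = 1) : a = b := by
  by_cases h1 : a = 1
  · rw [h1, h.1 h1]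
  · have : b ≠ 1 := fun h2 => h1 (h.2 h2)
    omega

/-- The number of rows without a witness so far. -/
def St.unhit (st : St) (n : ℕ) : ℕ := ((Finset.range n).filter fun I => st.ans I = 0).card

/-- Mark the row of an entry of the block if the entry is a witness. -/
def markEntry : RamProg :=
  SrcExpr.branch
    (((reg 7 * reg 2 + reg 17 / reg 2).ltb size) * ((reg 8 * reg 2 + reg 17 % reg 2).ltb size) *
      mat ((reg 7 * reg 2 + reg 17 / reg 2) * size + (reg 8 * reg 2 + reg 17 % reg 2)) *
      vec (reg 8 * reg 2 + reg 17 % reg 2))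
    (assignAns (reg 7 * reg 2 + reg 17 / reg 2) 1) .skip

/-- Mark all rows of the block that have a witness in the block. -/
def markBlock : RamProg := forLoop 17 (reg 2 * reg 2) markEntry

/-- The loop runs over codes of the entries of the block. The conclusion is phrased by quotients
modulo `B` instead, as `rowHit_succ` needs it; at the end the two descriptions are matched by
division with remainder. -/
theorem wp_markBlock {L : Layout} {st : St} {φ : ℕ} {Q : St → ℕ → Prop} {B x y : ℕ}
    (hBV : B * B + 1 < L.V) (hB : 0 < B)
    (h2 : st.reg 2 = B) (h7 : st.reg 7 = x) (h8 : st.reg 8 = y)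
    (hQ : ∀ st', st'.vec = st.vec → st'.inst = st.inst →
      (∀ r : Fin 32, r < 12 → st'.reg r = st.reg r) →
      (∀ I < L.n, (I / B = x ∧ ∃ J < L.n, J / B = y ∧ L.mat (I * L.n + J) ≠ 0 ∧ st.vec J ≠ 0) →
        st'.ans I = 1) →
      (∀ I < L.n, ¬ (I / B = x ∧ ∃ J < L.n, J / B = y ∧ L.mat (I * L.n + J) ≠ 0 ∧
        st.vec J ≠ 0) → st'.ans I = st.ans I) → Q st' φ) :
    L.WP markBlock (B * B * 4 + 2) Q st φ := by
  classical
  -- The code `e` stands for the entry with local row `e / B` and local column `e % B`.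
  let hit : ℕ → ℕ → Prop := fun e I => I = x * B + e / B ∧ I < L.n ∧ y * B + e % B < L.n ∧
    L.mat (I * L.n + (y * B + e % B)) ≠ 0 ∧ st.vec (y * B + e % B) ≠ 0
  refine Layout.WP.forLoop (T := 2) (fun i st' φ' => φ' = φ ∧ st'.vec = st.vec ∧
    st'.inst = st.inst ∧ (∀ r : Fin 32, r < 12 → st'.reg r = st.reg r) ∧ st'.reg 17 = i ∧
    ∀ I < L.n, st'.ans I = if ∃ e < i, hit e I then 1 else st.ans I) (B * B) (by omega)
    ?_ ?_ ?_ ?_ ?_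
  · rintro i - st' φ' ⟨-, -, -, hr, -⟩
    simp [hr 2 (by decide), h2]
  · rintro i - st' φ' ⟨-, -, -, -, hr, -⟩
    exact hr
  · rintro i hi st' φ' ⟨rfl, hvec, hinst, hr, h17, hans⟩
    have e2 := (hr 2 (by decide)).trans h2
    have e7 := (hr 7 (by decide)).trans h7
    have e8 := (hr 8 (by decide)).trans h8
    have hsucc : ∀ I, (∃ e < i + 1, hit e I) ↔ (∃ e < i, hit e I) ∨ hit i I := by
      intro I
      constructor
      · rintro ⟨e, he, h⟩
        rcases Nat.lt_succ_iff_lt_or_eq.1 he with h1 | rfl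
        · exact Or.inl ⟨e, h1, h⟩
        · exact Or.inr h
      · rintro (⟨e, he, h⟩ | h)
        · exact ⟨e, by omega, h⟩
        · exact ⟨i, by omega, h⟩
    -- Source expressions reduce indices modulo the array lengths. The two range tests make this
    -- harmless: a wrapped index is multiplied by `0`.
    have hcond : ∀ a b : ℕ, (ltNat a L.n * ltNat b L.n * L.mat ((a * L.n + b) % (L.n * L.n)) *
        st.vec (b % L.n) ≠ 0) ↔ a < L.n ∧ b < L.n ∧ L.mat (a * L.n + b) ≠ 0 ∧ st.vec b ≠ 0 := by
      intro a b
      simp only [mul_ne_zero_iff, ltNat_ne_zero]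
      constructor
      · rintro ⟨⟨⟨ha, hb⟩, hm⟩, hv⟩
        rw [Nat.mod_eq_of_lt] at hm
        · rw [Nat.mod_eq_of_lt hb] at hv
          exact ⟨ha, hb, hm, hv⟩
        · calc a * L.n + b < a * L.n + L.n := by omega
            _ = (a + 1) * L.n := by ring
            _ ≤ L.n * L.n := Nat.mul_le_mul_right _ ha
      · rintro ⟨ha, hb, hm, hv⟩
        rw [Nat.mod_eq_of_lt, Nat.mod_eq_of_lt hb]
        · exact ⟨⟨⟨ha, hb⟩, hm⟩, hv⟩
        · calc a * L.n + b < a * L.n + L.n := by omega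
            _ = (a + 1) * L.n := by ring
            _ ≤ L.n * L.n := Nat.mul_le_mul_right _ ha
    refine Layout.WP.branch (T := 1) (fun h => ?_) (fun h => ?_)
    · simp only [eval_mul, eval_ltb, eval_add, eval_div, eval_mod, eval_size, eval_reg, eval_mat,
        eval_vec, e2, e7, e8, h17, hvec] at h
      obtain ⟨ha, hb, hm, hv⟩ := (hcond _ _).1 h
      refine Layout.WP.assignAns (by simp; omega) ⟨h17, rfl, hvec, hinst, ?_, by simp, ?_⟩
      · intro r hr'
        rw [St.reg_setReg_of_ne]
        · exact hr r hr'
        · rintro rfl; exact absurd hr' (by decide)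
      · intro I hI
        simp only [eval_add, eval_mul, eval_reg, eval_div, e2, e7, h17, eval_one,
          Nat.mod_eq_of_lt ha, St.ans_setReg, St.ans_setAns]
        by_cases hIe : I = x * B + i / B
        · subst hIe
          rw [Function.update_self, if_pos]
          exact (hsucc _).2 (Or.inr ⟨rfl, hI, hb, hm, hv⟩)
        · rw [Function.update_of_ne hIe, hans I hI]
          refine if_congr ?_ rfl rfl
          rw [hsucc]
          exact (or_iff_left fun h => hIe h.1).symm
    · simp only [eval_mul, eval_ltb, eval_add, eval_div, eval_mod, eval_size, eval_reg, eval_mat,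
        eval_vec, e2, e7, e8, h17, hvec] at h
      refine Layout.WP.skip ⟨h17, rfl, hvec, hinst, ?_, by simp, ?_⟩
      · intro r hr'
        rw [St.reg_setReg_of_ne]
        · exact hr r hr'
        · rintro rfl; exact absurd hr' (by decide)
      · intro I hI
        rw [St.ans_setReg, hans I hI]
        refine if_congr ?_ rfl rfl
        rw [hsucc]
        refine (or_iff_left ?_).symm
        rintro ⟨rfl, h1, h3, h4, h5⟩
        exact (hcond _ _).2 ⟨h1, h3, h4, h5⟩ h
  · refine ⟨rfl, rfl, rfl, fun r hr' => ?_, by simp, by simp⟩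
    rw [St.reg_setReg_of_ne]
    rintro rfl; exact absurd hr' (by decide)
  · rintro st' φ' ⟨rfl, hvec, hinst, hr, -, hans⟩
    have hiff : ∀ I < L.n, (∃ e < B * B, hit e I) ↔
        (I / B = x ∧ ∃ J < L.n, J / B = y ∧ L.mat (I * L.n + J) ≠ 0 ∧ st.vec J ≠ 0) := by
      intro I hI
      constructor
      · rintro ⟨e, he, h1, -, h3, h4, h5⟩
        have h6 : e / B < B := (Nat.div_lt_iff_lt_mul hB).2 he
        have h7 : e % B < B := Nat.mod_lt _ hB
        refine ⟨?_, _, h3, ?_, h4, h5⟩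
        · rw [h1, mul_comm, Nat.mul_add_div hB, Nat.div_eq_of_lt h6, Nat.add_zero]
        · rw [mul_comm, Nat.mul_add_div hB, Nat.div_eq_of_lt h7, Nat.add_zero]
      · rintro ⟨h1, J, hJ, h3, h4, h5⟩
        have hmI : I % B < B := Nat.mod_lt _ hB
        have hmJ : J % B < B := Nat.mod_lt _ hB
        have eI := Nat.div_add_mod I B
        have eJ := Nat.div_add_mod J B
        have hd : (B * (I % B) + J % B) / B = I % B := by
          rw [Nat.mul_add_div hB, Nat.div_eq_of_lt hmJ, Nat.add_zero]
        have hm : (B * (I % B) + J % B) % B = J % B := by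
          rw [Nat.mul_add_mod, Nat.mod_eq_of_lt hmJ]
        have hyJ : y * B + J % B = J := by rw [← h3, mul_comm]; exact eJ
        refine ⟨B * (I % B) + J % B, ?_, ?_, hI, ?_, ?_, ?_⟩
        · calc B * (I % B) + J % B < B * (I % B) + B := by omega
            _ = B * (I % B + 1) := by ring
            _ ≤ B * B := Nat.mul_le_mul_left _ hmI
        · rw [hd, ← h1, mul_comm]; exact eI.symm
        · rw [hm, hyJ]; exact hJ
        · rw [hm, hyJ]; exact h4
        · rw [hm, hyJ]; exact h5
    refine hQ st' hvec hinst hr (fun I hI h => ?_) (fun I hI h => ?_)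
    · rw [hans I hI, if_pos ((hiff I hI).2 h)]
    · rw [hans I hI, if_neg fun h' => h ((hiff I hI).1 h')]

/-- The data of the block `(x, y)` in the window `w`. -/
noncomputable def blockData (n : ℕ) (mat : ℕ → ℕ) (vecs : ℕ → ℕ → ℕ) (B X w x y : ℕ) :
    BlockData B where
  M i j := ltNat (x * B + i) n * ltNat (y * B + j) n * mat ((x * B + i) * n + (y * B + j))
  u k i := ltNat (x * B + i) n *
    (1 - rowHit n mat (vecs (w * B + k)) B X (x * X + y) (x * B + i))
  v k j := ltNat (y * B + j) n * vecs (w * B + k) (y * B + j)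

theorem blockData_bounded {n : ℕ} {mat : ℕ → ℕ} {vecs : ℕ → ℕ → ℕ} (hmat : ∀ a, mat a ≤ 1)
    (hvecs : ∀ r j, vecs r j ≤ 1) (B X w x y : ℕ) :
    (blockData n mat vecs B X w x y).Bounded where
  M i j := Nat.mul_le_mul (Nat.mul_le_mul (ltNat_le_one _ _) (ltNat_le_one _ _)) (hmat _)
  u k i := Nat.mul_le_mul (ltNat_le_one _ _) (by omega : _ ≤ 1)
  v k j := Nat.mul_le_mul (ltNat_le_one _ _) (hvecs _ _)

/-- There is a witness for the block exactly if a row that had no witness gets one. -/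
theorem blockData_witness {n : ℕ} {mat : ℕ → ℕ} {vecs : ℕ → ℕ → ℕ} (hmat : ∀ a, mat a ≤ 1)
    (hvecs : ∀ r j, vecs r j ≤ 1) {B X w x y : ℕ} (k : Fin B) :
    (∃ a b, (blockData n mat vecs B X w x y).u k a = 1 ∧
      (blockData n mat vecs B X w x y).M a b = 1 ∧ (blockData n mat vecs B X w x y).v k b = 1) ↔
    ∃ I < n, rowHit n mat (vecs (w * B + k)) B X (x * X + y) I = 0 ∧
      (I / B = x ∧ ∃ J < n, J / B = y ∧ mat (I * n + J) ≠ 0 ∧ vecs (w * B + k) J ≠ 0) := by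
  have hB : 0 < B := k.pos
  have hdiv : ∀ (a : ℕ) (b : Fin B), (a * B + b) / B = a := by
    intro a b
    rw [mul_comm, Nat.mul_add_div hB, Nat.div_eq_of_lt b.2, Nat.add_zero]
  have hD := blockData_bounded hmat hvecs (n := n) B X w x y
  constructor
  · rintro ⟨a, b, hu, hM, hv⟩
    have hu' : (blockData n mat vecs B X w x y).u k a ≠ 0 := by omega
    have hM' : (blockData n mat vecs B X w x y).M a b ≠ 0 := by omega
    have hv' : (blockData n mat vecs B X w x y).v k b ≠ 0 := by omega
    simp only [blockData, mul_ne_zero_iff, ltNat_ne_zero] at hu' hM' hv'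
    exact ⟨x * B + a, hu'.1, by omega, hdiv _ _, y * B + b, hv'.1, hdiv _ _, hM'.2, hv'.2⟩
  · rintro ⟨I, hI, h0, hIx, J, hJ, hJy, hm, hv⟩
    have eI : x * B + I % B = I := by rw [← hIx, mul_comm]; exact Nat.div_add_mod I B
    have eJ : y * B + J % B = J := by rw [← hJy, mul_comm]; exact Nat.div_add_mod J B
    refine ⟨⟨I % B, Nat.mod_lt _ hB⟩, ⟨J % B, Nat.mod_lt _ hB⟩, ?_, ?_, ?_⟩
    · simp [blockData, eI, h0, ltNat_of_lt hI]
    · have := hmat (I * n + J)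
      simp only [blockData, eI, eJ, ltNat_of_lt hI, ltNat_of_lt hJ]
      omega
    · have := hvecs (w * B + k) J
      simp only [blockData, eJ, ltNat_of_lt hJ]
      omega

/-! ### One block in one round, with amortized scans -/

/-- The comparison of the two answers of a round. -/
def DynMode.compare : DynMode → SrcExpr
  | .incremental => (reg 15).ltb (reg 16)
  | .decremental => (reg 16).ltb (reg 15)

namespace DynFlowAlgorithm

/-- The work for one block in one round. -/
def blockRound (A : DynFlowAlgorithm) (mode : DynMode) (β : ℕ) : RamProg :=
  A.blockStep mode.bit β ;; mode.compare.branch markBlock .skip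

variable {A : DynFlowAlgorithm} {mode : DynMode} {g : GraphClass} {W : ℕ} {B : ℕ} [NeZero B]
  {L : Layout} {st : St} {φ τ q : ℕ} {Q : St → ℕ → Prop}

/-- Every row without a witness holds the price of one scan in credits. The block is scanned only if
the flow values reveal a witness for such a row; the scan marks this row, and the credits that are
set free pay for the scan. In the other case no row changes its status, so the partial answer is
already correct for the next block. -/
theorem wp_blockRound (hg : ∀ k, g = .weightedUndirected k → 1 ≤ k) (hq : q < L.cnt)
    (hb : st.reg 0 = L.base q) (hL : L.Room W (B * 8)) (hBV : B * B + 1 < L.V)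
    {vecs : ℕ → ℕ → ℕ} (hmat : ∀ a, L.mat a ≤ 1) (hvecs : ∀ r j, vecs r j ≤ 1)
    {X w x y : ℕ} (hy : y < X) (hX : ∀ J < L.n, J / B < X) {k : Fin B}
    (h2 : st.reg 2 = B) (h6 : st.reg 6 = k) (h7 : st.reg 7 = x) (h8 : st.reg 8 = y)
    (hvec : ∀ j < L.n, st.vec j = vecs (w * B + k) j)
    (hans : ∀ I < L.n, st.ans I = rowHit L.n L.mat (vecs (w * B + k)) B X (x * X + y) I)
    {rest : List (FlowRequest (B * 8))}
    (hH : A.Handles g W (vx 0 0) (vx 1 0)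
      ((blockData L.n L.mat vecs B X w x y).netAt mode g (3 * k)).cap (st.inst q)
      ((blockData L.n L.mat vecs B X w x y).roundReqs mode g k ++ rest) τ)
    (hQ : ∀ st' τ', st'.vec = st.vec → (∀ r : Fin 32, r < 12 → st'.reg r = st.reg r) →
      (∀ q', q' ≠ q → st'.inst q' = st.inst q') →
      A.Handles g W (vx 0 0) (vx 1 0)
        ((blockData L.n L.mat vecs B X w x y).netAt mode g (3 * k + 3)).cap (st'.inst q) rest τ' →
      (∀ I < L.n, st'.ans I = rowHit L.n L.mat (vecs (w * B + k)) B X (x * X + y + 1) I) →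
      ∃ ψ ≤ φ + 3 * L.K * (B * B * 4 + 2) * st'.unhit L.n + 30 * τ', Q st' ψ) :
    L.WP (A.blockRound mode g.beta) (B * 28 + 34) Q st
      (φ + 3 * L.K * (B * B * 4 + 2) * st.unhit L.n + 30 * τ) := by
  set D := blockData L.n L.mat vecs B X w x y with hDdef
  have hD : D.Bounded := blockData_bounded hmat hvecs B X w x y
  set C := B * B * 4 + 2 with hC
  refine Layout.WP.mono_time (T := (B * 28 + 32) + 2) (Layout.WP.seq ?_) (by omega)
  refine wp_blockStep hg hq hb hL hD h2 h6 ?_ ?_ hH ?_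
  · intro i
    rw [h7, h2]
    by_cases h : x * B + i < L.n
    · rw [Nat.mod_eq_of_lt h, hans _ h]; rfl
    · simp [hDdef, blockData, ltNat_of_not_lt h]
  · intro i
    rw [h8, h2]
    by_cases h : y * B + i < L.n
    · rw [Nat.mod_eq_of_lt h, hvec _ h]; rfl
    · simp [hDdef, blockData, ltNat_of_not_lt h]
  intro st₁ τ₁ ag hH₁ hx₁ hx₂
  have hcmp : mode.compare.eval L st₁ ≠ 0 ↔ ∃ a b, D.u k a = 1 ∧ D.M a b = 1 ∧ D.v k b = 1 := by
    rw [← query_answers hD k hx₁ hx₂]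
    cases mode <;> simp only [DynMode.compare, eval_ltb, eval_reg, ltNat_ne_zero, Nat.cast_lt]
  rw [hDdef, blockData_witness hmat hvecs k] at hcmp
  have hans₁ : ∀ I < L.n,
      st₁.ans I = rowHit L.n L.mat (vecs (w * B + k)) B X (x * X + y) I := by
    rw [ag.ans]; exact hans
  have hvec₁ : ∀ j < L.n, st₁.vec j = vecs (w * B + k) j := by rw [ag.vec]; exact hvec
  have hun : st₁.unhit L.n = st.unhit L.n := by simp only [St.unhit, ag.ans]
  have hle := rowHit_le_one L.n L.mat (vecs (w * B + k)) B X
  have hit_iff : ∀ I < L.n, (I / B = x ∧ ∃ J < L.n, J / B = y ∧ L.mat (I * L.n + J) ≠ 0 ∧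
      st₁.vec J ≠ 0) ↔ (I / B = x ∧ ∃ J < L.n, J / B = y ∧ L.mat (I * L.n + J) ≠ 0 ∧
      vecs (w * B + k) J ≠ 0) := by
    intro I hI
    refine and_congr_right fun _ => exists_congr fun J => and_congr_right fun hJ => ?_
    rw [hvec₁ J hJ]
  refine Layout.WP.branch (T := 1) (fun h => ?_) (fun h => ?_)
  · obtain ⟨I₀, hI₀, h0, hit₀⟩ := hcmp.1 h
    have hpos : 0 < st.unhit L.n := by
      rw [← hun]
      exact Finset.card_pos.2 ⟨I₀, by simp [hI₀, hans₁ I₀ hI₀, h0]⟩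
    -- The share of one unmarked row is split off to pay for the scan.
    have e1 : φ + 3 * L.K * C * st.unhit L.n + 30 * τ₁ =
        (φ + 3 * L.K * C * (st.unhit L.n - 1) + 30 * τ₁) + 3 * L.K * C := by
      have : st.unhit L.n = (st.unhit L.n - 1) + 1 := by omega
      rw [this, Nat.mul_add, Nat.add_sub_cancel]; ring
    rw [e1]
    refine Layout.WP.use_credits (Layout.WP.mono_time (T := C) ?_ (by omega))
    refine Layout.WP.mono (T := C) (Q := fun st' φ' =>
      φ' = φ + 3 * L.K * C * (st.unhit L.n - 1) + 30 * τ₁ ∧ ∃ ψ ≤ φ', Q st' ψ) ?_ le_rfl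
      (fun st' φ' h => h.2)
    refine wp_markBlock hBV (NeZero.pos B) ((ag.reg 2 (by decide)).trans h2)
      ((ag.reg 7 (by decide)).trans h7) ((ag.reg 8 (by decide)).trans h8) ?_
    intro st₂ hvec₂ hinst₂ hreg₂ hyes hno
    have hans₂ : ∀ I < L.n,
        st₂.ans I = rowHit L.n L.mat (vecs (w * B + k)) B X (x * X + y + 1) I := by
      intro I hI
      by_cases hh : (I / B = x ∧ ∃ J < L.n, J / B = y ∧ L.mat (I * L.n + J) ≠ 0 ∧ st₁.vec J ≠ 0)
      · rw [hyes I hI hh]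
        exact ((rowHit_succ hy hX).2 (Or.inr ((hit_iff I hI).1 hh))).symm
      · rw [hno I hI hh, hans₁ I hI]
        refine eq_of_le_one_of_iff (hle _ _) (hle _ _) ?_
        rw [rowHit_succ hy hX]
        exact (or_iff_left fun h => hh ((hit_iff I hI).2 h)).symm
    have hlt : st₂.unhit L.n < st.unhit L.n := by
      rw [← hun]
      refine Finset.card_lt_card (Finset.ssubset_iff_of_subset ?_ |>.2 ⟨I₀, ?_, ?_⟩)
      · intro I hI
        simp only [Finset.mem_filter, Finset.mem_range] at hI ⊢
        refine ⟨hI.1, ?_⟩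
        have h3 := hI.2
        rw [hans₂ I hI.1] at h3
        rw [hans₁ I hI.1]
        have h4 := hle (x * X + y) I
        by_contra h5
        have h6 : rowHit L.n L.mat (vecs (w * B + k)) B X (x * X + y) I = 1 := by omega
        rw [(rowHit_succ hy hX).2 (Or.inl h6)] at h3
        omega
      · simp [hI₀, hans₁ I₀ hI₀, h0]
      · simp [hI₀, hyes I₀ hI₀ ((hit_iff I₀ hI₀).2 hit₀)]
    refine ⟨rfl, ?_⟩
    obtain ⟨ψ, hψ, hq'⟩ := hQ st₂ τ₁ (hvec₂.trans ag.vec)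
      (fun r hr => (hreg₂ r hr).trans (ag.reg r hr))
      (fun q' hq' => by rw [hinst₂]; exact ag.inst q' hq') (by rw [hinst₂]; exact hH₁) hans₂
    refine ⟨ψ, hψ.trans ?_, hq'⟩
    have := Nat.mul_le_mul_left (3 * L.K * C) (show st₂.unhit L.n ≤ st.unhit L.n - 1 by omega)
    omega
  · have hno : ¬ _ := fun h' => (hcmp.2 h') h
    have hans₂ : ∀ I < L.n,
        st₁.ans I = rowHit L.n L.mat (vecs (w * B + k)) B X (x * X + y + 1) I := by
      intro I hI
      rw [hans₁ I hI]
      refine eq_of_le_one_of_iff (hle _ _) (hle _ _) ?_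
      rw [rowHit_succ hy hX]
      refine ⟨Or.inl, ?_⟩
      rintro (h1 | h1)
      · exact h1
      · by_contra h2
        refine hno ⟨I, hI, ?_, h1⟩
        have := hle (x * X + y) I
        omega
    refine Layout.WP.mono (T := 1) (Q := fun st' φ' => ∃ ψ ≤ φ', Q st' ψ)
      (Layout.WP.skip ?_) le_rfl (fun st' φ' h => h)
    have := hQ st₁ τ₁ ag.vec ag.reg ag.inst hH₁ hans₂
    rwa [hun] at this

end DynFlowAlgorithm

/-! ### The capacities as source expressions -/

/-- The test whether two vertices have given roles. -/
def rolesAre (a b : SrcExpr) (ρ σ : ℕ) : SrcExpr :=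
  ((a % 8) * 8 + b % 8).eqb (const (ρ * 8 + σ))

/-- The oriented capacity from `a` to `b` when all gadgets are absent (`f = 0`) or complete
(`f = 1`) and `m` is the entry of the matrix. -/
def arcExpr (β f : ℕ) (m a b : SrcExpr) : SrcExpr :=
  const f * ((a / 8).eqb 0 * (rolesAre a b 0 2 + rolesAre a b 0 3) +
    (b / 8).eqb 0 * (rolesAre a b 2 1 + rolesAre a b 3 1) +
    (rolesAre a b 2 4 + rolesAre a b 5 3) +
    const β * (rolesAre a b 6 4 + rolesAre a b 6 3 + rolesAre a b 2 7 + rolesAre a b 5 7)) +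
  m * (rolesAre a b 4 5 + const β * (rolesAre a b 6 5 + rolesAre a b 4 7)) +
  const β * (reg 2 * 8) *
    ((a / 8).eqb 0 * rolesAre a b 0 6 + (b / 8).eqb 0 * rolesAre a b 7 1)

theorem eval_rolesAre (L : Layout) (st : St) {B : ℕ} {a b : SrcExpr} {ρ σ : Fin 8} {i j : Fin B}
    (ha : a.eval L st = vx ρ i) (hb : b.eval L st = vx σ j) (ρ' σ' : ℕ) :
    (rolesAre a b ρ' σ').eval L st = eqNat ((ρ : ℕ) * 8 + σ) (ρ' * 8 + σ') := by
  have h1 : ((ρ : ℕ) + 8 * i) % 8 = ρ := by omega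
  have h2 : ((σ : ℕ) + 8 * j) % 8 = σ := by omega
  simp [rolesAre, ha, hb, val_vx, h1, h2]

/-- The numbers are the codes `8 * ρ + σ` of the listed pairs of roles, in the same order. -/
theorem roles_cases (ρ σ : Fin 8) :
    ((ρ, σ) ∈ ([(0, 2), (0, 3), (2, 1), (3, 1), (2, 4), (4, 5), (5, 3), (0, 6), (7, 1), (6, 4),
      (6, 5), (6, 3), (2, 7), (4, 7), (5, 7)] : List (Fin 8 × Fin 8))) ∨
    ∀ c ∈ ([2, 3, 17, 25, 20, 37, 43, 6, 57, 52, 53, 51, 23, 39, 47] : List ℕ),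
      ¬ ((ρ : ℕ) * 8 + σ = c) := by
  revert ρ σ; decide

/-- Only networks whose gadgets are all empty or all complete have to be computed from scratch: the
edges outside the diagonal that the start graph inherits from `hubNet`, and the network at time `0`.
Hence one parameter `f` replaces `U`, `V` and the stages. -/
theorem eval_arcExpr {B : ℕ} [NeZero B] {G : GadgetNet B} {f : ℕ} (hU : ∀ k i, G.U k i = f)
    (hV : ∀ k i, G.V k i = f) (hs : ∀ k, G.stage k = 3 * f) (hf : f ≤ 1)
    {L : Layout} {st : St} (h2 : st.reg 2 = B) {m a b : SrcExpr} {ρ σ : Fin 8} {i j : Fin B}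
    (hm : m.eval L st = G.M i j) (ha : a.eval L st = vx ρ i) (hb : b.eval L st = vx σ j) :
    (arcExpr G.β f m a b).eval L st = G.arc (vx ρ i) (vx σ j) := by
  have hi : ((ρ : ℕ) + 8 * i) / 8 = i := by omega
  have hj : ((σ : ℕ) + 8 * j) / 8 = j := by omega
  have ei : eqNat (i : ℕ) 0 = if i = 0 then 1 else 0 := by
    unfold eqNat; simp only [Fin.ext_iff, Fin.val_zero]
  have ej : eqNat (j : ℕ) 0 = if j = 0 then 1 else 0 := by
    unfold eqNat; simp only [Fin.ext_iff, Fin.val_zero]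
  have hstage : ∀ c ∈ ([1, 2, 3] : List ℕ), ∀ k, (if c ≤ G.stage k then 1 else 0) = f := by
    intro c hc k
    rw [hs]
    simp only [List.mem_cons, List.not_mem_nil, or_false] at hc
    split_ifs <;> omega
  have s1 := hstage 1 (by simp)
  have s2 := hstage 2 (by simp)
  have s3 := hstage 3 (by simp)
  rw [GadgetNet.arc_vx]
  simp only [arcExpr, eval_add, eval_mul, eval_const, eval_eqb, eval_div, eval_rolesAre L st ha hb,
    ha, hb, val_vx, hm, eval_reg, h2, eval_ofNat, eval_zero, hi, hj, ei, ej]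
  rcases roles_cases ρ σ with h | h
  · simp only [List.mem_cons, List.not_mem_nil, or_false, Prod.mk.injEq] at h
    rcases h with h | h | h | h | h | h | h | h | h | h | h | h | h | h | h <;>
    · obtain ⟨rfl, rfl⟩ := h
      simp [GadgetNet.arcAt, eqNat, hU, hV, s1, s2, s3, mul_comm, mul_left_comm]
  · have h0 : G.arcAt ρ i σ j = 0 := by
      unfold GadgetNet.arcAt
      split <;> first | rfl | (exfalso; revert h; decide)
    simp only [List.mem_cons, List.not_mem_nil, or_false, forall_eq_or_imp, forall_eq] at h
    simp [h0, eqNat, h]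

/-- The entry of the matrix in the block. -/
def blockEntry (a b : SrcExpr) : SrcExpr :=
  ((reg 7 * reg 2 + a / 8).ltb size) * ((reg 8 * reg 2 + b / 8).ltb size) *
    mat ((reg 7 * reg 2 + a / 8) * size + (reg 8 * reg 2 + b / 8))

/-- The capacity between `a` and `b`. -/
def capExpr (β f : ℕ) (m : SrcExpr → SrcExpr → SrcExpr) (a b : SrcExpr) : SrcExpr :=
  arcExpr β f (m a b) a b + const β * arcExpr β f (m b a) b a

theorem eval_capExpr {B : ℕ} [NeZero B] {G : GadgetNet B} {f : ℕ} (hU : ∀ k i, G.U k i = f)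
    (hV : ∀ k i, G.V k i = f) (hs : ∀ k, G.stage k = 3 * f) (hf : f ≤ 1)
    {L : Layout} {st : St} (h2 : st.reg 2 = B) {m : SrcExpr → SrcExpr → SrcExpr}
    (hm : ∀ (a b : SrcExpr) (ρ σ : Fin 8) (i j : Fin B), a.eval L st = vx ρ i →
      b.eval L st = vx σ j → (m a b).eval L st = G.M i j)
    {a b : SrcExpr} {u v : Fin (B * 8)} (ha : a.eval L st = u) (hb : b.eval L st = v) :
    (capExpr G.β f m a b).eval L st = G.cap u v := by
  obtain ⟨ρ, i, rfl⟩ := exists_vx u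
  obtain ⟨σ, j, rfl⟩ := exists_vx v
  simp only [capExpr, GadgetNet.cap, eval_add, eval_mul, eval_const]
  rw [eval_arcExpr hU hV hs hf h2 (hm _ _ _ _ _ _ ha hb) ha hb,
    eval_arcExpr hU hV hs hf h2 (hm _ _ _ _ _ _ hb ha) hb ha]

/-- The capacities of the start graph. -/
def startExpr (mode : DynMode) (β : ℕ) (a b : SrcExpr) : SrcExpr :=
  match mode with
  | .incremental => 0
  | .decremental => (1 - a.eqb b) * (capExpr β 0 (fun _ _ => 0) a b +
      (capExpr β 0 (fun _ _ => 0) a b).eqb 0)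

theorem eval_startExpr {B : ℕ} [NeZero B] (g : GraphClass) (mode : DynMode) {L : Layout} {st : St}
    (h2 : st.reg 2 = B) {a b : SrcExpr} {u v : Fin (B * 8)} (ha : a.eval L st = u)
    (hb : b.eval L st = v) :
    (startExpr mode g.beta a b).eval L st = startCap B g mode u v := by
  cases mode with
  | incremental => rfl
  | decremental =>
    have h : (capExpr g.beta 0 (fun _ _ => 0) a b).eval L st = (hubNet B g).cap u v :=
      eval_capExpr (G := hubNet B g) (fun _ _ => rfl) (fun _ _ => rfl) (fun _ => rfl) zero_le_one
        h2
        (fun _ _ _ _ _ _ _ _ => rfl) ha hb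
    simp only [startExpr, startCap, eval_mul, eval_add, eval_sub, eval_eqb, h, ha, hb, eval_one,
      eval_zero]
    by_cases huv : u = v
    · simp [huv, eqNat]
    · have : eqNat (u : ℕ) v = 0 := if_neg fun h => huv (Fin.ext h)
      rw [this, if_neg huv]
      unfold eqNat
      split_ifs <;> omega

theorem eval_netExpr {n : ℕ} {B : ℕ} [NeZero B] (g : GraphClass) (mode : DynMode) {L : Layout}
    (hn : L.n = n) {st : St} {x y : ℕ} (h2 : st.reg 2 = B) (h7 : st.reg 7 = x) (h8 : st.reg 8 = y)
    (vecs : ℕ → ℕ → ℕ) (X w : ℕ) {a b : SrcExpr} {u v : Fin (B * 8)} (ha : a.eval L st = u)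
    (hb : b.eval L st = v) :
    (capExpr g.beta (1 - mode.bit) blockEntry a b).eval L st =
      ((blockData n L.mat vecs B X w x y).netAt mode g 0).cap u v := by
  subst hn
  refine eval_capExpr (G := (blockData L.n L.mat vecs B X w x y).netAt mode g 0) (fun k i => ?_)
    (fun k i => ?_) (fun k => ?_) (by omega) h2 ?_ ha hb
  · simp [BlockData.netAt, phasesDone]
  · simp [BlockData.netAt, phasesDone]
  · cases mode <;> simp [BlockData.netAt, phasesDone, DynMode.stage, DynMode.bit]
  · intro a b ρ σ i j ha hb
    have hi : ((ρ : ℕ) + 8 * i) / 8 = i := by omega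
    have hj : ((σ : ℕ) + 8 * j) / 8 = j := by omega
    simp only [blockEntry, eval_mul, eval_ltb, eval_add, eval_reg, eval_div, ha, hb, val_vx,
      eval_ofNat, hi, hj, h2, h7, h8, eval_size, eval_mat, BlockData.netAt, blockData]
    by_cases h : x * B + i < L.n ∧ y * B + j < L.n
    · rw [Nat.mod_eq_of_lt]
      calc (x * B + i) * L.n + (y * B + j) < (x * B + i) * L.n + L.n := by omega
        _ = (x * B + i + 1) * L.n := by ring
        _ ≤ L.n * L.n := Nat.mul_le_mul_right _ h.1
    · rcases not_and_or.1 h with h | h <;> simp [ltNat_of_not_lt h]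

theorem startCap_le {B : ℕ} [NeZero B] (g : GraphClass) (mode : DynMode) (u v : Fin (B * 8)) :
    startCap B g mode u v ≤ B * 8 := by
  have hB : 0 < B := NeZero.pos B
  cases mode with
  | incremental => exact Nat.zero_le _
  | decremental =>
    have h := (hubNet B g).cap_le (hubNet_bounded g) u v
    have h' : (hubNet B g).cap u v ≤ B * 8 := by split_ifs at h <;> omega
    simp only [startCap]
    split_ifs <;> omega

section

/-! ### Initializing the data structure of one block -/

/-- A number below `N * N` as a pair. -/
theorem exists_pair {N e : ℕ} (he : e < N * N) :
    ∃ p : Fin (N * N), (p : ℕ) = e ∧ e / N = p.divNat ∧ e % N = p.modNat :=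
  ⟨⟨e, he⟩, rfl, rfl, rfl⟩

/-- The entries of a matrix, row by row. -/
def Network.entry {N : ℕ} (cap : Network N) (e : ℕ) : ℕ :=
  if h : e < N * N then cap (⟨e, h⟩ : Fin (N * N)).divNat (⟨e, h⟩ : Fin (N * N)).modNat else 0

theorem Network.entry_eq {N : ℕ} (cap : Network N) (p : Fin (N * N)) :
    cap.entry p = cap p.divNat p.modNat := by simp [Network.entry, p.2]

theorem DynFlowAlgorithm.initMem_eq {N : ℕ} (cap : Network N) (s t : Fin N) (a : ℕ) :
    DynFlowAlgorithm.initMem cap s t a = if 3 ≤ a ∧ a - 3 < N * N then cap.entry (a - 3) else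
      if a = 2 then (t : ℕ) else if a = 1 then (s : ℕ) else if a = 0 then N else 0 := by
  unfold DynFlowAlgorithm.initMem RamMem.writeMatrix RamMem.writeArray
  by_cases h : 3 ≤ a ∧ a - 3 < N * N
  · rw [dif_pos h, if_pos h, Network.entry, dif_pos h.2]
  · rw [dif_neg h, if_neg h]
    simp only [Function.update_apply]

/-- The vertices of the current pair. -/
def loadPair : RamProg := assign 13 (reg 12 / (reg 2 * 8)) ;; assign 14 (reg 12 % (reg 2 * 8))

/-- Write the start graph into the current region. -/
def writeStart (mode : DynMode) (β : ℕ) : RamProg :=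
  assignCell 0 (reg 2 * 8) ;; assignCell 1 0 ;; assignCell 2 1 ;;
  forLoop 12 ((reg 2 * 8) * (reg 2 * 8))
    (loadPair ;; assignCell (3 + reg 12) (startExpr mode β (reg 13) (reg 14)))

namespace DynFlowAlgorithm

/-- Issue the updates that lead from the start graph to the network of the block. -/
def syncStart (A : DynFlowAlgorithm) (mode : DynMode) (β : ℕ) : RamProg :=
  forLoop 12 ((reg 2 * 8) * (reg 2 * 8))
    (loadPair ;; assign 15 (startExpr mode β (reg 13) (reg 14)) ;;
      assign 16 (capExpr β (1 - mode.bit) blockEntry (reg 13) (reg 14)) ;;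
      SrcExpr.branch (const (1 - β) + (reg 13).ltb (reg 14))
        (A.tryUpdate (1 - (reg 15).eqb (reg 16)) (reg 13) (reg 14) (reg 16)) .skip)

/-- Initialize the current region. -/
def initBlock (A : DynFlowAlgorithm) (mode : DynMode) (β : ℕ) : RamProg :=
  writeStart mode β ;; A.init.reloc ;; A.syncStart mode β

end DynFlowAlgorithm

variable {B : ℕ} [NeZero B] {L : Layout} {st : St} {φ q : ℕ} {Q : St → ℕ → Prop}

theorem wp_loadPair (hN : B * 8 * (B * 8) < L.V) (h2 : st.reg 2 = B)
    {p : Fin (B * 8 * (B * 8))} (h12 : st.reg 12 = p)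
    (hQ : ∀ st', St.Agree q st st' → st'.inst = st.inst → st'.reg 12 = p →
      st'.reg 13 = p.divNat → st'.reg 14 = p.modNat → Q st' φ) :
    L.WP loadPair 2 Q st φ := by
  have hB : 0 < B * 8 := by have := NeZero.pos B; omega
  have h1 := p.divNat.2
  have h3 := p.modNat.2
  have h4 : B * 8 ≤ B * 8 * (B * 8) := Nat.le_mul_of_pos_right _ hB
  have e1 : (p : ℕ) / (B * 8) = p.divNat := rfl
  have e2 : (p : ℕ) % (B * 8) = p.modNat := rfl
  refine Layout.WP.seq (T₁ := 1) (T₂ := 1) (Layout.WP.assign ?_ (Layout.WP.assign ?_ ?_))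
  · simp only [eval_div, eval_mul, eval_reg, eval_ofNat, h2, h12, e1]; omega
  · simp only [eval_mod, eval_mul, eval_reg, eval_ofNat,
      St.reg_setReg_of_ne st (show (12 : Fin 32) ≠ 13 by decide),
      St.reg_setReg_of_ne st (show (2 : Fin 32) ≠ 13 by decide), h2, h12, e2]
    omega
  · refine hQ _ ((St.Agree.refl.setReg (by decide) _).setReg (by decide) _) rfl ?_ ?_ ?_
    · simp [St.reg_setReg_of_ne, h12]
    · simp [St.reg_setReg_of_ne, h12, h2]
    · simp [St.reg_setReg_of_ne, h12, h2]

theorem wp_writeStart (mode : DynMode) (g : GraphClass) {W : ℕ} (hq : q < L.cnt)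
    (hb : st.reg 0 = L.base q) (hL : L.Room W (B * 8)) (h2 : st.reg 2 = B)
    (hz : ∀ a, st.inst q a = 0)
    (hQ : ∀ st', St.Agree q st st' →
      st'.inst q = DynFlowAlgorithm.initMem (startCap B g mode) (vx 0 0) (vx 1 0) → Q st' φ) :
    L.WP (writeStart mode g.beta) (B * 8 * (B * 8) * 5 + 5) Q st φ := by
  have hS := hL.S_ge
  have hV := hL.V_ge
  have hlt := hL.lt_V
  have h8 := hL.pos
  have hNV : B * 8 * (B * 8) < L.V := by omega
  refine Layout.WP.mono_time (T := 1 + (1 + (1 + (B * 8 * (B * 8) * (3 + 2) + 2)))) ?_ (by omega)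
  refine Layout.WP.seq (Layout.WP.assignCell hq hb (by simp; omega) (by simp [h2, hlt]) ?_)
  refine Layout.WP.seq (Layout.WP.assignCell hq hb (by simp; omega) (by simp; omega) ?_)
  refine Layout.WP.seq (Layout.WP.assignCell hq hb (by simp; omega) (by simp; omega) ?_)
  simp only [eval_mul, eval_reg, eval_ofNat, eval_zero, eval_one,
    St.setInst_setInst, St.inst_setInst, h2]
  -- Cells 1 and 2 get `0` and `1`, the numbers of the vertices `vx 0 0` and `vx 1 0`.
  refine Layout.WP.forLoop (fun i st' φ' => φ' = φ ∧ St.Agree q st st' ∧ st'.reg 12 = i ∧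
    ∀ a, st'.inst q a = if 3 ≤ a ∧ a - 3 < i then (startCap B g mode).entry (a - 3) else
      if a = 2 then 1 else if a = 1 then 0 else if a = 0 then B * 8 else 0)
    (B * 8 * (B * 8)) hNV ?_ ?_ ?_ ?_ ?_
  · rintro i - st' φ' ⟨-, ag, -, -⟩
    simp [ag.reg 2 (by decide), h2]
  · rintro i - st' φ' ⟨-, -, h, -⟩
    exact h
  · rintro i hi st' φ' ⟨rfl, ag, h12, hmem⟩
    obtain ⟨p, rfl, -, -⟩ := exists_pair hi
    refine Layout.WP.seq (T₁ := 2) (T₂ := 1)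
      (wp_loadPair (q := q) hNV ((ag.reg 2 (by decide)).trans h2) h12 ?_)
    intro st₁ ag₁ hi₁ r12 r13 r14
    have ag₂ := ag.trans ag₁
    have hs := eval_startExpr g mode (L := L) (st := st₁) ((ag₂.reg 2 (by decide)).trans h2)
      (a := reg 13) (b := reg 14) r13 r14
    refine Layout.WP.assignCell hq ((ag₂.reg 0 (by decide)).trans hb) ?_ ?_ ⟨?_, rfl, ?_, ?_, ?_⟩
    · simp [r12]; omega
    · rw [hs]; exact lt_of_le_of_lt (startCap_le _ _ _ _) hlt
    · simpa using r12
    · exact (ag₂.setInst _).setReg (by decide) _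
    · simp
    · intro a
      simp only [St.inst_setReg, St.inst_setInst, Function.update_apply, hs, eval_add, eval_ofNat,
        eval_reg, r12, hi₁, hmem, ← Network.entry_eq]
      by_cases ha : a = 3 + (p : ℕ)
      · subst ha
        simp
      · rw [if_neg ha]
        have : (3 ≤ a ∧ a - 3 < (p : ℕ)) ↔ (3 ≤ a ∧ a - 3 < (p : ℕ) + 1) := by omega
        simp only [this]
  · refine ⟨rfl, (St.Agree.refl.setInst _).setReg (by decide) _, by simp, fun a => ?_⟩
    simp only [St.inst_setReg, St.inst_setInst, Function.update_apply, hz]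
    simp
  · rintro st' φ' ⟨rfl, ag, -, hmem⟩
    refine hQ st' ag (funext fun a => ?_)
    rw [DynFlowAlgorithm.initMem_eq, hmem]
    simp [val_vx]

namespace DynFlowAlgorithm

variable {A : DynFlowAlgorithm} {mode : DynMode} {g : GraphClass} {W τ : ℕ}

theorem wp_syncStart (hg : ∀ k, g = .weightedUndirected k → 1 ≤ k) (hq : q < L.cnt)
    (hb : st.reg 0 = L.base q) (hL : L.Room W (B * 8)) {x y : ℕ} (vecs : ℕ → ℕ → ℕ) (X w : ℕ)
    (hD : (blockData L.n L.mat vecs B X w x y).Bounded)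
    (h2 : st.reg 2 = B) (h7 : st.reg 7 = x) (h8 : st.reg 8 = y)
    {rest : List (FlowRequest (B * 8))}
    (hH : A.Handles g W (vx 0 0) (vx 1 0) (startCap B g mode) (st.inst q)
      (syncReqs (startCap B g mode) ((blockData L.n L.mat vecs B X w x y).netAt mode g 0).cap
        (initPairs (B * 8) g) ++ rest) τ)
    (hQ : ∀ st' τ', St.Agree q st st' →
      A.Handles g W (vx 0 0) (vx 1 0) ((blockData L.n L.mat vecs B X w x y).netAt mode g 0).cap
        (st'.inst q) rest τ' → Q st' (φ + 30 * τ')) :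
    L.WP (A.syncStart mode g.beta) (B * 8 * (B * 8) * 11 + 2) Q st (φ + 30 * τ) := by
  set D := blockData L.n L.mat vecs B X w x y with hDdef
  have hS := hL.S_ge
  have hV := hL.V_ge
  have hlt := hL.lt_V
  have hpos := hL.pos
  have hNV : B * 8 * (B * 8) < L.V := by omega
  have hβ := g.beta_le_one
  set old := startCap B g mode with hold
  set new := (D.netAt mode g 0).cap with hnew
  let item : Fin (B * 8 * (B * 8)) → List (FlowRequest (B * 8)) := fun e =>
    syncReqs old new (if g.beta = 0 ∨ e.divNat < e.modNat then [(e.divNat, e.modNat)] else [])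
  have hitems : ∀ l : List (Fin (B * 8 * (B * 8))), syncReqs old new (l.flatMap fun e =>
      if g.beta = 0 ∨ e.divNat < e.modNat then [(e.divNat, e.modNat)] else []) =
      l.flatMap item := by
    intro l
    simp only [syncReqs, List.flatMap_assoc, item]
  have hreq : syncReqs old new (initPairs (B * 8) g) =
      ((List.finRange (B * 8 * (B * 8))).drop 0).flatMap item := hitems _
  have hfin := (syncReqs_init (mode := mode) hg hD).1
  rw [← hold, ← hnew, hreq] at hfin
  rw [hreq] at hH
  refine Layout.WP.mono_time (T := B * 8 * (B * 8) * (9 + 2) + 2) ?_ (by omega)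
  refine Layout.WP.forLoop (fun i st' φ' => St.Agree q st st' ∧ st'.reg 12 = i ∧
    ∃ τ', φ' = φ + 30 * τ' ∧ A.Pending g W (vx 0 0) (vx 1 0) new
      (((List.finRange (B * 8 * (B * 8))).drop i).flatMap item) rest (st'.inst q) τ')
    (B * 8 * (B * 8)) hNV ?_ ?_ ?_ ?_ ?_
  · rintro i - st' φ' ⟨ag, -, -⟩
    simp [ag.reg 2 (by decide), h2]
  · rintro i - st' φ' ⟨-, h, -⟩
    exact h
  · rintro i hi st' φ' ⟨ag, h12, τ', rfl, hP⟩
    obtain ⟨p, rfl, -, -⟩ := exists_pair hi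
    rw [List.drop_eq_getElem_cons (by simp), List.getElem_finRange,
      List.flatMap_cons] at hP
    simp only [Fin.cast_mk, Fin.eta] at hP
    refine Layout.WP.seq (T₁ := 2) (T₂ := 7)
      (wp_loadPair (q := q) hNV ((ag.reg 2 (by decide)).trans h2) h12 ?_)
    intro st₁ ag₁ hi₁ r12 r13 r14
    have ag₂ := ag.trans ag₁
    have hs := eval_startExpr g mode (L := L) (st := st₁) ((ag₂.reg 2 (by decide)).trans h2)
      (a := reg 13) (b := reg 14) r13 r14
    have hsV : old p.divNat p.modNat < L.V := lt_of_le_of_lt (startCap_le _ _ _ _) hlt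
    refine Layout.WP.seq (T₁ := 1) (T₂ := 6) (Layout.WP.assign (by rw [hs]; exact hsV) ?_)
    rw [hs]
    set st₂ := st₁.setReg 15 (old p.divNat p.modNat) with hst₂
    have ag₃ : St.Agree q st st₂ := ag₂.setReg (by decide) _
    have q13 : st₂.reg 13 = p.divNat := by simp [hst₂, St.reg_setReg_of_ne, r13]
    have q14 : st₂.reg 14 = p.modNat := by simp [hst₂, St.reg_setReg_of_ne, r14]
    have hc := eval_netExpr g mode (L := L) rfl (st := st₂) (x := x) (y := y)
      ((ag₃.reg 2 (by decide)).trans h2) ((ag₃.reg 7 (by decide)).trans h7)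
      ((ag₃.reg 8 (by decide)).trans h8) vecs X w (a := reg 13) (b := reg 14) q13 q14
    have hcV : new p.divNat p.modNat < L.V := by
      refine lt_of_le_of_lt ((GadgetNet.cap_le _ (hD.netAt mode g 0) _ _).trans ?_) hlt
      split_ifs <;> omega
    refine Layout.WP.seq (T₁ := 1) (T₂ := 5) (Layout.WP.assign (by rw [hc]; exact hcV) ?_)
    rw [hc]
    set st₃ := st₂.setReg 16 (new p.divNat p.modNat) with hst₃
    have ag₄ : St.Agree q st st₃ := ag₃.setReg (by decide) _
    have t12 : st₃.reg 12 = p := by simp [hst₃, hst₂, St.reg_setReg_of_ne, r12]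
    have t13 : st₃.reg 13 = p.divNat := by simp [hst₃, St.reg_setReg_of_ne, q13]
    have t14 : st₃.reg 14 = p.modNat := by simp [hst₃, St.reg_setReg_of_ne, q14]
    have t15 : st₃.reg 15 = old p.divNat p.modNat := by
      simp [hst₃, hst₂, St.reg_setReg_of_ne]
    have t16 : st₃.reg 16 = new p.divNat p.modNat := by simp [hst₃]
    have ti : st₃.inst q = st'.inst q := by simp [hst₃, hst₂, hi₁]
    rw [← ti] at hP
    clear_value st₃
    have hcond : (const (1 - g.beta) + (reg 13).ltb (reg 14)).eval L st₃ ≠ 0 ↔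
        (g.beta = 0 ∨ p.divNat < p.modNat) := by
      simp only [eval_add, eval_const, eval_ltb, eval_reg, t13, t14, Fin.lt_def]
      rw [← ltNat_ne_zero (a := (p.divNat : ℕ))]
      omega
    refine Layout.WP.branch (T := 4) (fun h => ?_) (fun h => ?_)
    · have hite : item p = syncItem old new (p.divNat, p.modNat) := by
        simp [item, if_pos (hcond.1 h), syncReqs]
      rw [hite] at hP
      rw [← St.setInst_self st₃ q]
      refine wp_tryUpdate hq ((ag₄.reg 0 (by decide)).trans hb) hL.W_le (by omega) hlt.le hP ?_
        t13 t14 (fun _ => ⟨t16, hcV⟩) ?_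
      · simp only [eval_sub, eval_one, eval_eqb, eval_reg, t15, t16, eqNat]
        split_ifs with h <;> simp [h]
      · intro μ' τ₂ hP₂
        exact ⟨by simpa using t12, (ag₄.setInst _).setReg (by decide) _, by simp, τ₂, rfl,
          by simpa using hP₂⟩
    · have hite : item p = [] := by
        have : ¬ (g.beta = 0 ∨ p.divNat < p.modNat) := fun h' => hcond.2 h' h
        simp [item, if_neg this, syncReqs]
      rw [hite, List.nil_append] at hP
      exact Layout.WP.mono_time (Layout.WP.skip ⟨t12, ag₄.setReg (by decide) _, by simp, τ', rfl,
        by simpa using hP⟩) (by omega)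
  · exact ⟨St.Agree.refl.setReg (by decide) _, by simp, τ, rfl, _, hfin, hH⟩
  · rintro st' φ' ⟨ag, -, τ', rfl, hP⟩
    rw [List.drop_of_length_le (by simp), List.flatMap_nil] at hP
    exact hQ st' τ' ag (pending_nil hP)

theorem wp_initBlock (hg : ∀ k, g = .weightedUndirected k → 1 ≤ k) (hq : q < L.cnt)
    (hb : st.reg 0 = L.base q) (hL : L.Room W (B * 8)) {x y : ℕ} (vecs : ℕ → ℕ → ℕ) (X w : ℕ)
    (hD : (blockData L.n L.mat vecs B X w x y).Bounded)
    (h2 : st.reg 2 = B) (h7 : st.reg 7 = x) (h8 : st.reg 8 = y) (hz : ∀ a, st.inst q a = 0)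
    {μ : RamMem} {τ₀ : ℕ}
    (hI : RamExec W A.init (initMem (startCap B g mode) (vx 0 0) (vx 1 0)) μ τ₀)
    {rest : List (FlowRequest (B * 8))}
    (hH : A.Handles g W (vx 0 0) (vx 1 0) (startCap B g mode) μ
      (syncReqs (startCap B g mode) ((blockData L.n L.mat vecs B X w x y).netAt mode g 0).cap
        (initPairs (B * 8) g) ++ rest) τ)
    (hQ : ∀ st' τ', St.Agree q st st' →
      A.Handles g W (vx 0 0) (vx 1 0) ((blockData L.n L.mat vecs B X w x y).netAt mode g 0).cap
        (st'.inst q) rest τ' → Q st' (φ + 30 * τ')) :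
    L.WP (A.initBlock mode g.beta) (B * 8 * (B * 8) * 16 + 7) Q st (φ + 30 * (τ₀ + τ)) := by
  refine Layout.WP.mono_time (T := (B * 8 * (B * 8) * 5 + 5) + (0 + (B * 8 * (B * 8) * 11 + 2)))
    (Layout.WP.seq (wp_writeStart mode g hq hb hL h2 hz ?_)) (by omega)
  intro st₁ ag hi
  have e : φ + 30 * (τ₀ + τ) = (φ + 30 * τ) + 30 * τ₀ := by ring
  rw [e]
  refine Layout.WP.seq (Layout.WP.call (W := W) (μ' := μ) hq ((ag.reg 0 (by decide)).trans hb)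
    hL.W_le (by rw [hi]; exact hI) ?_)
  have ag₂ : St.Agree q st (st₁.setInst q μ) := ag.setInst _
  refine wp_syncStart hg hq ((ag₂.reg 0 (by decide)).trans hb) hL vecs X w hD
    ((ag₂.reg 2 (by decide)).trans h2) ((ag₂.reg 7 (by decide)).trans h7)
    ((ag₂.reg 8 (by decide)).trans h8) (by simpa using hH) ?_
  intro st' τ' ag' h'
  exact hQ st' τ' (ag₂.trans ag') h'

end DynFlowAlgorithm

end

/-! ### The program for one round -/

/-- The address of a region. -/
def baseExpr (q : SrcExpr) : SrcExpr := 1 + size * size + size + size + 32 + q * reg 1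

theorem eval_baseExpr {L : Layout} {st : St} (h1 : st.reg 1 = L.S) (e : SrcExpr) :
    (baseExpr e).eval L st = L.base (e.eval L st) := by
  simp [baseExpr, Layout.base, Layout.off, h1]

/-- The data of the block with number `q`. -/
noncomputable def dataOf (n : ℕ) (mat : ℕ → ℕ) (vecs : ℕ → ℕ → ℕ) (B X q : ℕ) : BlockData B :=
  blockData n mat vecs B X (q / (X * X)) (q % (X * X) / X) (q % X)

/-- How many rounds of its window a block has seen before round `r`. -/
def roundsDone (B X q r : ℕ) : ℕ := min (r - q / (X * X) * B) B

theorem block_number {X w z : ℕ} (hz : z < X * X) :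
    (w * (X * X) + z) / (X * X) = w ∧ (w * (X * X) + z) % (X * X) = z ∧
      (w * (X * X) + z) % X = z % X := by
  have hX : 0 < X * X := by omega
  refine ⟨?_, ?_, ?_⟩
  · rw [mul_comm, Nat.mul_add_div hX, Nat.div_eq_of_lt hz, Nat.add_zero]
  · rw [mul_comm, Nat.mul_add_mod, Nat.mod_eq_of_lt hz]
  · rw [← mul_assoc, mul_comm, Nat.mul_add_mod]

theorem roundsDone_same {B X r z : ℕ} (hz : z < X * X) (d : ℕ) (hd : r % B + d ≤ B) :
    roundsDone B X (r / B * (X * X) + z) (r + d) = r % B + d := by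
  rw [roundsDone, (block_number hz).1]
  have : r / B * B + r % B = r := Nat.div_add_mod' r B
  omega

/-- The block belongs to an earlier window, where the minimum has already reached `B`. -/
theorem roundsDone_of_lt {B X r q : ℕ} (hB : 0 < B) (hX : 0 < X) (hq : q < r / B * (X * X)) :
    roundsDone B X q r = roundsDone B X q (r + 1) := by
  have h1 : q / (X * X) < r / B := (Nat.div_lt_iff_lt_mul (Nat.mul_pos hX hX)).2 hq
  have h2 : (q / (X * X) + 1) * B ≤ r / B * B := Nat.mul_le_mul_right _ h1
  have h3 : r / B * B + r % B = r := Nat.div_add_mod' r B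
  unfold roundsDone
  rw [Nat.add_mul] at h2
  omega

/-- The block belongs to a later window, where the truncated subtraction gives `0` both times. -/
theorem roundsDone_of_ge {B X r q : ℕ} (hB : 0 < B) (hX : 0 < X)
    (hq : r / B * (X * X) + X * X ≤ q) : roundsDone B X q r = roundsDone B X q (r + 1) := by
  have h1 : r / B + 1 ≤ q / (X * X) :=
    (Nat.le_div_iff_mul_le (Nat.mul_pos hX hX)).2 (by rw [Nat.add_mul]; omega)
  have h2 : (r / B + 1) * B ≤ q / (X * X) * B := Nat.mul_le_mul_right _ h1
  have h3 : r / B * B + r % B = r := Nat.div_add_mod' r B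
  have h4 := Nat.mod_lt r hB
  unfold roundsDone
  rw [Nat.add_mul] at h2
  omega

/-- The parameters of the reduction are consistent. -/
structure Layout.Fit (L : Layout) (W B X : ℕ) : Prop where
  valid : L.Valid
  room : L.Room W (B * 8)
  sq_lt : B * B + 1 < L.V
  mat : ∀ a, L.mat a ≤ 1
  div_lt : ∀ J < L.n, J / B < X
  cnt : L.cnt = X * X * X

namespace Layout.Fit

variable {L : Layout} {W B X : ℕ}

theorem X_pos (h : L.Fit W B X) : 0 < X := lt_of_le_of_lt (Nat.zero_le _) (h.div_lt 0 h.valid.n_pos)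

theorem n_lt (h : L.Fit W B X) : L.n < L.V := by
  have := h.valid.le_V
  unfold Layout.off at this
  omega

theorem cube_lt (h : L.Fit W B X) : X * X * X < L.V := by
  have h1 := h.valid.le_V
  have h2 : 0 < L.S := by have := h.room.S_ge; omega
  have h3 : L.cnt ≤ L.cnt * L.S := Nat.le_mul_of_pos_right _ h2
  have := h.cnt
  omega

theorem sq_le_cube (h : L.Fit W B X) : X * X ≤ X * X * X := Nat.le_mul_of_pos_right _ h.X_pos

theorem le_sq (h : L.Fit W B X) : X ≤ X * X := Nat.le_mul_of_pos_right _ h.X_pos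

end Layout.Fit

namespace DynFlowAlgorithm

/-- The program that is run on the arrival of a vector. -/
def roundProg (A : DynFlowAlgorithm) (mode : DynMode) (β : ℕ) : RamProg :=
  assign 5 (reg 4 / reg 2) ;; assign 6 (reg 4 % reg 2) ;;
  forLoop 9 size (assignAns (reg 9) 0) ;;
  forLoop 9 (reg 3 * reg 3)
    (assign 7 (reg 9 / reg 3) ;; assign 8 (reg 9 % reg 3) ;;
      assign 0 (baseExpr (reg 5 * (reg 3 * reg 3) + reg 9)) ;; A.blockRound mode β) ;;
  assign 4 (reg 4 + 1)

variable (A : DynFlowAlgorithm) (mode : DynMode) (g : GraphClass) (W : ℕ) {B : ℕ} [NeZero B]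

/-- The data structures of the blocks are ready for the rounds that remain, of which `d` tells how
many have been done.  The credits pay for their operations. -/
def Ready (L : Layout) (vecs : ℕ → ℕ → ℕ) (B : ℕ) [NeZero B] (X : ℕ) (d : ℕ → ℕ) (inst : ℕ → RamMem)
    (φ : ℕ) : Prop :=
  ∃ τ : ℕ → ℕ, φ = 30 * ∑ q ∈ Finset.range (X * X * X), τ q ∧
    ∀ q < X * X * X, A.Handles g W (vx 0 0) (vx 1 0)
      ((dataOf L.n L.mat vecs B X q).netAt mode g (3 * d q)).cap (inst q)
      (((List.finRange B).drop (d q)).flatMap ((dataOf L.n L.mat vecs B X q).roundReqs mode g))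
      (τ q)

variable {A mode g W} {L : Layout} {st : St} {φ X : ℕ} {Q : St → ℕ → Prop} {vecs : ℕ → ℕ → ℕ}

theorem Ready.congr {d d' : ℕ → ℕ} {inst : ℕ → RamMem}
    (h : A.Ready mode g W L vecs B X d inst φ) (hd : ∀ q < X * X * X, d q = d' q) :
    A.Ready mode g W L vecs B X d' inst φ := by
  obtain ⟨τ, h1, h2⟩ := h
  refine ⟨τ, h1, fun q hq => ?_⟩
  rw [← hd q hq]
  exact h2 q hq

/-- Take the data structure of one block out. -/
theorem Ready.take {d : ℕ → ℕ} {inst : ℕ → RamMem} (h : A.Ready mode g W L vecs B X d inst φ)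
    {q₀ : ℕ} (hq₀ : q₀ < X * X * X) :
    ∃ τ φ', φ = φ' + 30 * τ ∧ A.Handles g W (vx 0 0) (vx 1 0)
      ((dataOf L.n L.mat vecs B X q₀).netAt mode g (3 * d q₀)).cap (inst q₀)
      (((List.finRange B).drop (d q₀)).flatMap ((dataOf L.n L.mat vecs B X q₀).roundReqs mode g)) τ ∧
      ∀ (d' : ℕ → ℕ) (inst' : ℕ → RamMem) (τ' : ℕ), (∀ q < X * X * X, q ≠ q₀ → d' q = d q) →
        (∀ q, q ≠ q₀ → inst' q = inst q) →
        A.Handles g W (vx 0 0) (vx 1 0)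
          ((dataOf L.n L.mat vecs B X q₀).netAt mode g (3 * d' q₀)).cap (inst' q₀)
          (((List.finRange B).drop (d' q₀)).flatMap
            ((dataOf L.n L.mat vecs B X q₀).roundReqs mode g)) τ' →
        A.Ready mode g W L vecs B X d' inst' (φ' + 30 * τ') := by
  obtain ⟨τ, rfl, h2⟩ := h
  have hmem : q₀ ∈ Finset.range (X * X * X) := Finset.mem_range.2 hq₀
  refine ⟨τ q₀, 30 * ∑ q ∈ (Finset.range (X * X * X)).erase q₀, τ q, ?_, h2 q₀ hq₀, ?_⟩
  · rw [← Finset.sum_erase_add _ _ hmem, Nat.mul_add]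
  · intro d' inst' τ' hd hi hH
    refine ⟨Function.update τ q₀ τ', ?_, fun q hq => ?_⟩
    · rw [← Finset.sum_erase_add _ _ hmem, Nat.mul_add, Function.update_self]
      congr 2
      refine Finset.sum_congr rfl fun q hq => ?_
      rw [Function.update_of_ne (Finset.ne_of_mem_erase hq)]
    · by_cases hqq : q = q₀
      · subst hqq
        rwa [Function.update_self]
      · rw [Function.update_of_ne hqq, hd q hq hqq, hi q hqq]
        exact h2 q hq

theorem wp_clearAns (hnV : L.n < L.V)
    (hQ : ∀ st', st'.vec = st.vec → st'.inst = st.inst → (∀ r : Fin 32, r < 9 → st'.reg r = st.reg r) →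
      (∀ I < L.n, st'.ans I = 0) → Q st' φ) :
    L.WP (forLoop 9 size (assignAns (reg 9) 0)) (L.n * 3 + 2) Q st φ := by
  refine Layout.WP.forLoop (T := 1) (fun i st' φ' => φ' = φ ∧ st'.reg 9 = i ∧ st'.vec = st.vec ∧
    st'.inst = st.inst ∧ (∀ r : Fin 32, r < 9 → st'.reg r = st.reg r) ∧ ∀ I < i, st'.ans I = 0)
    L.n hnV ?_ ?_ ?_ ?_ ?_
  · intros; rfl
  · rintro i - st' φ' ⟨-, h, -⟩
    exact h
  · rintro i hi st' φ' ⟨rfl, h9, hv, hin, hr, ha⟩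
    refine Layout.WP.assignAns (by simp; omega) ⟨by simpa using h9, rfl, by simp, by simpa using hv,
      by simpa using hin, fun r hr' => ?_, fun I hI => ?_⟩
    · rw [St.reg_setReg_of_ne _ (ne_of_lt hr')]
      exact hr r hr'
    · simp only [St.ans_setReg, St.ans_setAns, eval_reg, h9, Nat.mod_eq_of_lt hi,
        Function.update_apply, eval_zero]
      split_ifs with h
      · rfl
      · exact ha I (by omega)
  · refine ⟨rfl, by simp, rfl, rfl, fun r hr' => ?_, by simp⟩
    rw [St.reg_setReg_of_ne _ (ne_of_lt hr')]
  · rintro st' φ' ⟨rfl, -, hv, hin, hr, ha⟩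
    exact hQ st' hv hin hr ha

/-- The blocks of the current window are visited in the order of their numbers, so the sets of rows
that a block is asked about are those prescribed by `rowHit`. All operations of the data structures
are paid by the credits in `Ready`. -/
theorem wp_roundProg (hL : L.Fit W B X) (hg : ∀ k, g = .weightedUndirected k → 1 ≤ k)
    (hvecs : ∀ r j, vecs r j ≤ 1) {r : ℕ} (hr : r < L.n) (h1 : st.reg 1 = L.S) (h2 : st.reg 2 = B)
    (h3 : st.reg 3 = X) (h4 : st.reg 4 = r) (hvec : ∀ j < L.n, st.vec j = vecs r j)
    (hI : A.Ready mode g W L vecs B X (fun q => roundsDone B X q r) st.inst φ)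
    (hQ : ∀ st' φ', st'.reg 1 = L.S → st'.reg 2 = B → st'.reg 3 = X → st'.reg 4 = r + 1 →
      (∀ I < L.n, st'.ans I = rowHit L.n L.mat (vecs r) B X (X * X) I) →
      A.Ready mode g W L vecs B X (fun q => roundsDone B X q (r + 1)) st'.inst φ' → Q st' φ') :
    L.WP (A.roundProg mode g.beta)
      (X * X * (B * 28 + 39) + L.n * 3 + 7 + (B * B * 4 + 2) * L.n) Q st φ := by
  have hn := hL.n_lt
  have hcube := hL.cube_lt
  have hsq := hL.sq_le_cube
  have hXsq := hL.le_sq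
  have hX := hL.X_pos
  have hB : 0 < B := NeZero.pos B
  set C := B * B * 4 + 2 with hC
  set w := r / B with hw
  have hwr : w * B + r % B = r := Nat.div_add_mod' r B
  have hk : r % B < B := Nat.mod_lt r hB
  have hwX : w < X := hL.div_lt r hr
  have hwr' : w ≤ r := Nat.div_le_self _ _
  have hkr : r % B ≤ r := Nat.mod_le _ _
  have hwin : w * (X * X) + X * X ≤ X * X * X := by
    calc w * (X * X) + X * X = (w + 1) * (X * X) := by ring
      _ ≤ X * (X * X) := Nat.mul_le_mul_right _ hwX
      _ = X * X * X := by ring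
  -- The price of one scan for each of the `n` rows is borrowed in advance; after the answer is
  -- cleared all rows are unmarked.
  refine Layout.WP.of_credits ?_
  refine Layout.WP.mono_time
    (T := 1 + (1 + ((L.n * 3 + 2) + ((X * X * ((B * 28 + 37) + 2) + 2) + 1)))) ?_ (le_of_eq (by ring))
  refine Layout.WP.seq (Layout.WP.assign (by simp [h4, h2]; omega) ?_)
  refine Layout.WP.seq (Layout.WP.assign (by simp [St.reg_setReg_of_ne, h4, h2]; omega) ?_)
  refine Layout.WP.seq (wp_clearAns hn ?_)
  intro st₀ v₀ i₀ r₀ a₀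
  have g1 : st₀.reg 1 = L.S := by rw [r₀ 1 (by decide)]; simp [St.reg_setReg_of_ne, h1]
  have g2 : st₀.reg 2 = B := by rw [r₀ 2 (by decide)]; simp [St.reg_setReg_of_ne, h2]
  have g3 : st₀.reg 3 = X := by rw [r₀ 3 (by decide)]; simp [St.reg_setReg_of_ne, h3]
  have g4 : st₀.reg 4 = r := by rw [r₀ 4 (by decide)]; simp [St.reg_setReg_of_ne, h4]
  have g5 : st₀.reg 5 = w := by rw [r₀ 5 (by decide)]; simp [St.reg_setReg_of_ne, h4, h2, hw]
  have g6 : st₀.reg 6 = r % B := by rw [r₀ 6 (by decide)]; simp [St.reg_setReg_of_ne, h4, h2]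
  have gv : ∀ j < L.n, st₀.vec j = vecs r j := by rw [v₀]; exact hvec
  have gi : st₀.inst = st.inst := i₀
  rw [← gi] at hI
  have hun : st₀.unhit L.n = L.n := by
    rw [St.unhit, Finset.filter_true_of_mem, Finset.card_range]
    intro I hI
    exact a₀ I (Finset.mem_range.1 hI)
  -- Blocks with a number below the current one count as having done round `r`. This includes all
  -- earlier windows, for which `r` and `r + 1` give the same number of rounds.
  refine Layout.WP.seq (Layout.WP.forLoop (T := B * 28 + 37) (fun z st' φ' =>
      st'.reg 9 = z ∧ st'.reg 1 = L.S ∧ st'.reg 2 = B ∧ st'.reg 3 = X ∧ st'.reg 4 = r ∧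
      st'.reg 5 = w ∧ st'.reg 6 = r % B ∧ (∀ j < L.n, st'.vec j = vecs r j) ∧
      (∀ I < L.n, st'.ans I = rowHit L.n L.mat (vecs r) B X z I) ∧
      ∃ ψ, φ' = ψ + 3 * L.K * C * st'.unhit L.n ∧ A.Ready mode g W L vecs B X
        (fun q => roundsDone B X q (if q < w * (X * X) + z then r + 1 else r)) st'.inst ψ)
    (X * X) (by omega) ?_ ?_ ?_ ?_ ?_)
  · rintro z - st' φ' ⟨-, -, -, h, -⟩
    simp [h]
  · rintro z - st' φ' ⟨h, -⟩
    exact h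
  · rintro z hz st' φ' ⟨k9, k1, k2, k3, k4, k5, k6, kv, ka, ψ, rfl, hR⟩
    have hzX : z / X < X := (Nat.div_lt_iff_lt_mul hX).2 hz
    have hzm : z % X < X := Nat.mod_lt _ hX
    have hzd : z / X * X + z % X = z := Nat.div_add_mod' z X
    have hq : w * (X * X) + z < X * X * X := by omega
    have hqc : w * (X * X) + z < L.cnt := by rw [hL.cnt]; exact hq
    refine Layout.WP.mono_time (T := 1 + (1 + (1 + (B * 28 + 34)))) ?_ (by omega)
    refine Layout.WP.seq (Layout.WP.assign (by simp [k9, k3]; omega) ?_)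
    refine Layout.WP.seq (Layout.WP.assign (by simp [St.reg_setReg_of_ne, k9, k3]; omega) ?_)
    refine Layout.WP.seq (Layout.WP.assign ?_ ?_)
    · rw [eval_baseExpr (by simp [St.reg_setReg_of_ne, k1])]
      simpa [St.reg_setReg_of_ne, k9, k5, k3] using Layout.base_lt hL.valid hqc
    rw [eval_baseExpr (by simp [St.reg_setReg_of_ne, k1])]
    simp only [eval_add, eval_mul, eval_div, eval_mod, eval_reg, k9, k3]
    set st₁ := ((st'.setReg 7 (z / X)).setReg 8 _).setReg 0 _ with hst₁
    have t0 : st₁.reg 0 = L.base (w * (X * X) + z) := by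
      simp [hst₁, St.reg_setReg_of_ne, k5, k9, k3]
    have t1 : st₁.reg 1 = L.S := by simp [hst₁, St.reg_setReg_of_ne, k1]
    have t2 : st₁.reg 2 = B := by simp [hst₁, St.reg_setReg_of_ne, k2]
    have t3 : st₁.reg 3 = X := by simp [hst₁, St.reg_setReg_of_ne, k3]
    have t4 : st₁.reg 4 = r := by simp [hst₁, St.reg_setReg_of_ne, k4]
    have t5 : st₁.reg 5 = w := by simp [hst₁, St.reg_setReg_of_ne, k5]
    have t6 : st₁.reg 6 = r % B := by simp [hst₁, St.reg_setReg_of_ne, k6]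
    have t7 : st₁.reg 7 = z / X := by simp [hst₁, St.reg_setReg_of_ne]
    have t8 : st₁.reg 8 = z % X := by simp [hst₁, St.reg_setReg_of_ne, k9, k3]
    have t9 : st₁.reg 9 = z := by simp [hst₁, St.reg_setReg_of_ne, k9]
    have tv : st₁.vec = st'.vec := rfl
    have ta : st₁.ans = st'.ans := rfl
    have ti : st₁.inst = st'.inst := rfl
    have tu : st₁.unhit L.n = st'.unhit L.n := rfl
    clear_value st₁
    rw [← ti] at hR
    rw [← tu]
    obtain ⟨τ, ψ', rfl, hH, hback⟩ := hR.take hq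
    obtain ⟨b1, b2, b3⟩ := block_number (w := w) hz
    have hd0 : roundsDone B X (w * (X * X) + z) r = r % B := roundsDone_same hz 0 (by omega)
    have hd1 : roundsDone B X (w * (X * X) + z) (r + 1) = r % B + 1 :=
      roundsDone_same hz 1 (by omega)
    simp only [lt_irrefl, if_false, hd0] at hH
    have hdata : dataOf L.n L.mat vecs B X (w * (X * X) + z) =
        blockData L.n L.mat vecs B X w (z / X) (z % X) := by
      rw [dataOf, b1, b2, b3]
    simp only [hdata] at hH hback
    have hk' : r % B < (List.finRange B).length := by simpa using hk
    rw [List.drop_eq_getElem_cons hk', List.flatMap_cons, List.getElem_finRange] at hH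
    simp only [Fin.cast_mk] at hH
    have e : ψ' + 30 * τ + 3 * L.K * C * st₁.unhit L.n =
        ψ' + 3 * L.K * C * st₁.unhit L.n + 30 * τ := by ring
    rw [e]
    refine wp_blockRound hg hqc t0 hL.room hL.sq_lt hL.mat hvecs (w := w) (x := z / X)
      (y := z % X) hzm hL.div_lt (k := ⟨r % B, hk⟩) t2 t6 t7 t8 ?_ ?_ hH ?_
    · intro j hj
      simp only [hwr, tv]
      exact kv j hj
    · intro I hI
      simp only [hwr, hzd, ta]
      exact ka I hI
    · intro st₂ τ₂ v₂ r₂ i₂ hH₂ a₂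
      refine ⟨ψ' + 3 * L.K * C * st₂.unhit L.n + 30 * τ₂, le_rfl, (r₂ 9 (by decide)).trans t9,
        by simp, ?_, ?_, ?_, ?_, ?_, ?_, ?_, ?_, ψ' + 30 * τ₂, ?_, ?_⟩
      · simpa [St.reg_setReg_of_ne] using (r₂ 1 (by decide)).trans t1
      · simpa [St.reg_setReg_of_ne] using (r₂ 2 (by decide)).trans t2
      · simpa [St.reg_setReg_of_ne] using (r₂ 3 (by decide)).trans t3
      · simpa [St.reg_setReg_of_ne] using (r₂ 4 (by decide)).trans t4
      · simpa [St.reg_setReg_of_ne] using (r₂ 5 (by decide)).trans t5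
      · simpa [St.reg_setReg_of_ne] using (r₂ 6 (by decide)).trans t6
      · intro j hj
        rw [St.vec_setReg, v₂, tv]
        exact kv j hj
      · intro I hI
        have := a₂ I hI
        simp only [hwr, hzd] at this
        exact this
      · have : (st₂.setReg 9 (z + 1)).unhit L.n = st₂.unhit L.n := rfl
        rw [this]; ring
      · refine hback _ _ _ (fun q hq hqq => ?_) (fun q hqq => ?_) ?_
        · have : (q < w * (X * X) + (z + 1)) ↔ q < w * (X * X) + z := by omega
          simp only [this]
        · rw [St.inst_setReg]; exact i₂ q hqq
        · have : w * (X * X) + z < w * (X * X) + (z + 1) := by omega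
          simp only [this, if_true, hd1, St.inst_setReg]
          exact hH₂
  · refine ⟨by simp, by simpa [St.reg_setReg_of_ne] using g1,
      by simpa [St.reg_setReg_of_ne] using g2, by simpa [St.reg_setReg_of_ne] using g3,
      by simpa [St.reg_setReg_of_ne] using g4, by simpa [St.reg_setReg_of_ne] using g5,
      by simpa [St.reg_setReg_of_ne] using g6, gv, fun I hI => ?_, φ, ?_, ?_⟩
    · rw [rowHit_zero]; exact a₀ I hI
    · have : (st₀.setReg 9 0).unhit L.n = L.n := hun
      rw [this]; ring
    · refine hI.congr fun q hq => ?_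
      split_ifs with h
      · exact roundsDone_of_lt hB hX h
      · rfl
  · rintro st' φ' ⟨-, k1, k2, k3, k4, -, -, -, ka, ψ, rfl, hR⟩
    -- The credits of the rows that remain unmarked are dropped at the end of the round.
    refine Layout.WP.mono (Q := fun st' φ' => ∃ ψ ≤ φ', Q st' ψ) (Layout.WP.assign ?_ ?_) le_rfl
      fun _ _ h => h
    · simp [k4]; omega
    refine ⟨ψ, by omega, hQ _ _ (by simpa [St.reg_setReg_of_ne] using k1)
      (by simpa [St.reg_setReg_of_ne] using k2) (by simpa [St.reg_setReg_of_ne] using k3)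
      (by simp [k4]) ka ?_⟩
    refine hR.congr fun q hq => ?_
    split_ifs with h
    · rfl
    · exact roundsDone_of_ge hB hX (not_lt.1 h)

end DynFlowAlgorithm

section

/-! ### The program for the preprocessing -/

/-- Powers. -/
def powExpr (e : SrcExpr) : ℕ → SrcExpr
  | 0 => 1
  | c + 1 => powExpr e c * e

theorem eval_powExpr (L : Layout) (st : St) (e : SrcExpr) :
    ∀ c, (powExpr e c).eval L st = e.eval L st ^ c
  | 0 => rfl
  | c + 1 => by rw [powExpr, eval_mul, eval_powExpr L st e c, pow_succ]

/-- The size of a region. -/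
def regionSize (B c : ℕ) : ℕ := (B * 8 + 79 * (B * B) + 2) ^ c

/-- Compute the integral part of the cube root of the size. -/
def cubeRoot : RamProg :=
  assign 2 1 ;; forLoop 9 size
    (SrcExpr.branch (size.ltb ((reg 2 + 1) * (reg 2 + 1) * (reg 2 + 1))) .skip
      (assign 2 (reg 2 + 1)))

/-- Compute the parameters. -/
def setup (c : ℕ) : RamProg :=
  cubeRoot ;; assign 3 (size / reg 2 + 1) ;;
  assign 1 (powExpr (reg 2 * 8 + 79 * (reg 2 * reg 2) + 2) c) ;; assign 4 0

namespace DynFlowAlgorithm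

/-- Compute the parameters and initialize all regions. -/
def preProg (A : DynFlowAlgorithm) (mode : DynMode) (β c : ℕ) : RamProg :=
  setup c ;;
  forLoop 9 (reg 3 * reg 3 * reg 3)
    (assign 0 (baseExpr (reg 9)) ;; assign 7 (reg 9 % (reg 3 * reg 3) / reg 3) ;;
      assign 8 (reg 9 % reg 3) ;; A.initBlock mode β)

end DynFlowAlgorithm

variable {B : ℕ} [NeZero B] {L : Layout} {st : St} {φ : ℕ} {Q : St → ℕ → Prop}

/-- The register holds `min (i + 1) B` after `i` iterations, and `B ≤ n` iterations suffice. -/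
theorem wp_cubeRoot (hnV : L.n + 1 < L.V) (hB : B * B * B ≤ L.n)
    (hB' : L.n < (B + 1) * (B + 1) * (B + 1))
    (hQ : ∀ st', st'.inst = st.inst → st'.reg 2 = B → Q st' φ) :
    L.WP cubeRoot (L.n * 4 + 3) Q st φ := by
  have hB0 : 0 < B := NeZero.pos B
  have hBn : B ≤ L.n :=
    (Nat.le_mul_of_pos_right B (Nat.mul_pos hB0 hB0)).trans (by rwa [← mul_assoc])
  refine Layout.WP.mono_time (T := 1 + (L.n * (2 + 2) + 2)) ?_ (by omega)
  refine Layout.WP.seq (Layout.WP.assign (by simp; omega) ?_)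
  refine Layout.WP.forLoop (fun i st' φ' => φ' = φ ∧ st'.reg 9 = i ∧ st'.inst = st.inst ∧
    st'.reg 2 = min (i + 1) B) L.n (by omega) ?_ ?_ ?_ ?_ ?_
  · intros; rfl
  · rintro i - st' φ' ⟨-, h, -⟩
    exact h
  · rintro i hi st' φ' ⟨rfl, h9, hin, h2⟩
    have hcond : (size.ltb ((reg 2 + 1) * (reg 2 + 1) * (reg 2 + 1))).eval L st' ≠ 0 ↔
        B ≤ i + 1 := by
      simp only [eval_ltb, eval_size, eval_mul, eval_add, eval_reg, eval_one, ltNat_ne_zero, h2]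
      constructor
      · intro h
        by_contra hlt
        have hle : min (i + 1) B + 1 ≤ B := by omega
        have := Nat.mul_le_mul (Nat.mul_le_mul hle hle) hle
        omega
      · intro h
        rwa [min_eq_right h]
    refine Layout.WP.branch (T := 1) (fun h => Layout.WP.skip ?_)
      (fun h => Layout.WP.assign ?_ ?_)
    · have := hcond.1 h
      refine ⟨h9, rfl, by simp, hin, ?_⟩
      rw [St.reg_setReg_of_ne _ (by decide), h2]
      omega
    · simp [h2]; omega
    · have : ¬ B ≤ i + 1 := fun h' => hcond.2 h' h
      refine ⟨by simpa [St.reg_setReg_of_ne] using h9, rfl, by simp, hin, ?_⟩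
      rw [St.reg_setReg_of_ne _ (by decide)]
      simp only [St.reg_setReg, eval_add, eval_reg, h2, eval_one]
      omega
  · refine ⟨rfl, by simp, rfl, ?_⟩
    rw [St.reg_setReg_of_ne _ (by decide)]
    simp; omega
  · rintro st' φ' ⟨rfl, -, hin, h2⟩
    exact hQ st' hin (by omega)

theorem wp_setup (hnV : L.n + 1 < L.V) (hSV : L.S < L.V) (hB : B * B * B ≤ L.n)
    (hB' : L.n < (B + 1) * (B + 1) * (B + 1)) {c X : ℕ} (hX : X = L.n / B + 1)
    (hS : L.S = regionSize B c)
    (hQ : ∀ st', st'.inst = st.inst → st'.reg 1 = L.S → st'.reg 2 = B → st'.reg 3 = X →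
      st'.reg 4 = 0 → Q st' φ) :
    L.WP (setup c) (L.n * 4 + 6) Q st φ := by
  refine Layout.WP.mono_time (T := (L.n * 4 + 3) + (1 + (1 + 1))) ?_ (by omega)
  refine Layout.WP.seq (wp_cubeRoot hnV hB hB' fun st' hin h2 => ?_)
  have hXV : L.n / B + 1 < L.V := by have := Nat.div_le_self L.n B; omega
  refine Layout.WP.seq (Layout.WP.assign (by simpa [h2] using hXV) ?_)
  have hSe : (powExpr (reg 2 * 8 + 79 * (reg 2 * reg 2) + 2) c).eval L
      (st'.setReg 3 ((size / reg 2 + 1).eval L st')) = L.S := by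
    rw [eval_powExpr, hS, regionSize]
    simp [St.reg_setReg_of_ne, h2]
  refine Layout.WP.seq (Layout.WP.assign (by rwa [hSe]) ?_)
  rw [hSe]
  refine Layout.WP.assign (by simp; omega) (hQ _ hin ?_ ?_ ?_ ?_)
  · simp [St.reg_setReg_of_ne]
  · simp [St.reg_setReg_of_ne, h2]
  · simp [St.reg_setReg_of_ne, h2, hX]
  · simp

namespace DynFlowAlgorithm

variable {A : DynFlowAlgorithm} {mode : DynMode} {g : GraphClass} {W X c : ℕ} {vecs : ℕ → ℕ → ℕ}

/-- A region is as large as the word bound of its instance, which may exceed the available time by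
far. It need not be cleared: by `hz` the regions are zero until they are initialized, as `initMem`
requires outside its input. -/
theorem wp_preProg (hL : L.Fit W B X) (hg : ∀ k, g = .weightedUndirected k → 1 ≤ k)
    (hvecs : ∀ r j, vecs r j ≤ 1) (hnV : L.n + 1 < L.V) (hSV : L.S < L.V) (hB : B * B * B ≤ L.n)
    (hB' : L.n < (B + 1) * (B + 1) * (B + 1)) (hX : X = L.n / B + 1)
    (hS : L.S = regionSize B c) (hz : ∀ q a, st.inst q a = 0)
    {μ : ℕ → RamMem} {τ₀ τ₁ : ℕ → ℕ}
    (hI : ∀ q < X * X * X, RamExec W A.init (initMem (startCap B g mode) (vx 0 0) (vx 1 0)) (μ q)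
      (τ₀ q))
    (hH : ∀ q < X * X * X, A.Handles g W (vx 0 0) (vx 1 0) (startCap B g mode) (μ q)
      ((dataOf L.n L.mat vecs B X q).reqs mode g) (τ₁ q))
    (hQ : ∀ st' φ', st'.reg 1 = L.S → st'.reg 2 = B → st'.reg 3 = X → st'.reg 4 = 0 →
      A.Ready mode g W L vecs B X (fun q => roundsDone B X q 0) st'.inst φ' → Q st' φ') :
    L.WP (A.preProg mode g.beta c)
      (L.n * 4 + 8 + X * X * X * (B * 8 * (B * 8) * 16 + 12)) Q st
      (30 * ∑ q ∈ Finset.range (X * X * X), (τ₀ q + τ₁ q)) := by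
  have hcube := hL.cube_lt
  have hsq := hL.sq_le_cube
  have hXsq := hL.le_sq
  have hX0 := hL.X_pos
  refine Layout.WP.mono_time
    (T := (L.n * 4 + 6) + (X * X * X * ((B * 8 * (B * 8) * 16 + 10) + 2) + 2)) ?_
    (le_of_eq (by ring))
  refine Layout.WP.seq (wp_setup hnV hSV hB hB' hX hS ?_)
  intro st₀ i₀ g1 g2 g3 g4
  refine Layout.WP.forLoop (fun i st' φ' => st'.reg 9 = i ∧ st'.reg 1 = L.S ∧ st'.reg 2 = B ∧
      st'.reg 3 = X ∧ st'.reg 4 = 0 ∧ (∀ q, i ≤ q → ∀ a, st'.inst q a = 0) ∧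
      ∃ τ : ℕ → ℕ, φ' = 30 * ∑ q ∈ Finset.range (X * X * X), τ q ∧
        (∀ q, i ≤ q → τ q = τ₀ q + τ₁ q) ∧ ∀ q < i, A.Handles g W (vx 0 0) (vx 1 0)
          ((dataOf L.n L.mat vecs B X q).netAt mode g 0).cap (st'.inst q)
          ((List.finRange B).flatMap ((dataOf L.n L.mat vecs B X q).roundReqs mode g)) (τ q))
    (X * X * X) hcube ?_ ?_ ?_ ?_ ?_
  · rintro i - st' φ' ⟨-, -, -, h, -⟩
    simp [h]
  · rintro i - st' φ' ⟨h, -⟩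
    exact h
  · rintro q hq st' φ' ⟨k9, k1, k2, k3, k4, kz, τ, rfl, kτ, kH⟩
    have hqc : q < L.cnt := by rw [hL.cnt]; exact hq
    have hmod : q % (X * X) < X * X := Nat.mod_lt _ (Nat.mul_pos hX0 hX0)
    have hdiv : q % (X * X) / X ≤ q % (X * X) := Nat.div_le_self _ _
    have hmod' : q % X < X := Nat.mod_lt _ hX0
    refine Layout.WP.mono_time (T := 1 + (1 + (1 + (B * 8 * (B * 8) * 16 + 7)))) ?_ (by omega)
    refine Layout.WP.seq (Layout.WP.assign ?_ ?_)
    · rw [eval_baseExpr k1]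
      simpa [k9] using Layout.base_lt hL.valid hqc
    rw [eval_baseExpr k1]
    refine Layout.WP.seq (Layout.WP.assign (by simp [St.reg_setReg_of_ne, k9, k3]; omega) ?_)
    refine Layout.WP.seq (Layout.WP.assign (by simp [St.reg_setReg_of_ne, k9, k3]; omega) ?_)
    simp only [eval_div, eval_mul, eval_mod, eval_reg]
    set st₁ := ((st'.setReg 0 _).setReg 7 _).setReg 8 _ with hst₁
    have t0 : st₁.reg 0 = L.base q := by simp [hst₁, St.reg_setReg_of_ne, k9]
    have t1 : st₁.reg 1 = L.S := by simp [hst₁, St.reg_setReg_of_ne, k1]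
    have t2 : st₁.reg 2 = B := by simp [hst₁, St.reg_setReg_of_ne, k2]
    have t3 : st₁.reg 3 = X := by simp [hst₁, St.reg_setReg_of_ne, k3]
    have t4 : st₁.reg 4 = 0 := by simp [hst₁, St.reg_setReg_of_ne, k4]
    have t7 : st₁.reg 7 = q % (X * X) / X := by simp [hst₁, St.reg_setReg_of_ne, k9, k3]
    have t8 : st₁.reg 8 = q % X := by simp [hst₁, St.reg_setReg_of_ne, k9, k3]
    have t9 : st₁.reg 9 = q := by simp [hst₁, St.reg_setReg_of_ne, k9]
    have ti : st₁.inst = st'.inst := rfl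
    clear_value st₁
    have hmem : q ∈ Finset.range (X * X * X) := Finset.mem_range.2 hq
    have e : 30 * ∑ q ∈ Finset.range (X * X * X), τ q =
        30 * ∑ q ∈ (Finset.range (X * X * X)).erase q, τ q + 30 * (τ₀ q + τ₁ q) := by
      rw [← kτ q le_rfl, ← Finset.sum_erase_add _ _ hmem, Nat.mul_add]
    rw [e]
    refine wp_initBlock (rest := (List.finRange B).flatMap
      ((dataOf L.n L.mat vecs B X q).roundReqs mode g)) hg hqc t0 hL.room vecs X (q / (X * X))
      (blockData_bounded hL.mat hvecs _ _ _ _ _) t2 t7 t8 (by rw [ti]; exact kz q le_rfl)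
      (hI q hq) (hH q hq) ?_
    intro st₂ τ₂ ag hH₂
    refine ⟨(ag.reg 9 (by decide)).trans t9, by simp, ?_, ?_, ?_, ?_, ?_,
      Function.update τ q τ₂, ?_, ?_, ?_⟩
    · simpa [St.reg_setReg_of_ne] using (ag.reg 1 (by decide)).trans t1
    · simpa [St.reg_setReg_of_ne] using (ag.reg 2 (by decide)).trans t2
    · simpa [St.reg_setReg_of_ne] using (ag.reg 3 (by decide)).trans t3
    · simpa [St.reg_setReg_of_ne] using (ag.reg 4 (by decide)).trans t4
    · intro q' hq' a
      rw [St.inst_setReg, ag.inst q' (by omega), ti]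
      exact kz q' (by omega) a
    · rw [← Finset.sum_erase_add _ _ hmem, Nat.mul_add, Function.update_self]
      congr 2
      refine Finset.sum_congr rfl fun q' hq' => ?_
      rw [Function.update_of_ne (Finset.ne_of_mem_erase hq')]
    · intro q' hq'
      rw [Function.update_of_ne (by omega)]
      exact kτ q' (by omega)
    · intro q' hq'
      rw [St.inst_setReg]
      by_cases hqq : q' = q
      · subst hqq
        rw [Function.update_self]
        exact hH₂
      · rw [Function.update_of_ne hqq, ag.inst q' hqq, ti]
        exact kH q' (by omega)
  · refine ⟨by simp, by simpa [St.reg_setReg_of_ne] using g1,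
      by simpa [St.reg_setReg_of_ne] using g2, by simpa [St.reg_setReg_of_ne] using g3,
      by simpa [St.reg_setReg_of_ne] using g4, fun q _ a => ?_, fun q => τ₀ q + τ₁ q, rfl,
      fun q _ => rfl, fun q hq => absurd hq (by omega)⟩
    rw [St.inst_setReg, i₀]
    exact hz q a
  · rintro st' φ' ⟨-, k1, k2, k3, k4, -, τ, rfl, -, kH⟩
    refine hQ st' _ k1 k2 k3 k4 ⟨τ, rfl, fun q hq => ?_⟩
    have h0 : roundsDone B X q 0 = 0 := by simp [roundsDone]
    simp only [h0, Nat.mul_zero, List.drop_zero]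
    exact kH q hq

end DynFlowAlgorithm

end

/-! ### The algorithm for online matrix-vector multiplication -/

theorem DynFlowAlgorithm.Handles.mono {A : DynFlowAlgorithm} {g : GraphClass} {W W' n : ℕ}
    {s t : Fin n} (hW : W ≤ W') : ∀ {rs : List (FlowRequest n)} {cap : Network n} {m : RamMem}
    {T : ℕ}, A.Handles g W s t cap m rs T → A.Handles g W' s t cap m rs T
  | [], _, _, _, h => h
  | _ :: _, _, _, _, ⟨m', τ, T', h1, h2, h3, h4⟩ => ⟨m', τ, T', h1.mono hW, h2, h3.mono hW, h4⟩

/-- The matrix as a sequence of numbers. -/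
def matSeq {n : ℕ} (M : Fin n → Fin n → Bool) : ℕ → ℕ :=
  Network.entry fun i j => (M i j).toNat

/-- The vectors as sequences of numbers. -/
def vecSeq {n : ℕ} (v : Fin n → Fin n → Bool) (r j : ℕ) : ℕ :=
  if h : r < n ∧ j < n then (v ⟨r, h.1⟩ ⟨j, h.2⟩).toNat else 0

theorem matSeq_le_one {n : ℕ} (M : Fin n → Fin n → Bool) (a : ℕ) : matSeq M a ≤ 1 := by
  unfold matSeq Network.entry
  split
  · exact Bool.toNat_le _
  · omega

theorem vecSeq_le_one {n : ℕ} (v : Fin n → Fin n → Bool) (r j : ℕ) : vecSeq v r j ≤ 1 := by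
  unfold vecSeq
  split
  · exact Bool.toNat_le _
  · omega

theorem matSeq_eq {n : ℕ} (M : Fin n → Fin n → Bool) (i j : Fin n) :
    matSeq M (i * n + j) = (M i j).toNat := by
  have h1 : ((finProdFinEquiv (i, j) : Fin (n * n)) : ℕ) = i * n + j := by
    rw [finProdFinEquiv_apply_val]; ring
  have h2 := finProdFinEquiv.symm_apply_apply (i, j)
  rw [← h1, matSeq, Network.entry_eq]
  have h3 : (finProdFinEquiv (i, j)).divNat = i := congrArg Prod.fst h2
  have h4 : (finProdFinEquiv (i, j)).modNat = j := congrArg Prod.snd h2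
  rw [h3, h4]

theorem OMvAlgorithm.initMem_eq {n : ℕ} (M : Fin n → Fin n → Bool) (a : ℕ) :
    OMvAlgorithm.initMem n M a = if 1 ≤ a ∧ a - 1 < n * n then matSeq M (a - 1) else
      if a = 0 then n else 0 := by
  unfold OMvAlgorithm.initMem RamMem.writeMatrix RamMem.writeArray
  by_cases h : 1 ≤ a ∧ a - 1 < n * n
  · rw [dif_pos h, if_pos h, matSeq, Network.entry, dif_pos h.2]
  · rw [dif_neg h, if_neg h]
    simp only [Function.update_apply]

/-- The state at the beginning. -/
def St.init : St := ⟨fun _ => 0, fun _ => 0, fun _ => 0, fun _ _ => 0⟩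

namespace Layout

variable {L : Layout}

theorem rep_init {n : ℕ} (M : Fin n → Fin n → Bool) (hn : L.n = n) (hm : L.mat = matSeq M)
    (hV : n + 1 < L.V) : L.Rep (OMvAlgorithm.initMem n M) St.init := by
  subst hn
  have hzero : ∀ a, 1 + L.n * L.n ≤ a → OMvAlgorithm.initMem L.n M a = 0 := by
    intro a ha
    rw [OMvAlgorithm.initMem_eq, if_neg (by omega), if_neg (by omega)]
  refine ⟨?_, ?_, ?_, ?_, ?_, ?_, ?_⟩
  · rw [OMvAlgorithm.initMem_eq]; simp
  · intro a ha
    rw [OMvAlgorithm.initMem_eq, if_pos (by omega), hm, Nat.add_sub_cancel_left]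
  · exact fun a _ => hzero _ (by omega)
  · exact fun a _ => hzero _ (by omega)
  · exact fun r => hzero _ (by omega)
  · exact fun q _ a _ => hzero _ (by unfold base off; omega)
  · intro a
    rw [OMvAlgorithm.initMem_eq]
    have := matSeq_le_one M (a - 1)
    split_ifs <;> omega

theorem Rep.receive {m : RamMem} {st : St} (h : L.Rep m st) {n : ℕ} (hn : L.n = n) (hV : 1 < L.V)
    (v : Fin n → Bool) :
    L.Rep (OMvAlgorithm.receive n v m)
      { st with vec := fun j => if h : j < n then (v ⟨j, h⟩).toNat else 0 } := by
  subst hn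
  have hout : ∀ a, (a < 1 + L.n * L.n ∨ 1 + L.n * L.n + L.n ≤ a) →
      OMvAlgorithm.receive L.n v m a = m a := by
    intro a ha
    unfold OMvAlgorithm.receive RamMem.writeArray
    rw [dif_neg (by omega)]
  refine ⟨?_, ?_, ?_, ?_, ?_, ?_, ?_⟩
  · rw [hout _ (by omega)]; exact h.size
  · intro a ha
    rw [hout _ (by omega)]; exact h.mat a ha
  · intro a ha
    unfold OMvAlgorithm.receive RamMem.writeArray
    simp [ha]
  · intro a ha
    rw [hout _ (by omega)]; exact h.ans a ha
  · intro r
    rw [hout _ (by omega)]; exact h.reg r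
  · intro q hq a ha
    rw [hout _ (by unfold base off; omega)]; exact h.inst q hq a ha
  · intro a
    unfold OMvAlgorithm.receive RamMem.writeArray
    split
    · exact lt_of_le_of_lt (Bool.toNat_le _) hV
    · exact h.bdd a

end Layout

/-- All block numbers are below `X * X`, so after the last block the restriction to visited blocks
is void. -/
theorem rowHit_all {n : ℕ} (M : Fin n → Fin n → Bool) (v : Fin n → Fin n → Bool) {B X : ℕ}
    (hX : ∀ J < n, J / B < X) (r i : Fin n) :
    rowHit n (matSeq M) (vecSeq v r) B X (X * X) i = 1 ↔ ∃ j, M i j = true ∧ v r j = true := by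
  have hz : ∀ J < n, (i : ℕ) / B * X + J / B < X * X := by
    intro J hJ
    calc (i : ℕ) / B * X + J / B < (i : ℕ) / B * X + X := by have := hX J hJ; omega
      _ = ((i : ℕ) / B + 1) * X := by ring
      _ ≤ X * X := Nat.mul_le_mul_right _ (hX i i.2)
  unfold rowHit
  simp only [ite_eq_left_iff, zero_ne_one, imp_false, not_not]
  constructor
  · rintro ⟨J, hJ, -, h1, h2⟩
    refine ⟨⟨J, hJ⟩, ?_, ?_⟩
    · rw [matSeq_eq M i ⟨J, hJ⟩] at h1
      simpa using h1
    · simpa [vecSeq, hJ] using h2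
  · rintro ⟨j, h1, h2⟩
    refine ⟨j, j.2, hz j j.2, ?_, ?_⟩
    · rw [matSeq_eq M i j, h1]; decide
    · simp [vecSeq, h2]

namespace DynFlowAlgorithm

variable {A : DynFlowAlgorithm} {mode : DynMode} {g : GraphClass} {W B X : ℕ} [NeZero B]
  {L : Layout}

/-- The algorithm that is obtained from a dynamic flow algorithm. -/
def toOMv (A : DynFlowAlgorithm) (mode : DynMode) (g : GraphClass) (c : ℕ) : OMvAlgorithm where
  preprocess := A.preProg mode g.beta c
  round := A.roundProg mode g.beta

/-- Induction on the number of vectors still to come. All vectors occur in the invariant, through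
the requests that the data structures are able to handle, but the program is only given the vector
that has arrived. -/
theorem answers {n : ℕ} (M : Fin n → Fin n → Bool) (v : Fin n → Fin n → Bool) (hn : L.n = n)
    (hM : L.mat = matSeq M) (hL : L.Fit W B X) (hg : ∀ k, g = .weightedUndirected k → 1 ≤ k)
    (c : ℕ) (hK : (A.roundProg mode g.beta).weight ≤ L.K) :
    ∀ (d r : ℕ), r + d = n → ∀ (m : RamMem) (st : St) (φ : ℕ), L.Rep m st → st.reg 1 = L.S →
      st.reg 2 = B → st.reg 3 = X → st.reg 4 = r →
      A.Ready mode g W L (vecSeq v) B X (fun q => roundsDone B X q r) st.inst φ →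
      ∃ T, (A.toOMv mode g c).Answers L.W M m ((List.ofFn v).drop r) T ∧
        T ≤ d * (3 * L.K * (X * X * (B * 28 + 39) + n * 3 + 7 + (B * B * 4 + 2) * n)) + φ := by
  intro d
  induction d with
  | zero =>
    intro r hr m st φ _ _ _ _ _ _
    exact ⟨0, by rw [List.drop_of_length_le (by simp; omega)]; rfl, Nat.zero_le _⟩
  | succ d ih =>
    intro r hr m st φ hm h1 h2 h3 h4 hR
    have hrn : r < n := by omega
    have hV : 1 < L.V := by have := hL.sq_lt; omega
    have hrec := hm.receive hn hV (v ⟨r, hrn⟩)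
    have hwp := wp_roundProg (A := A) (mode := mode) (L := L) (φ := φ)
      (st := { st with vec := fun j => if h : j < n then (v ⟨r, hrn⟩ ⟨j, h⟩).toNat else 0 })
      (Q := fun st' φ' => st'.reg 1 = L.S ∧ st'.reg 2 = B ∧ st'.reg 3 = X ∧ st'.reg 4 = r + 1 ∧
        (∀ I < L.n, st'.ans I = rowHit L.n L.mat (vecSeq v r) B X (X * X) I) ∧
        A.Ready mode g W L (vecSeq v) B X (fun q => roundsDone B X q (r + 1)) st'.inst φ')
      hL hg (vecSeq_le_one v) (r := r) (by omega) h1 h2 h3 h4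
      (fun j hj => by
        have hj' : j < n := by omega
        simp [vecSeq, hrn, hj'])
      hR (fun st' φ' a b c d e f => ⟨a, b, c, d, e, f⟩)
    obtain ⟨m', t, st', φ', he, hr', ⟨k1, k2, k3, k4, ka, kR⟩, ht⟩ := hwp hL.valid hK _ hrec
    obtain ⟨T', hT', hle⟩ := ih (r + 1) (by omega) m' st' φ' hr' k1 k2 k3 k4 kR
    refine ⟨t + T', ?_, ?_⟩
    · rw [List.drop_eq_getElem_cons (by simpa using hrn), List.getElem_ofFn]
      refine ⟨m', t, T', he, fun i => ?_, hT', rfl⟩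
      have hi : (i : ℕ) < L.n := by omega
      have h5 : m' (1 + n * n + n + i) = rowHit n (matSeq M) (vecSeq v r) B X (X * X) i := by
        have h6 := hr'.ans i hi
        rw [ka i hi, hM] at h6
        simpa only [hn] using h6
      have h7 := rowHit_all M v (B := B) (X := X) (by rw [← hn]; exact hL.div_lt) ⟨r, hrn⟩ i
      have h8 := rowHit_le_one n (matSeq M) (vecSeq v r) B X (X * X) i
      rw [h5]
      refine ⟨fun h => h7.2 h, fun h => ?_⟩
      have : rowHit n (matSeq M) (vecSeq v r) B X (X * X) i ≠ 1 := fun h' => h (h7.1 h')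
      omega
    · rw [hn] at ht
      rw [Nat.add_mul, one_mul]
      omega

theorem solves {n : ℕ} (M : Fin n → Fin n → Bool) (v : Fin n → Fin n → Bool) (hn : L.n = n)
    (hM : L.mat = matSeq M) (hL : L.Fit W B X) (hg : ∀ k, g = .weightedUndirected k → 1 ≤ k)
    {c : ℕ} (hK : (A.roundProg mode g.beta).weight ≤ L.K)
    (hK' : (A.preProg mode g.beta c).weight ≤ L.K) (hnV : n + 1 < L.V) (hSV : L.S < L.V)
    (hB : B * B * B ≤ n) (hB' : n < (B + 1) * (B + 1) * (B + 1)) (hX : X = n / B + 1)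
    (hS : L.S = regionSize B c) {μ : ℕ → RamMem} {τ₀ τ₁ : ℕ → ℕ}
    (hI : ∀ q < X * X * X, RamExec W A.init (initMem (startCap B g mode) (vx 0 0) (vx 1 0)) (μ q)
      (τ₀ q))
    (hH : ∀ q < X * X * X, A.Handles g W (vx 0 0) (vx 1 0) (startCap B g mode) (μ q)
      ((dataOf n (matSeq M) (vecSeq v) B X q).reqs mode g) (τ₁ q)) :
    ∃ m t T, RamExec L.W (A.toOMv mode g c).preprocess (OMvAlgorithm.initMem n M) m t ∧
      (A.toOMv mode g c).Answers L.W M m (List.ofFn v) T ∧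
      t + T ≤ 3 * L.K * (n * 4 + 8 + X * X * X * (B * 8 * (B * 8) * 16 + 12)) +
        n * (3 * L.K * (X * X * (B * 28 + 39) + n * 3 + 7 + (B * B * 4 + 2) * n)) +
        30 * ∑ q ∈ Finset.range (X * X * X), (τ₀ q + τ₁ q) := by
  subst hn
  rw [← hM] at hH
  have hwp := wp_preProg (A := A) (mode := mode) (L := L) (st := St.init)
    (Q := fun st' φ' => st'.reg 1 = L.S ∧ st'.reg 2 = B ∧ st'.reg 3 = X ∧ st'.reg 4 = 0 ∧
      A.Ready mode g W L (vecSeq v) B X (fun q => roundsDone B X q 0) st'.inst φ')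
    hL hg (vecSeq_le_one v) hnV hSV hB hB' hX hS (fun _ _ => rfl) hI hH
    (fun st' φ' a b c d e => ⟨a, b, c, d, e⟩)
  obtain ⟨m', t, st', φ', he, hr', ⟨k1, k2, k3, k4, kR⟩, ht⟩ :=
    hwp hL.valid hK' _ (Layout.rep_init M rfl hM hnV)
  obtain ⟨T, hT, hle⟩ := answers M v rfl hM hL hg c hK L.n 0 (by omega) m' st' φ' hr' k1 k2 k3 k4 kR
  refine ⟨m', t, T, he, by simpa using hT, by omega⟩

end DynFlowAlgorithm

/-! ### The running time -/

theorem exists_cubeRoot (n : ℕ) : ∃ B, B * B * B ≤ n ∧ n < (B + 1) * (B + 1) * (B + 1) := by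
  induction n with
  | zero => exact ⟨0, by norm_num, by norm_num⟩
  | succ n ih =>
    obtain ⟨B, h1, h2⟩ := ih
    by_cases h : (B + 1) * (B + 1) * (B + 1) ≤ n + 1
    · exact ⟨B + 1, h, by nlinarith⟩
    · exact ⟨B, by omega, by omega⟩

/-- With `n = y ^ 3` the overhead terms become integral powers of `y`. -/
theorem exists_real_cubeRoot {n : ℕ} (hn : 1 ≤ n) (ε : ℝ) :
    ∃ y : ℝ, 1 ≤ y ∧ (n : ℝ) = y ^ 3 ∧ (n : ℝ) ^ (3 - ε / 3) = y ^ (9 - ε) := by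
  have hn0 : (0 : ℝ) ≤ n := Nat.cast_nonneg n
  refine ⟨(n : ℝ) ^ (1 / 3 : ℝ), Real.one_le_rpow (Nat.one_le_cast.2 hn) (by norm_num), ?_, ?_⟩
  · rw [← Real.rpow_natCast, ← Real.rpow_mul hn0]; norm_num
  · rw [← Real.rpow_mul hn0, show (1 / 3 : ℝ) * (9 - ε) = 3 - ε / 3 by ring]

/-- The terms of order `y ^ 8` are the initialization `X³ * B²`, the updates `n * X² * B` and the
scans `n * B² * n`. -/
theorem overhead_le {n B X : ℕ} {y : ℝ} (hy : 1 ≤ y) (hn : (n : ℝ) = y ^ 3) (hB : (B : ℝ) ≤ y)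
    (hX : (X : ℝ) ≤ 3 * y ^ 2) :
    (((n * 4 + 8 + X * X * X * (B * 8 * (B * 8) * 16 + 12)) +
      n * (X * X * (B * 28 + 39) + n * 3 + 7 + (B * B * 4 + 2) * n) : ℕ) : ℝ) ≤ 40000 * y ^ 8 := by
  have hp : ∀ k, k ≤ 8 → y ^ k ≤ y ^ 8 := fun k hk => pow_le_pow_right₀ hy hk
  have p0 := hp 0 (by omega)
  have p3 := hp 3 (by omega)
  have p6 := hp 6 (by omega)
  have p7 := hp 7 (by omega)
  push_cast
  rw [hn]
  calc (y ^ 3 * 4 + 8 + (X : ℝ) * X * X * (B * 8 * (B * 8) * 16 + 12)) +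
        y ^ 3 * (X * X * (B * 28 + 39) + y ^ 3 * 3 + 7 + (B * B * 4 + 2) * y ^ 3)
      ≤ (y ^ 3 * 4 + 8 + (3 * y ^ 2) * (3 * y ^ 2) * (3 * y ^ 2) * (y * 8 * (y * 8) * 16 + 12)) +
        y ^ 3 * ((3 * y ^ 2) * (3 * y ^ 2) * (y * 28 + 39) + y ^ 3 * 3 + 7 +
          (y * y * 4 + 2) * y ^ 3) := by gcongr
    _ = 27904 * y ^ 8 + 8 * y ^ 0 + 351 * y ^ 7 + 329 * y ^ 6 + 11 * y ^ 3 := by ring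
    _ ≤ 40000 * y ^ 8 := by nlinarith

/-- The parameters in terms of the cube root. -/
theorem parameters_le {n B : ℕ} {y : ℝ} (hy1 : 1 ≤ y) (hyn : (n : ℝ) = y ^ 3) (hB0 : 1 ≤ B)
    (hB : B * B * B ≤ n) (hB' : n < (B + 1) * (B + 1) * (B + 1)) :
    (B : ℝ) ≤ y ∧ ((n / B + 1 : ℕ) : ℝ) ≤ 3 * y ^ 2 := by
  have hy0 : 0 < y := by linarith
  have h1 : (B : ℝ) ^ 3 ≤ y ^ 3 := by
    rw [← hyn]
    calc (B : ℝ) ^ 3 = ((B * B * B : ℕ) : ℝ) := by push_cast; ring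
      _ ≤ n := Nat.cast_le.2 hB
  have h2 : y ^ 3 ≤ (2 * (B : ℝ)) ^ 3 := by
    rw [← hyn]
    have : n ≤ (2 * B) * (2 * B) * (2 * B) :=
      hB'.le.trans (Nat.mul_le_mul (Nat.mul_le_mul (by omega) (by omega)) (by omega))
    calc (n : ℝ) ≤ (((2 * B) * (2 * B) * (2 * B) : ℕ) : ℝ) := Nat.cast_le.2 this
      _ = (2 * (B : ℝ)) ^ 3 := by push_cast; ring
  have hBy : (B : ℝ) ≤ y := le_of_pow_le_pow_left₀ (by norm_num) hy0.le h1
  have hyB : y ≤ 2 * (B : ℝ) := le_of_pow_le_pow_left₀ (by norm_num) (by positivity) h2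
  refine ⟨hBy, ?_⟩
  have hB0' : (0 : ℝ) < B := Nat.cast_pos.2 hB0
  have h4 : ((n / B : ℕ) : ℝ) ≤ (n : ℝ) / B := Nat.cast_div_le
  have h5 : (n : ℝ) / B ≤ 2 * y ^ 2 := by
    rw [div_le_iff₀ hB0', hyn]
    have := mul_le_mul_of_nonneg_left hyB (sq_nonneg y)
    linarith [show y ^ 3 = y ^ 2 * y by ring, show 2 * y ^ 2 * (B : ℝ) = y ^ 2 * (2 * B) by ring]
  have h6 : 1 ≤ y ^ 2 := one_le_pow₀ hy1
  push_cast
  linarith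

/-- The time for all data structures. -/
theorem sum_runs_le {B X : ℕ} {y C ε : ℝ} (hy1 : 1 ≤ y) (hC : 0 ≤ C) (hε : 0 < ε) (hε1 : ε ≤ 1)
    (hBy : (B : ℝ) ≤ y) (hXy : (X : ℝ) ≤ 3 * y ^ 2) {σ : ℕ → ℕ}
    (hσ : ∀ q, (σ q : ℝ) ≤ C * (151 * (B : ℝ) ^ 2) * ((B * 8 : ℕ) : ℝ) ^ (1 - ε)) :
    ((∑ q ∈ Finset.range (X * X * X), σ q : ℕ) : ℝ) ≤ 27 * (C * 151 * 8) * y ^ (9 - ε) := by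
  have hy0 : 0 < y := by linarith
  have hpow : ((B * 8 : ℕ) : ℝ) ^ (1 - ε) ≤ 8 * y ^ (1 - ε) := by
    calc ((B * 8 : ℕ) : ℝ) ^ (1 - ε) ≤ (8 * y) ^ (1 - ε) := by
          refine Real.rpow_le_rpow (Nat.cast_nonneg _) ?_ (by linarith)
          push_cast
          linarith
      _ = (8 : ℝ) ^ (1 - ε) * y ^ (1 - ε) := Real.mul_rpow (by norm_num) hy0.le
      _ ≤ 8 * y ^ (1 - ε) := by
          gcongr
          calc (8 : ℝ) ^ (1 - ε) ≤ (8 : ℝ) ^ (1 : ℝ) :=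
                Real.rpow_le_rpow_of_exponent_le (by norm_num) (by linarith)
            _ = 8 := Real.rpow_one _
  push_cast
  calc ∑ q ∈ Finset.range (X * X * X), (σ q : ℝ)
      ≤ ∑ q ∈ Finset.range (X * X * X), C * (151 * y ^ 2) * (8 * y ^ (1 - ε)) := by
        refine Finset.sum_le_sum fun q _ => ?_
        exact (hσ q).trans (mul_le_mul (by gcongr) hpow (by positivity) (by positivity))
    _ = ((X : ℝ) * X * X) * (C * (151 * y ^ 2) * (8 * y ^ (1 - ε))) := by
        rw [Finset.sum_const, Finset.card_range, nsmul_eq_mul]; push_cast; ring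
    _ ≤ ((3 * y ^ 2) * (3 * y ^ 2) * (3 * y ^ 2)) * (C * (151 * y ^ 2) * (8 * y ^ (1 - ε))) := by
        gcongr
    _ = 27 * (C * 151 * 8) * (y ^ 8 * y ^ (1 - ε)) := by ring
    _ = 27 * (C * 151 * 8) * y ^ (9 - ε) := by
        rw [← Real.rpow_natCast, ← Real.rpow_add hy0]
        congr 2
        push_cast
        ring

theorem time_le {n B K T : ℕ} {y C ε : ℝ} (hy1 : 1 ≤ y) (hyn : (n : ℝ) = y ^ 3) (hC : 0 ≤ C)
    (hε : 0 < ε) (hε1 : ε ≤ 1) (hB0 : 1 ≤ B) (hB : B * B * B ≤ n)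
    (hB' : n < (B + 1) * (B + 1) * (B + 1)) {X : ℕ} (hX : X = n / B + 1) {σ : ℕ → ℕ}
    (hσ : ∀ q, (σ q : ℝ) ≤ C * (151 * (B : ℝ) ^ 2) * ((B * 8 : ℕ) : ℝ) ^ (1 - ε))
    (hT : T ≤ 3 * K * (n * 4 + 8 + X * X * X * (B * 8 * (B * 8) * 16 + 12)) +
      n * (3 * K * (X * X * (B * 28 + 39) + n * 3 + 7 + (B * B * 4 + 2) * n)) +
      30 * ∑ q ∈ Finset.range (X * X * X), σ q) :
    (T : ℝ) ≤ (3 * K * 40000 + 30 * (27 * (C * 151 * 8))) * y ^ (9 - ε) := by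
  obtain ⟨hBy, hXy⟩ := parameters_le hy1 hyn hB0 hB hB'
  rw [← hX] at hXy
  have hover := overhead_le hy1 hyn hBy hXy
  have hsum := sum_runs_le hy1 hC hε hε1 hBy hXy hσ
  -- The overhead is within the bound because `ε ≤ 1`.
  have hy8 : y ^ 8 ≤ y ^ (9 - ε) := by
    rw [← Real.rpow_natCast]
    refine Real.rpow_le_rpow_of_exponent_le hy1 ?_
    push_cast
    linarith
  set O := (n * 4 + 8 + X * X * X * (B * 8 * (B * 8) * 16 + 12)) +
    n * (X * X * (B * 28 + 39) + n * 3 + 7 + (B * B * 4 + 2) * n) with hO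
  have hT' : T ≤ 3 * K * O + 30 * ∑ q ∈ Finset.range (X * X * X), σ q :=
    hT.trans (le_of_eq (by rw [hO]; ring))
  calc (T : ℝ) ≤ ((3 * K * O + 30 * ∑ q ∈ Finset.range (X * X * X), σ q : ℕ) : ℝ) :=
        Nat.cast_le.2 hT'
    _ = 3 * K * (O : ℝ) + 30 * ((∑ q ∈ Finset.range (X * X * X), σ q : ℕ) : ℝ) := by
        rw [Nat.cast_add, Nat.cast_mul, Nat.cast_mul, Nat.cast_mul]; norm_num
    _ ≤ 3 * K * (40000 * y ^ (9 - ε)) + 30 * (27 * (C * 151 * 8) * y ^ (9 - ε)) := by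
        gcongr
        exact hover.trans (by gcongr)
    _ = (3 * K * 40000 + 30 * (27 * (C * 151 * 8))) * y ^ (9 - ε) := by ring

/-- The bound for the word length that is needed for one block. -/
theorem regionSize_le (c : ℕ) {B n : ℕ} (hB : B ≤ n) (hn : 1 ≤ n) :
    regionSize B c ≤ (n + 2) ^ (7 * c) := by
  rw [regionSize, pow_mul]
  refine Nat.pow_le_pow_left ?_ c
  have h1 : B * B ≤ (n + 2) * (n + 2) := Nat.mul_le_mul (by omega) (by omega)
  have h2 : 3 * (n + 2) ≤ (n + 2) * (n + 2) := Nat.mul_le_mul_right _ (by omega)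
  -- Five of the seven factors absorb the coefficients 8, 79 and 2.
  have h3 : 3 ^ 5 ≤ (n + 2) ^ 5 := Nat.pow_le_pow_left (by omega) 5
  have h4 : 3 ^ 5 * ((n + 2) * (n + 2)) ≤ (n + 2) ^ 5 * ((n + 2) * (n + 2)) :=
    Nat.mul_le_mul_right _ h3
  have h5 : (n + 2) ^ 7 = (n + 2) ^ 5 * ((n + 2) * (n + 2)) := by ring
  omega

theorem space_lt {n B X c : ℕ} (hn : 1 ≤ n) (hB : B ≤ n) (hX : X ≤ n + 1) :
    (1 + n * n + n + n + 32) + X * X * X * regionSize B c + regionSize B c <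
      (n + 2) ^ (7 * c + 12) := by
  have hS := regionSize_le c hB hn
  set m := n + 2 with hm
  set P := m ^ (7 * c) with hP
  have hm3 : 3 ≤ m := by omega
  have hP1 : 1 ≤ P := Nat.one_le_pow _ _ (by omega)
  have hX3 : X * X * X ≤ m * m * m :=
    Nat.mul_le_mul (Nat.mul_le_mul (by omega) (by omega)) (by omega)
  have h1 : X * X * X * regionSize B c ≤ m * m * m * P := Nat.mul_le_mul hX3 hS
  have e : m ^ (7 * c + 12) = m ^ 12 * P := by rw [pow_add, mul_comm]
  have h2 : 1 + n * n + n + n + 32 ≤ m * m + 32 := by nlinarith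
  have h3 : 3 ^ 9 * (m * m * m) ≤ m ^ 9 * (m * m * m) :=
    Nat.mul_le_mul_right _ (Nat.pow_le_pow_left hm3 9)
  have h4 : m ^ 12 = m ^ 9 * (m * m * m) := by ring
  have h5 : 3 * 3 * 3 ≤ m * m * m := Nat.mul_le_mul (Nat.mul_le_mul hm3 hm3) hm3
  have h6 : m * m * 3 ≤ m * m * m := Nat.mul_le_mul_left _ hm3
  have h7 : 3 ^ 9 * (m * m * m) * P ≤ m ^ 12 * P := Nat.mul_le_mul_right _ (by omega)
  have h8 : (m * m * m) * 1 ≤ (m * m * m) * P := Nat.mul_le_mul_left _ hP1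
  have h9 : 1 * P ≤ (m * m * m) * P := Nat.mul_le_mul_right _ (by omega)
  have h10 : 3 ^ 9 * (m * m * m) * P = 3 ^ 9 * (m * m * m * P) := by ring
  rw [e]
  omega

/-- The layout for a matrix. -/
def mkLayout {n : ℕ} (M : Fin n → Fin n → Bool) (B X c K : ℕ) : Layout where
  n := n
  mat := matSeq M
  S := regionSize B c
  cnt := X * X * X
  V := (n + 2) ^ (7 * c + 12)
  K := K

theorem fit_mkLayout {n : ℕ} (hn : 1 ≤ n) (M : Fin n → Fin n → Bool) {B X c K W : ℕ} (hB0 : 1 ≤ B)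
    (hB : B * B * B ≤ n) (hX : X = n / B + 1) (hK : 100 ≤ K) (hc : 1 ≤ c)
    (hW : W ≤ regionSize B c) : (mkLayout M B X c K).Fit W B X := by
  have hBn : B ≤ n := (Nat.le_mul_of_pos_right B (Nat.mul_pos hB0 hB0)).trans (by rwa [← mul_assoc])
  have hBB : B * B ≤ n := (Nat.le_mul_of_pos_right (B * B) hB0).trans hB
  have hXn : X ≤ n + 1 := by have := Nat.div_le_self n B; omega
  have hsp := space_lt (c := c) hn hBn hXn
  -- With `1 ≤ c` the region has room for the start matrix, whose size is `64 * B²`.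
  have hS : B * 8 + 79 * (B * B) + 2 ≤ regionSize B c := Nat.le_self_pow (by omega) _
  refine ⟨⟨hn, hsp, hK⟩, ⟨hW, ?_, ?_, ?_, by omega⟩, ?_, matSeq_le_one M, ?_, rfl⟩
  · refine le_trans ?_ hS
    have : B * 8 * (B * 8) = 64 * (B * B) := by ring
    omega
  · exact le_of_lt (lt_of_le_of_lt (Nat.le_add_left _ _) hsp)
  · change B * 8 < (n + 2) ^ (7 * c + 12)
    omega
  · change B * B + 1 < (n + 2) ^ (7 * c + 12)
    omega
  · intro J hJ
    have : J / B ≤ n / B := Nat.div_le_div_right (le_of_lt hJ)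
    omega

theorem Network.numEdges_le {n : ℕ} (cap : Network n) : cap.numEdges ≤ n * n := by
  refine (Finset.card_le_univ _).trans ?_
  simp

/-! ### From a flow algorithm to an algorithm for OMv -/

namespace DynFlowAlgorithm

variable {A : DynFlowAlgorithm} {mode : DynMode} {g : GraphClass}

/-- The data structure of a block is handled in the time that the dynamic algorithm promises. -/
theorem exists_block_run (hg : ∀ k, g = .weightedUndirected k → 1 ≤ k) {c : ℕ} {C e : ℝ}
    (hC : 0 ≤ C)
    (hA : ∀ (n : ℕ) (s t : Fin n), s ≠ t → ∀ cap : Network n, mode.IsStart g cap →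
      ∀ rs : List (FlowRequest n), mode.Legal g cap rs → ∃ (m : RamMem) (τ T : ℕ),
      RamExec ((n + rs.length + 2) ^ c) A.init (initMem cap s t) m τ ∧
      A.Handles g ((n + rs.length + 2) ^ c) s t cap m rs T ∧
      ((τ + T : ℕ) : ℝ) ≤ C * ((n + cap.numEdges + rs.length : ℕ) : ℝ) * (n : ℝ) ^ e)
    {B : ℕ} [NeZero B] {D : BlockData B} (hD : D.Bounded) :
    ∃ (μ : RamMem) (τ₀ τ₁ : ℕ),
      RamExec (regionSize B c) A.init (initMem (startCap B g mode) (vx 0 0) (vx 1 0)) μ τ₀ ∧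
      A.Handles g (regionSize B c) (vx 0 0) (vx 1 0) (startCap B g mode) μ (D.reqs mode g) τ₁ ∧
      ((τ₀ + τ₁ : ℕ) : ℝ) ≤ C * (151 * (B : ℝ) ^ 2) * ((B * 8 : ℕ) : ℝ) ^ e := by
  have hB : 1 ≤ B := NeZero.pos B
  obtain ⟨μ, τ₀, τ₁, h1, h2, h3⟩ := hA (B * 8) (vx 0 0) (vx 1 0)
    (fun h => absurd (vx_injective.1 h).1 (by decide)) _ (isStart_startCap hg mode) _
    (legal_reqs hg hD)
  have hlen := length_reqs_le (mode := mode) (g := g) D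
  have hW : (B * 8 + (D.reqs mode g).length + 2) ^ c ≤ regionSize B c :=
    Nat.pow_le_pow_left (by omega) c
  refine ⟨μ, τ₀, τ₁, h1.mono hW, h2.mono hW, h3.trans ?_⟩
  have hE := (startCap B g mode).numEdges_le
  have hBB : B ≤ B * B := Nat.le_mul_of_pos_right _ hB
  -- Vertices, start edges and requests contribute at most `8`, `64` and `79` times `B * B`.
  have hsum : B * 8 + (startCap B g mode).numEdges + (D.reqs mode g).length ≤ 151 * (B * B) := by
    have : B * 8 * (B * 8) = 64 * (B * B) := by ring
    omega
  have hsum' : ((B * 8 + (startCap B g mode).numEdges + (D.reqs mode g).length : ℕ) : ℝ) ≤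
      151 * (B : ℝ) ^ 2 := by
    rw [pow_two]; exact_mod_cast hsum
  gcongr

/-- The saving of `ε` in the exponent for instances of size about `n^(1/3)` becomes a saving of `ε /
3` in terms of `n`. -/
theorem exists_omv (hg : ∀ k, g = .weightedUndirected k → 1 ≤ k) {ε : ℝ} (hε : 0 < ε)
    (hε1 : ε ≤ 1) (hA : A.SolvesInAmortizedTime mode g (1 - ε)) :
    ∃ A' : OMvAlgorithm, A'.SolvesInTime (3 - ε / 3) := by
  obtain ⟨c₀, C₀, hA⟩ := hA
  -- A positive exponent guarantees that a region can hold the input of its instance. Enlarging the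
  -- word bound is harmless.
  set c := c₀ + 1 with hc
  set C := max C₀ 0 with hCdef
  have hC : 0 ≤ C := le_max_right _ _
  have hA' : ∀ (n : ℕ) (s t : Fin n), s ≠ t → ∀ cap : Network n, mode.IsStart g cap →
      ∀ rs : List (FlowRequest n), mode.Legal g cap rs → ∃ (m : RamMem) (τ T : ℕ),
      RamExec ((n + rs.length + 2) ^ c) A.init (initMem cap s t) m τ ∧
      A.Handles g ((n + rs.length + 2) ^ c) s t cap m rs T ∧
      ((τ + T : ℕ) : ℝ) ≤ C * ((n + cap.numEdges + rs.length : ℕ) : ℝ) * (n : ℝ) ^ (1 - ε) := by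
    intro n s t hst cap hcap rs hrs
    obtain ⟨m, τ, T, h1, h2, h3⟩ := hA n s t hst cap hcap rs hrs
    have hW : (n + rs.length + 2) ^ c₀ ≤ (n + rs.length + 2) ^ c :=
      Nat.pow_le_pow_right (by omega) (by omega)
    refine ⟨m, τ, T, h1.mono hW, h2.mono hW, h3.trans ?_⟩
    gcongr
    exact le_max_left _ _
  -- This depends on the programs alone and not on `n`, so the time bound has a constant factor and
  -- the word bound `L.V ^ K` is polynomial in `n`.
  set K := max 100 (max (A.roundProg mode g.beta).weight (A.preProg mode g.beta c).weight) with hK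
  refine ⟨A.toOMv mode g c, (7 * c + 12) * K,
    3 * K * 40000 + 30 * (27 * (C * 151 * 8)), fun n hn M v => ?_⟩
  obtain ⟨B, hB, hB'⟩ := exists_cubeRoot n
  have hB0 : 1 ≤ B := by
    by_contra h
    have : B = 0 := by omega
    subst this
    omega
  have : NeZero B := ⟨by omega⟩
  set X := n / B + 1 with hX
  set L := mkLayout M B X c K with hL
  have hfit : L.Fit (regionSize B c) B X :=
    fit_mkLayout hn M hB0 hB hX (le_max_left _ _) (by omega) le_rfl
  have hBn : B ≤ n := (Nat.le_mul_of_pos_right B (Nat.mul_pos hB0 hB0)).trans (by rwa [← mul_assoc])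
  have hXn : X ≤ n + 1 := by have := Nat.div_le_self n B; omega
  have hsp := space_lt (c := c) hn hBn hXn
  -- The runs are taken for the complete request sequences, with all vectors known; vectors beyond
  -- the last round are zero. The simulation then follows these runs.
  have hrun : ∀ q, ∃ (μ : RamMem) (τ₀ τ₁ : ℕ),
      RamExec (regionSize B c) A.init (initMem (startCap B g mode) (vx 0 0) (vx 1 0)) μ τ₀ ∧
      A.Handles g (regionSize B c) (vx 0 0) (vx 1 0) (startCap B g mode) μ
        ((dataOf n (matSeq M) (vecSeq v) B X q).reqs mode g) τ₁ ∧
      ((τ₀ + τ₁ : ℕ) : ℝ) ≤ C * (151 * (B : ℝ) ^ 2) * ((B * 8 : ℕ) : ℝ) ^ (1 - ε) := fun q =>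
    exists_block_run hg hC hA'
      (blockData_bounded (matSeq_le_one M) (vecSeq_le_one v) _ _ _ _ _)
  choose μ τ₀ τ₁ h1 h2 h3 using hrun
  obtain ⟨m, t, T, he, ha, hle⟩ := solves (A := A) (mode := mode) (g := g) (L := L) M v rfl rfl
    hfit hg (c := c) ((le_max_left _ _).trans (le_max_right _ _))
    ((le_max_right _ _).trans (le_max_right _ _)) (by change n + 1 < (n + 2) ^ (7 * c + 12); omega)
    (lt_of_le_of_lt (Nat.le_add_left _ _) hsp) hB hB' hX rfl (fun q _ => h1 q) (fun q _ => h2 q)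
  have hWeq : L.W = (n + 2) ^ ((7 * c + 12) * K) := (pow_mul _ _ _).symm
  rw [hWeq] at he ha
  refine ⟨m, t, T, he, ha, ?_⟩
  obtain ⟨y, hy1, hyn, hy9⟩ := exists_real_cubeRoot hn ε
  rw [hy9]
  exact time_le hy1 hyn hC hε hε1 hB0 hB hB' hX h3 hle

/-- A shorter running time is also a longer one. -/
theorem SolvesInAmortizedTime.mono {e e' : ℝ} (h : A.SolvesInAmortizedTime mode g e)
    (hee : e ≤ e') : A.SolvesInAmortizedTime mode g e' := by
  obtain ⟨c, C, hA⟩ := h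
  refine ⟨c, max C 0, fun n s t hst cap hcap rs hrs => ?_⟩
  obtain ⟨m, τ, T, h1, h2, h3⟩ := hA n s t hst cap hcap rs hrs
  have hn : (1 : ℝ) ≤ n := by exact_mod_cast s.pos
  refine ⟨m, τ, T, h1, h2, h3.trans ?_⟩
  have : 0 ≤ max C 0 := le_max_right _ _
  calc C * ((n + cap.numEdges + rs.length : ℕ) : ℝ) * (n : ℝ) ^ e
      ≤ max C 0 * ((n + cap.numEdges + rs.length : ℕ) : ℝ) * (n : ℝ) ^ e := by
        gcongr
        exact le_max_left _ _
    _ ≤ _ := by gcongr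

theorem not_solves (hOMv : OMvConjecture) (mode : DynMode) {ε : ℝ} (hε : 0 < ε) {g : GraphClass}
    (hg : ∀ k, g = .weightedUndirected k → 1 ≤ k) :
    ¬ ∃ A : DynFlowAlgorithm, A.SolvesInAmortizedTime mode g (1 - ε) := by
  rintro ⟨A, hA⟩
  -- Larger `ε` are reduced to `1`, so that `1 - ε` is nonnegative and the overhead does not
  -- dominate.
  have hδ : 0 < min ε 1 := lt_min hε one_pos
  have hA' : A.SolvesInAmortizedTime mode g (1 - min ε 1) :=
    hA.mono (by linarith [min_le_left ε 1])
  exact hOMv (min ε 1 / 3) (by positivity) (exists_omv hg hδ (min_le_right _ _) hA')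

end DynFlowAlgorithm

theorem theorem3 (hOMv : OMvConjecture) (mode : DynMode) (ε : ℝ) (hε : 0 < ε) :
    (¬ ∃ A : DynFlowAlgorithm, A.SolvesInAmortizedTime mode .unweightedDirected (1 - ε)) ∧
    (∀ k : ℕ, 1 ≤ k →
      ¬ ∃ A : DynFlowAlgorithm, A.SolvesInAmortizedTime mode (.weightedUndirected k) (1 - ε)) :=
  ⟨DynFlowAlgorithm.not_solves hOMv mode hε (fun _ h => nomatch h),
    fun _ hk => DynFlowAlgorithm.not_solves hOMv mode hε (fun _ h => by cases h; exact hk)⟩
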